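/- **Setting.** Let $A$ be a commutative $\mathbb C$-algebra (of scalar functions of $t=(t_1=x,t_3,t_5,\dots)$) with commuting derivations $\partial_{t_{2k+1}}$, $k\ge 0$, and $\partial=\partial_x=\partial_{t_1}$. $Z_N$-valued functions are the elements of $R=A[\Gamma]/(\Gamma^N)$, derivations acting coefficientwise in $\Gamma$. For $u,v\in R$ let $$L=L(u,v)=\partial+u\,\partial^{-1}v_x-v\,\partial^{-1}u_x ,$$ a pseudo-differential operator over $R$; $P_\pm$ denote differential and integral parts and $P^*$ the formal adjoint. The *constrained CMBKP hierarchy* is the system $u_{t_{2k+1}}=(L^{2k+1})_+u$, $v_{t_{2k+1}}=(L^{2k+1})_+v$ for all $k\ge0$. **(1) $N=2$.** For $u=q+p\Gamma$, $v=r+s\Gamma$ the $t_3$-equations of the hierarchy are equivalent to $$\begin{aligned} q_{t_3}&=q_{xxx}+3(qr_x-rq_x)q_x,\\ p_{t_3}&=p_{xxx}+3\big[(qr_x-rq_x)p_x+(pr_x+qs_x-sq_x-rp_x)q_x\big],\\ r_{t_3}&=r_{xxx}+3(qr_x-rq_x)r_x,\\ s_{t_3}&=s_{xxx}+3\big[(qr_x-rq_x)s_x+(pr_x+qs_x-sq_x-rp_x)r_x\big].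 \end{aligned}$$ For $q=r$, $p=s$ they are equivalent to $q_{t_3}=q_{xxx}$, $p_{t_3}=p_{xxx}$; for $r=s=1$ they are equivalent to the coupled KdV-like system $q_{t_3}=q_{xxx}-3q_x^2$, $p_{t_3}=p_{xxx}-6q_xp_x-3q_x^2$. **(2) Gauge transformations.** Let $\mathcal B\subseteq R$ be a subalgebra and $\mathcal V\subseteq\mathcal B$ an ideal of $\mathcal B$, both stable under all $\partial_{t_{2k+1}}$, such that $\partial:\mathcal V\to\mathcal V$ is bijective; $\int:\mathcal V\to\mathcal V$ is its inverse (for instance $\int_{-\infty}^x$ on functions that decay exponentially with their derivatives as $x\to-\infty$). Let $u\in\mathcal V$, $v\in\mathcal B$ solve the constrained hierarchy. For $f\in\mathcal V$ put $L\cdot f=f_x+u\int v_xf-v\int u_xf$, and let $\phi^{(j)}=L^j\cdot u$, $\psi^{(j)}=\phi^{(j)}_x$. The generalized Wronskian $GW_{k,n}(g_{k-1},\dots,g_0;f_0,\dots,f_{n-1})$, $k\le n$, is the determinant of the $n\times n$ matrix over $R$ with rows $(\int g_{k-1}f_c)_c,\dots,(\int g_0f_c)_c,(f_c)_c,(f_c')_c,\dots,(f_c^{(n-k-1)})_c$.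 Write $GW_n=GW_{n,n}(\psi^{(n-1)},\dots,\psi^{(1)},u_x;u,\phi^{(1)},\dots,\phi^{(n-1)})$ and $$u^{(n+n)}=\frac{GW_{n,n+1}(\psi^{(n-1)},\dots,\psi^{(1)},u_x;u,\phi^{(1)},\dots,\phi^{(n)})}{GW_n},\qquad v^{(n+n)}=\frac{(-1)^n\,GW_{n-1,n}(\psi^{(n-2)},\dots,\psi^{(1)},u_x;u,\phi^{(1)},\dots,\phi^{(n-1)})}{GW_n}.$$ Let $n\ge1$ and assume that $GW_1,\dots,GW_n$ are invertible in $R$. With $T_D(\phi)=\phi\circ\partial\circ\phi^{-1}$, $T_I(\psi)=\psi^{-1}\circ\partial^{-1}\circ\psi$ let $W_0=1$, $W_{k+1}=T_I(\psi_{k+1})\circ T_D(\phi_{k+1})\circ W_k$, where $\phi_{k+1}=u^{(k+k)}$ ($u^{(0+0)}=u$) and $\psi_{k+1}=-\tfrac12\phi_{k+1}$. Then: * $(u^{(n+n)},v^{(n+n)})$ solves the constrained hierarchy, and $L'=L(u^{(n+n)},v^{(n+n)})$ satisfies the B type condition $L'^*=-\partial L'\partial^{-1}$ and the Lax equations $\partial_{t_{2k+1}}L'=[(L'^{2k+1})_+,L']$.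 * $W_n=1+O(\partial^{-1})$ is a gauge transformation from $L$ to $L'$: $L'=W_nLW_n^{-1}$, $W_n^*=\partial W_n^{-1}\partial^{-1}$, and $(W_n)_{t_{2k+1}}=(L'^{2k+1})_+W_n-W_n(L^{2k+1})_+$. * If $\Phi=1+\sum_{i\ge1}a_i\partial^{-i}$ is a dressing operator of $L$ ($L=\Phi\partial\Phi^{-1}$, $\Phi^*=\partial\Phi^{-1}\partial^{-1}$, $\Phi_{t_{2k+1}}=-(L^{2k+1})_-\Phi$), then $W_n\Phi$ is a dressing operator of $L'$. Let $w=\Phi e^{\xi}$, $\xi=\sum_k t_{2k+1}z^{2k+1}$, be the wave function and $[z]=(z,z^3/3,z^5/5,\dots)$. If an invertible $\tau_c$ is a tau function of the constrained hierarchy in the normalization $w(t;z)^2=\dfrac{\tau_c(t-2[z^{-1}])}{\tau_c(t)}e^{2\xi}$, then $$\tau_c^{(n+n)}=GW_n\,\tau_c$$ is such a tau function for $W_n\Phi$. Equivalently for $\tau_c=\tau^2$: if an invertible $\tau$ satisfies $w=\dfrac{\tau(t-2[z^{-1}])}{\tau(t)}e^{\xi}$, then every $\sigma$ with $\sigma^2=GW_n\,\tau^2$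 satisfies this relation for $W_n\Phi$. Here $f(t-2[z^{-1}])$ is the power series $\exp\big(-2\sum_{j\ \mathrm{odd}}\tfrac{z^{-j}}{j}\partial_{t_j}\big)f$ in $z^{-1}$. -/

import Mathlib

open Polynomial

noncomputable section

namespace CMBKP

/-! ## Pseudo-differential operators with coefficients in a differential algebra -/

section PDO

variable {R : Type*} [CommRing R] [Algebra ℂ R]

/-- A pseudo-differential operator `∑_{m ≤ n} coeff m ∂^m` over the commutative differential
algebra `(R, δ)`; the symbol `∂` stands for `δ`. -/
@[ext]
structure PDO (δ : Derivation ℂ R R) where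
  /-- `coeff m` is the coefficient standing to the left of `∂^m`. -/
  coeff : ℤ → R
  bdd : ∃ n : ℤ, ∀ m, n < m → coeff m = 0

namespace PDO

variable {δ : Derivation ℂ R R}

/-- The operator `f ∂^i`. -/
def single (δ : Derivation ℂ R R) (i : ℤ) (f : R) : PDO δ where
  coeff m := if m = i then f else 0
  bdd := ⟨i, fun _ hm => if_neg (ne_of_gt hm)⟩

/-- The operator of multiplication by `f`. -/
def mulOp (δ : Derivation ℂ R R) (f : R) : PDO δ := single δ 0 f

/-- The operator `∂^i`, for any integer `i`. -/
def del (δ : Derivation ℂ R R) (i : ℤ) : PDO δ := single δ i 1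

instance : One (PDO δ) := ⟨mulOp δ 1⟩

instance : Add (PDO δ) where
  add P Q :=
    { coeff := fun m => P.coeff m + Q.coeff m
      bdd := by
        obtain ⟨a, ha⟩ := P.bdd
        obtain ⟨b, hb⟩ := Q.bdd
        refine ⟨max a b, fun m hm => ?_⟩
        rw [ha m (lt_of_le_of_lt (le_max_left a b) hm),
          hb m (lt_of_le_of_lt (le_max_right a b) hm), add_zero] }

instance : Neg (PDO δ) where
  neg P :=
    { coeff := fun m => -P.coeff m
      bdd := by
        obtain ⟨a, ha⟩ := P.bdd
        exact ⟨a, fun m hm => by rw [ha m hm, neg_zero]⟩ }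

instance : Sub (PDO δ) := ⟨fun P Q => P + -Q⟩

/-- Composition, from the generalized Leibniz rule
`∂^i ∘ b = ∑_{k ≥ 0} (i choose k) b^{(k)} ∂^{i-k}`, for any integer `i`.
Each coefficient is a finite sum. -/
instance : Mul (PDO δ) where
  mul P Q :=
    { coeff := fun m => ∑ᶠ x : ℤ × ℕ,
        Ring.choose x.1 x.2 • (P.coeff x.1 * δ^[x.2] (Q.coeff (m - x.1 + x.2)))
      bdd := by
        obtain ⟨a, ha⟩ := P.bdd
        obtain ⟨b, hb⟩ := Q.bdd
        refine ⟨a + b, fun m hm => finsum_eq_zero_of_forall_eq_zero ?_⟩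
        rintro ⟨i, k⟩
        by_cases hi : a < i
        · simp [ha i hi]
        · have h : Q.coeff (m - i + k) = 0 := hb _ (by omega)
          have h0 : δ^[k] (0 : R) = 0 := Function.iterate_fixed (map_zero δ) k
          simp [h, h0] }

/-- Powers `P^n`. -/
def pow (P : PDO δ) : ℕ → PDO δ
  | 0 => 1
  | n + 1 => pow P n * P

/-- The differential part `P_+`. -/
def pos (P : PDO δ) : PDO δ where
  coeff m := if 0 ≤ m then P.coeff m else 0
  bdd := by
    obtain ⟨a, ha⟩ := P.bdd
    exact ⟨a, fun m hm => by simp [ha m hm]⟩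

/-- The integral part `P_-`. -/
def neg (P : PDO δ) : PDO δ where
  coeff m := if m < 0 then P.coeff m else 0
  bdd := by
    obtain ⟨a, ha⟩ := P.bdd
    exact ⟨a, fun m hm => by simp [ha m hm]⟩

/-- The formal adjoint `P^* = ∑ (-1)^i ∂^i ∘ p_i`. -/
def adjoint (P : PDO δ) : PDO δ where
  coeff m := ∑ᶠ k : ℕ,
    ((m + k).negOnePow * Ring.choose (m + k) k : ℤ) • δ^[k] (P.coeff (m + k))
  bdd := by
    obtain ⟨a, ha⟩ := P.bdd
    refine ⟨a, fun m hm => finsum_eq_zero_of_forall_eq_zero fun k => ?_⟩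
    have h : P.coeff (m + k) = 0 := ha _ (by omega)
    have h0 : δ^[k] (0 : R) = 0 := Function.iterate_fixed (map_zero δ) k
    simp [h, h0]

/-- The derivation `e` applied to every coefficient: the derivative of an operator with respect to
a parameter. -/
def diff (e : Derivation ℂ R R) (P : PDO δ) : PDO δ where
  coeff m := e (P.coeff m)
  bdd := by
    obtain ⟨a, ha⟩ := P.bdd
    exact ⟨a, fun m hm => by rw [ha m hm, map_zero]⟩

/-- The value at the function `f` of the differential operator `P = P_+`. -/
def apply (P : PDO δ) (f : R) : R := ∑ᶠ j : ℕ, P.coeff j * δ^[j] f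

end PDO

end PDO

/-! ## The hierarchy

A commutative algebra `R` of functions of the times `t = (t₁ = x, t₃, t₅, …)` carries the
derivations `d k = ∂/∂t_{2k+1}`; in particular `∂ = ∂/∂x = d 0`. -/

section Hierarchy

variable {R : Type*} [CommRing R] [Algebra ℂ R] (d : ℕ → Derivation ℂ R R)

/-- The operator `∂ + u ∂⁻¹ v_x - v ∂⁻¹ u_x`. -/
def laxOp (u v : R) : PDO (d 0) :=
  PDO.del (d 0) 1 + PDO.mulOp (d 0) u * PDO.del (d 0) (-1) * PDO.mulOp (d 0) (d 0 v)
    - PDO.mulOp (d 0) v * PDO.del (d 0) (-1) * PDO.mulOp (d 0) (d 0 u)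

/-- `(L^{2k+1})_+`. -/
def flowOp (L : PDO (d 0)) (k : ℕ) : PDO (d 0) := (L.pow (2 * k + 1)).pos

/-- The `t_{2k+1}`-Sato equations `u_t = (L^{2k+1})_+ u`, `v_t = (L^{2k+1})_+ v` for
`L = ∂ + u ∂⁻¹ v_x - v ∂⁻¹ u_x`. -/
def SatoFlow (k : ℕ) (u v : R) : Prop :=
  d k u = (flowOp d (laxOp d u v) k).apply u ∧ d k v = (flowOp d (laxOp d u v) k).apply v

/-- `(u, v)` is a solution of the constrained hierarchy. -/
def IsConstrainedSolution (u v : R) : Prop := ∀ k, SatoFlow d k u v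

/-- `L = ∂ + ∑_{i ≥ 1} u_i ∂^{-i}` satisfies the B type condition `L^* = -∂ L ∂⁻¹` and the Lax
equations `∂L/∂t_{2k+1} = [(L^{2k+1})_+, L]`. -/
structure IsLaxSolution (L : PDO (d 0)) : Prop where
  coeff_of_one_lt : ∀ m, 1 < m → L.coeff m = 0
  coeff_one : L.coeff 1 = 1
  coeff_zero : L.coeff 0 = 0
  bType : L.adjoint = -(PDO.del (d 0) 1 * L * PDO.del (d 0) (-1))
  lax : ∀ k, L.diff (d k) = flowOp d L k * L - L * flowOp d L k

/-- `W` is a gauge transformation from `L` to `L' = W L W⁻¹` that preserves the B type condition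
(`W^* = ∂ W⁻¹ ∂⁻¹`) and the flows (`W_t = -W (L^{2k+1})_+ + (W L^{2k+1} W⁻¹)_+ W`).
A `W` of the form `1 + O(∂⁻¹)` is invertible. -/
structure IsGaugeTransformation (L L' W : PDO (d 0)) : Prop where
  coeff_of_pos : ∀ m, 0 < m → W.coeff m = 0
  coeff_zero : W.coeff 0 = 1
  conj : L' * W = W * L
  bType : W.adjoint * PDO.del (d 0) 1 * W = PDO.del (d 0) 1
  flow : ∀ k, W.diff (d k) = flowOp d L' k * W - W * flowOp d L k

/-- `Φ = 1 + ∑_{i ≥ 1} a_i ∂^{-i}` is a dressing operator of the solution `L` of the hierarchy: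
`L = Φ ∂ Φ⁻¹`, `Φ^* = ∂ Φ⁻¹ ∂⁻¹` and `∂Φ/∂t_{2k+1} = -(L^{2k+1})_- Φ`. -/
structure IsDressing (L Φ : PDO (d 0)) : Prop where
  coeff_of_pos : ∀ m, 0 < m → Φ.coeff m = 0
  coeff_zero : Φ.coeff 0 = 1
  conj : L * Φ = Φ * PDO.del (d 0) 1
  bType : Φ.adjoint * PDO.del (d 0) 1 * Φ = PDO.del (d 0) 1
  flow : ∀ k, Φ.diff (d k) = -((L.pow (2 * k + 1)).neg * Φ)

/-! ### Tau functions -/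

/-- The operator series `-2 ∑_{j odd} (z^{-j} / j) ∂/∂t_j`, with the power series variable `X`
in the role of `z⁻¹`. -/
def shiftExponent : PowerSeries (Module.End ℂ R) :=
  PowerSeries.mk fun j =>
    if Odd j then (-(2 / (j : ℂ))) • ((d (j / 2) : Derivation ℂ R R) : R →ₗ[ℂ] R) else 0

/-- The coefficient of `z^{-m}` in
`f(t - 2[z⁻¹]) = exp(-2 ∑_{j odd} (z^{-j} / j) ∂/∂t_j) f`, where `[z] = (z, z³/3, z⁵/5, …)`. -/
def shiftCoeff (m : ℕ) (f : R) : R :=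
  ∑ j ∈ Finset.range (m + 1),
    ((j.factorial : ℂ)⁻¹) • (PowerSeries.coeff m (shiftExponent d ^ j)) f

/-- `τ` is a tau function: the wave function
`w(t; z) = Φ e^{ξ(t; z)} = (1 + ∑ a_i z^{-i}) e^{ξ(t; z)}` equals
`τ(t - 2[z⁻¹]) / τ(t) · e^{ξ(t; z)}`. -/
structure IsTau (Φ : PDO (d 0)) (τ : R) : Prop where
  unit : IsUnit τ
  wave : ∀ m : ℕ, τ * Φ.coeff (-(m : ℤ)) = shiftCoeff d m τ

/-- `τ` is a tau function in the quadratic normalization: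
`w(t; z)² = τ(t - 2[z⁻¹]) / τ(t) · e^{2 ξ(t; z)}`. -/
structure IsTauC (Φ : PDO (d 0)) (τ : R) : Prop where
  unit : IsUnit τ
  wave : ∀ m : ℕ,
    τ * ∑ i ∈ Finset.range (m + 1), Φ.coeff (-(i : ℤ)) * Φ.coeff (-((m : ℤ) - i))
      = shiftCoeff d m τ

/-! ### Integration and generalized Wronskians -/

/-- A class of functions on which the integral `∫ … dx` is defined: an algebra `reg` of functions,
and in it an ideal `dec` of functions on which `∂ = ∂/∂x` is bijective, both stable under all
derivations. (For instance `reg` can consist of smooth functions all of whose derivatives are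
bounded as `x → -∞`, `dec` of those decaying exponentially with all derivatives, locally uniformly
in the other times, and `∫` is then the integral from `-∞` to `x`.) Elements of `reg` need not
have their inverses in `reg`. -/
structure IntegrationClass where
  reg : Subalgebra ℂ R
  dec : Submodule ℂ R
  dec_le : ∀ f ∈ dec, f ∈ reg
  mul_mem : ∀ b ∈ reg, ∀ f ∈ dec, b * f ∈ dec
  d_reg : ∀ k, ∀ b ∈ reg, d k b ∈ reg
  d_dec : ∀ k, ∀ f ∈ dec, d k f ∈ dec
  bijOn : Set.BijOn (d 0) dec dec

namespace IntegrationClass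

variable {d}
variable (J : IntegrationClass d)

/-- `∫ f dx`: the antiderivative in `J.dec` of a function of `J.dec`. -/
def integral (f : R) : R := Function.invFunOn (d 0) J.dec f

/-- The generalized Wronskian `GW_{k,n}(g_{k-1}, …, g_0; f_0, …, f_{n-1})`: the rows are
`(∫ g_{k-1} f_c)_c, …, (∫ g_0 f_c)_c, (f_c)_c, (f_c')_c, …, (f_c^{(n-k-1)})_c`. -/
def GW (k n : ℕ) (g f : ℕ → R) : R :=
  Matrix.det (Matrix.of fun r c : Fin n =>
    if (r : ℕ) < k then J.integral (g (k - 1 - r) * f c) else (d 0)^[(r : ℕ) - k] (f c))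

/-- The action of `L = ∂ + u ∂⁻¹ v_x - v ∂⁻¹ u_x` on a function, with `∂⁻¹ = ∫`. -/
def laxAct (u v f : R) : R :=
  d 0 f + u * J.integral (d 0 v * f) - v * J.integral (d 0 u * f)

/-- `φ^{(j)} = L^j u`. -/
def phi (u v : R) (j : ℕ) : R := (J.laxAct u v)^[j] u

/-- `ψ^{(j)} = (φ^{(j)})_x`; in particular `ψ^{(0)} = u_x`. -/
def psi (u v : R) (j : ℕ) : R := d 0 (J.phi u v j)

/-- `GW_{n,n}(ψ^{(n-1)}, …, ψ^{(1)}, u_x; u, φ^{(1)}, …, φ^{(n-1)})`. -/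
def tauFactor (u v : R) (n : ℕ) : R := J.GW n n (J.psi u v) (J.phi u v)

/-- `u^{(n+n)} = GW_{n,n+1}(ψ^{(n-1)}, …, u_x; u, φ^{(1)}, …, φ^{(n)}) / GW_{n,n}`. -/
def uNew (u v : R) (n : ℕ) : R :=
  J.GW n (n + 1) (J.psi u v) (J.phi u v) * Ring.inverse (J.tauFactor u v n)

/-- `v^{(n+n)} = (-1)^n GW_{n-1,n}(ψ^{(n-2)}, …, u_x; u, φ^{(1)}, …, φ^{(n-1)}) / GW_{n,n}`,
for `n ≥ 1`. -/
def vNew (u v : R) (n : ℕ) : R :=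
  (-1) ^ n * J.GW (n - 1) n (J.psi u v) (J.phi u v) * Ring.inverse (J.tauFactor u v n)

end IntegrationClass

/-! ### Gauge transformation operators -/

/-- `T_D(φ) = φ ∘ ∂ ∘ φ⁻¹`. -/
def TD (φ : R) : PDO (d 0) :=
  PDO.mulOp (d 0) φ * PDO.del (d 0) 1 * PDO.mulOp (d 0) (Ring.inverse φ)

/-- `T_I(ψ) = ψ⁻¹ ∘ ∂⁻¹ ∘ ψ`. -/
def TI (ψ : R) : PDO (d 0) :=
  PDO.mulOp (d 0) (Ring.inverse ψ) * PDO.del (d 0) (-1) * PDO.mulOp (d 0) ψ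

variable {d}

/-- The iterated gauge operator
`W_n = T_I(ψ_n) ∘ T_D(φ_n) ∘ ⋯ ∘ T_I(ψ_1) ∘ T_D(φ_1)`. The generating function `φ_{k+1}` of the
step from `(u^{(k+k)}, v^{(k+k)})` is `φ_{k+1} = u^{(k+k)}`, and the B type constraint makes
`ψ_{k+1} = -φ_{k+1}⁻¹ ∫ φ_{k+1} (φ_{k+1})_x = -φ_{k+1} / 2`. -/
def IntegrationClass.gaugeOp (J : IntegrationClass d) (u v : R) : ℕ → PDO (d 0)
  | 0 => 1
  | k + 1 => TI d (-((1 / 2 : ℂ) • J.uNew u v k)) * TD d (J.uNew u v k) * J.gaugeOp u v k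

end Hierarchy

/-! ## The algebra `Z_N` -/

section ZN

variable {A : Type*} [CommRing A] [Algebra ℂ A]

/-- The `Z_N`-valued functions, `Z_N = ℂ[Γ]/(Γ^N)`, when `A` is the algebra of scalar functions:
`A[Γ]/(Γ^N)`. -/
abbrev ZN (N : ℕ) (A : Type*) [CommRing A] : Type _ := AdjoinRoot ((X : A[X]) ^ N)

/-- The generator `Γ` of `Z_N`. -/
def Gam (N : ℕ) (A : Type*) [CommRing A] : ZN N A := AdjoinRoot.root ((X : A[X]) ^ N)

/-- A scalar function as a `Z_N`-valued function. -/
def scal (N : ℕ) (a : A) : ZN N A := AdjoinRoot.of ((X : A[X]) ^ N) a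

/-- The derivation of `A[Γ]` that acts on the coefficients. -/
def coeffDer (D : Derivation ℂ A A) : Derivation ℂ A[X] A[X] :=
  PolynomialModule.equivPolynomialSelf.compDer D.mapCoeffs

theorem coeffDer_coeff (D : Derivation ℂ A A) (p : A[X]) (i : ℕ) :
    (coeffDer D p).coeff i = D (p.coeff i) := rfl

theorem mk_coeffDer_eq_zero (N : ℕ) (D : Derivation ℂ A A) (p : A[X])
    (hp : (AdjoinRoot.mkₐ ((X : A[X]) ^ N)).restrictScalars ℂ p = 0) :
    (AdjoinRoot.mkₐ ((X : A[X]) ^ N)).restrictScalars ℂ (coeffDer D p) = 0 := by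
  have hp' : AdjoinRoot.mk ((X : A[X]) ^ N) p = 0 := hp
  rw [AdjoinRoot.mk_eq_zero, X_pow_dvd_iff] at hp'
  change AdjoinRoot.mk ((X : A[X]) ^ N) (coeffDer D p) = 0
  rw [AdjoinRoot.mk_eq_zero, X_pow_dvd_iff]
  intro m hm
  rw [coeffDer_coeff, hp' m hm, map_zero]

/-- The derivation of `A[Γ]/(Γ^N)` that acts on the coefficients with respect to `Γ`. -/
def znDer (N : ℕ) (D : Derivation ℂ A A) : Derivation ℂ (ZN N A) (ZN N A) :=
  Derivation.liftOfSurjective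
    (f := (AdjoinRoot.mkₐ ((X : A[X]) ^ N)).restrictScalars ℂ)
    AdjoinRoot.mk_surjective (d := coeffDer D) (mk_coeffDer_eq_zero N D)

theorem znDer_mk (N : ℕ) (D : Derivation ℂ A A) (p : A[X]) :
    znDer N D (AdjoinRoot.mk ((X : A[X]) ^ N) p)
      = AdjoinRoot.mk ((X : A[X]) ^ N) (coeffDer D p) :=
  Derivation.liftOfSurjective_apply
    (f := (AdjoinRoot.mkₐ ((X : A[X]) ^ N)).restrictScalars ℂ)
    AdjoinRoot.mk_surjective (mk_coeffDer_eq_zero N D) p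

end ZN

end CMBKP

end

/-! ### The ring of pseudo-differential operators. -/

noncomputable section

namespace CMBKP

namespace PDO

section Ring

variable {R : Type*} [CommRing R] [Algebra ℂ R] {δ : Derivation ℂ R R}

/-! ### The additive structure -/

/-! Everything rests on one elementary gauge transformation. For invertible `u` with inverse `r`,
the product `T_I(-u/2) T_D(u)` is `T = 1 - 2 r ∂⁻¹ u_x` (`TI_mul_TD`), and `T^* ∂ T = ∂`. Since `L =
K ∂` with `K` self-adjoint (`laxOp_eq`), conjugation of `L` by `T` amounts to `K ↦ T K T^*`, and
integration by parts shows that the result is again of the form `L(u', v')`, with `v' = -2r` and `u'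
= T(L·u)` (`stepOp_conj`).

Flows. The B type condition makes `(L^{2k+1})_+` equal to `Y ∂` with `Y` self-adjoint (`isBOp_pos`).
Hence derivatives of eigenfunctions are adjoint eigenfunctions, and integrals `∫ f_x g` of
eigenfunctions evolve by a residue `omega` with `omega B f g + omega B g f = (f g)_t`. Residue
calculus then shows that `T` intertwines the flows (`isStepFlow`), that it maps eigenfunctions to
eigenfunctions (`eigen_step`), and that the integrals of the images are algebraic in the old ones
(`omega_step_step`).

Iteration. The inverse of `u` need not belong to the class on which `∫` is defined, so integrals
cannot be taken anew after a step. Instead `IsChain` carries `f j = L^j u`, `M i j = ∫ (f i)_x (f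
j)` and `a j = ∫ v_x (f j)` as data subject to algebraic and evolution identities. The integration
class supplies the first chain (`isChain`), and `IsChain.step` produces each following one. In a
step `M` becomes its Schur complement with respect to `M 0 0 = u²/2`, so the generalized Wronskians
factor step by step (`bordered_succ`, `level_spec`). This yields the formulas for the new potentials
and the recursion `2 GW_{n+1} = (-1)^n u_n² GW_n` (`tauFactor_succ`), where `u_n` is the first
potential after `n` steps.

Tau functions. In view of this recursion it is enough that one step multiplies `τ_c` by `u²`, up to
a constant. This follows from `u · symbol(TΦ) = u(t - 2[z⁻¹]) · symbol(Φ)` (`symbol_stepOp_mul`). To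
prove it, the shifted wave operator is written as `P Φ` with differential operators `P` that act on
eigenfunctions as the shift itself (`shiftDiffOp_apply`). Residues of the shifted operator against
`Φ` and against `∂⁻¹ u_x Φ` then express the symbols through `P(1)` and `P(u)`.

For `N = 2` the `t₃`-system is read off from `(L³)_+ = ∂³ + 3 (u v_x - v u_x) ∂`
(`flowOp_laxOp_one`) by comparing the coefficients of `1` and `Γ`. -/

instance : Zero (PDO δ) := ⟨⟨fun _ => 0, ⟨0, fun _ _ => rfl⟩⟩⟩

instance : SMul ℂ (PDO δ) where
  smul c P :=
    { coeff := fun m => c • P.coeff m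
      bdd := by
        obtain ⟨a, ha⟩ := P.bdd
        exact ⟨a, fun m hm => by rw [ha m hm, smul_zero]⟩ }

@[simp] theorem coeff_zero' (m : ℤ) : (0 : PDO δ).coeff m = 0 := rfl

@[simp] theorem coeff_add (P Q : PDO δ) (m : ℤ) : (P + Q).coeff m = P.coeff m + Q.coeff m := rfl

@[simp] theorem coeff_neg (P : PDO δ) (m : ℤ) : (-P).coeff m = -P.coeff m := rfl

@[simp] theorem coeff_sub (P Q : PDO δ) (m : ℤ) : (P - Q).coeff m = P.coeff m - Q.coeff m := by
  rw [sub_eq_add_neg]; rfl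

@[simp] theorem coeff_smul (c : ℂ) (P : PDO δ) (m : ℤ) : (c • P).coeff m = c • P.coeff m := rfl

theorem coeff_single (i m : ℤ) (f : R) : (single δ i f).coeff m = if m = i then f else 0 := rfl

theorem coeff_del (i m : ℤ) : (del δ i).coeff m = if m = i then 1 else 0 := rfl

theorem coeff_mulOp (m : ℤ) (f : R) : (mulOp δ f).coeff m = if m = 0 then f else 0 := rfl

theorem coeff_one (m : ℤ) : (1 : PDO δ).coeff m = if m = 0 then 1 else 0 := rfl

@[simp] theorem coeff_diff (e : Derivation ℂ R R) (P : PDO δ) (m : ℤ) :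
    (P.diff e).coeff m = e (P.coeff m) := rfl

theorem coeff_pos (P : PDO δ) (m : ℤ) : P.pos.coeff m = if 0 ≤ m then P.coeff m else 0 := rfl

theorem coeff_neg_part (P : PDO δ) (m : ℤ) : P.neg.coeff m = if m < 0 then P.coeff m else 0 := rfl

instance : AddCommGroup (PDO δ) where
  add_assoc P Q S := by ext m; simp [add_assoc]
  zero_add P := by ext m; simp
  add_zero P := by ext m; simp
  nsmul := nsmulRec
  zsmul := zsmulRec
  neg_add_cancel P := by ext m; simp
  add_comm P Q := by ext m; simp [add_comm]
  sub_eq_add_neg P Q := rfl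

/-- The coefficient of `∂^m` as an additive map. -/
def coeffHom (δ : Derivation ℂ R R) (m : ℤ) : PDO δ →+ R where
  toFun P := P.coeff m
  map_zero' := rfl
  map_add' _ _ := rfl

theorem coeff_sum {ι : Type*} (s : Finset ι) (P : ι → PDO δ) (m : ℤ) :
    (∑ i ∈ s, P i).coeff m = ∑ i ∈ s, (P i).coeff m :=
  map_sum (coeffHom δ m) P s

instance : Module ℂ (PDO δ) where
  one_smul P := by ext m; simp
  mul_smul a b P := by ext m; simp [mul_smul]
  smul_zero a := by ext m; simp
  smul_add a P Q := by ext m; simp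
  add_smul a b P := by ext m; simp [add_smul]
  zero_smul P := by ext m; simp

/-! ### The order filtration -/

/-- `P` has order at most `n`. -/
def OrdLE (P : PDO δ) (n : ℤ) : Prop := ∀ m, n < m → P.coeff m = 0

theorem exists_ordLE (P : PDO δ) : ∃ n, P.OrdLE n := P.bdd

theorem OrdLE.mono {P : PDO δ} {n k : ℤ} (h : P.OrdLE n) (hk : n ≤ k) : P.OrdLE k :=
  fun m hm => h m (by omega)

theorem OrdLE.add {P Q : PDO δ} {n : ℤ} (hP : P.OrdLE n) (hQ : Q.OrdLE n) : (P + Q).OrdLE n :=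
  fun m hm => by simp [hP m hm, hQ m hm]

theorem OrdLE.neg' {P : PDO δ} {n : ℤ} (hP : P.OrdLE n) : (-P).OrdLE n :=
  fun m hm => by simp [hP m hm]

theorem OrdLE.sub {P Q : PDO δ} {n : ℤ} (hP : P.OrdLE n) (hQ : Q.OrdLE n) : (P - Q).OrdLE n :=
  fun m hm => by simp [hP m hm, hQ m hm]

theorem ordLE_single (i : ℤ) (f : R) : (single δ i f).OrdLE i :=
  fun m hm => by rw [coeff_single, if_neg (by omega)]

theorem ordLE_del (i : ℤ) : (del δ i).OrdLE i := ordLE_single i 1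

theorem ordLE_mulOp (f : R) : (mulOp δ f).OrdLE 0 := ordLE_single 0 f

theorem iterate_zero' (k : ℕ) : δ^[k] (0 : R) = 0 := Function.iterate_fixed (map_zero δ) k

theorem OrdLE.diff {P : PDO δ} {n : ℤ} (hP : P.OrdLE n) (e : Derivation ℂ R R) :
    (P.diff e).OrdLE n := fun m hm => by simp [hP m hm]

/-! ### Multiplication -/

/-- A term of a coefficient of a product. -/
def mulTerm (P Q : PDO δ) (m : ℤ) (x : ℤ × ℕ) : R :=
  Ring.choose x.1 x.2 • (P.coeff x.1 * δ^[x.2] (Q.coeff (m - x.1 + x.2)))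

theorem coeff_mul (P Q : PDO δ) (m : ℤ) : (P * Q).coeff m = ∑ᶠ x, mulTerm P Q m x := rfl

theorem mulTerm_eq_zero {P Q : PDO δ} {a b : ℤ} (hP : P.OrdLE a) (hQ : Q.OrdLE b) {m : ℤ}
    {x : ℤ × ℕ} (hx : a < x.1 ∨ b < m - x.1 + x.2) : mulTerm P Q m x = 0 := by
  rcases hx with hx | hx
  · simp [mulTerm, hP _ hx]
  · simp [mulTerm, hQ _ hx]

theorem support_mulTerm {P Q : PDO δ} {a b : ℤ} (hP : P.OrdLE a) (hQ : Q.OrdLE b) (m : ℤ) :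
    Function.support (mulTerm P Q m) ⊆
      ↑(Finset.Icc (m - b) a ×ˢ Finset.range (a + b - m + 1).toNat) := by
  intro x hx
  by_contra hx'
  refine hx (mulTerm_eq_zero hP hQ ?_)
  simp only [Finset.coe_product, Set.mem_prod, Finset.mem_coe, Finset.mem_Icc,
    Finset.mem_range] at hx'
  omega

theorem finite_mulTerm (P Q : PDO δ) (m : ℤ) : (mulTerm P Q m).HasFiniteSupport := by
  obtain ⟨a, ha⟩ := P.exists_ordLE
  obtain ⟨b, hb⟩ := Q.exists_ordLE
  exact (Finset.finite_toSet _).subset (support_mulTerm ha hb m)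

theorem OrdLE.mul {P Q : PDO δ} {a b : ℤ} (hP : P.OrdLE a) (hQ : Q.OrdLE b) :
    (P * Q).OrdLE (a + b) := fun m hm => by
  rw [coeff_mul]
  refine finsum_eq_zero_of_forall_eq_zero fun x => mulTerm_eq_zero hP hQ ?_
  omega

protected theorem add_mul' (P P' Q : PDO δ) : (P + P') * Q = P * Q + P' * Q := by
  ext m
  simp only [coeff_mul, coeff_add]
  rw [← finsum_add_distrib (finite_mulTerm _ _ _) (finite_mulTerm _ _ _)]
  exact finsum_congr fun x => by simp [mulTerm, add_mul]

protected theorem mul_add' (P Q Q' : PDO δ) : P * (Q + Q') = P * Q + P * Q' := by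
  ext m
  simp only [coeff_mul, coeff_add]
  rw [← finsum_add_distrib (finite_mulTerm _ _ _) (finite_mulTerm _ _ _)]
  exact finsum_congr fun x => by simp [mulTerm, mul_add]

/-- Left multiplication as an additive map. -/
def mulLeftHom (P : PDO δ) : PDO δ →+ PDO δ := AddMonoidHom.mk' (fun Q => P * Q) (PDO.mul_add' P)

/-- Right multiplication as an additive map. -/
def mulRightHom (Q : PDO δ) : PDO δ →+ PDO δ :=
  AddMonoidHom.mk' (fun P => P * Q) fun P P' => PDO.add_mul' P P' Q

theorem coeff_mulOp_mul (f : R) (P : PDO δ) (m : ℤ) :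
    (mulOp δ f * P).coeff m = f * P.coeff m := by
  rw [coeff_mul, finsum_eq_single _ (0, 0)]
  · simp [mulTerm, coeff_mulOp]
  · rintro ⟨i, k⟩ hx
    by_cases hi : i = 0
    · subst hi
      obtain _ | k := k
      · exact absurd rfl hx
      · simp [mulTerm, Ring.choose_zero_succ]
    · simp [mulTerm, coeff_mulOp, hi]

theorem coeff_del_mul {P : PDO δ} {a : ℤ} (hP : P.OrdLE a) (i m : ℤ) {N : ℕ} (hN : a < m - i + N) :
    (del δ i * P).coeff m
      = ∑ k ∈ Finset.range N, Ring.choose i k • δ^[k] (P.coeff (m - i + k)) := by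
  rw [coeff_mul, finsum_eq_sum_of_support_subset (s := (Finset.range N).image fun k => (i, k)),
    Finset.sum_image (fun _ _ _ _ h => (Prod.ext_iff.1 h).2)]
  · simp [mulTerm, coeff_del]
  · rintro ⟨j, k⟩ hx
    simp only [Finset.coe_image, Set.mem_image, Finset.mem_coe, Finset.mem_range]
    by_contra hx'
    refine hx ?_
    by_cases hj : j = i
    · subst hj
      have hk : ¬ k < N := fun h => hx' ⟨k, h, rfl⟩
      have : P.coeff (m - j + k) = 0 := hP _ (by omega)
      simp [mulTerm, this]
    · simp [mulTerm, coeff_del, hj]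

theorem coeff_mul_del (P : PDO δ) (j m : ℤ) : (P * del δ j).coeff m = P.coeff (m - j) := by
  rw [coeff_mul, finsum_eq_single _ (m - j, 0)]
  · simp [mulTerm, coeff_del]
  · rintro ⟨i, k⟩ hx
    have h1 : ∀ k : ℕ, δ^[k + 1] (1 : R) = 0 := fun k => by
      rw [Function.iterate_succ_apply, Derivation.map_one_eq_zero, iterate_zero']
    by_cases hi : m - i + k = j
    · obtain _ | k := k
      · exact absurd (by rw [show i = m - j by push_cast at hi; omega]) hx
      · rw [mulTerm, coeff_del, if_pos hi, h1, mul_zero, smul_zero]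
    · simp [mulTerm, coeff_del, hi]

/-- A `k`-th derivative of `f` with `k ≥ 1` could enter the residue only from `∂^{k-1}`, where its
binomial factor `choose (k-1) k` is zero. -/
theorem res_mul_mulOp (P : PDO δ) (f : R) : (P * mulOp δ f).coeff (-1) = P.coeff (-1) * f := by
  rw [coeff_mul, finsum_eq_single _ (-1, 0)]
  · simp [mulTerm, coeff_mulOp]
  · rintro ⟨i, k⟩ hx
    by_cases hi : -1 - i + k = 0
    · obtain rfl : i = (k : ℤ) - 1 := by omega
      obtain _ | k := k
      · exact absurd (by simp) hx
      · have : Ring.choose (((k + 1 : ℕ) : ℤ) - 1) (k + 1) = 0 := by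
          rw [show (((k + 1 : ℕ) : ℤ) - 1) = (k : ℤ) by push_cast; ring, Ring.choose_natCast]
          simp
        rw [mulTerm, this, zero_smul]
    · simp [mulTerm, coeff_mulOp, hi]

theorem single_eq (i : ℤ) (f : R) : single δ i f = mulOp δ f * del δ i := by
  ext m; simp [coeff_mulOp_mul, coeff_single, coeff_del]

theorem del_zero : del δ 0 = 1 := rfl

/-- An additive map that raises the order by a bounded amount and kills all `f ∂^i` is zero. -/
theorem eq_zero_of_single (F : PDO δ →+ PDO δ) (c : ℤ)
    (hF : ∀ n P, OrdLE P n → OrdLE (F P) (n + c)) (hs : ∀ i f, F (single δ i f) = 0) (P : PDO δ) :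
    F P = 0 := by
  -- Operators of order at most `m - c - 1` cannot reach `∂^m` under `F`; `k` counts the leading
  -- monomials that must be removed before this applies.
  have key : ∀ (k : ℕ) (m : ℤ) (P : PDO δ), P.OrdLE (m - c - 1 + k) → (F P).coeff m = 0 := by
    intro k
    induction k with
    | zero => exact fun m P hP => hF _ _ hP _ (by push_cast; linarith)
    | succ k ih =>
      intro m P hP
      set n : ℤ := m - c - 1 + (k + 1 : ℕ) with hn
      have hd : P = single δ n (P.coeff n) + (P - single δ n (P.coeff n)) := by abel
      rw [hd, map_add, hs, zero_add]
      refine ih m _ fun l hl => ?_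
      rw [coeff_sub, coeff_single]
      split_ifs with h
      · rw [h, sub_self]
      · rw [hP l (by push_cast at hn; omega), sub_zero]
  ext m
  obtain ⟨a, ha⟩ := P.exists_ordLE
  exact key (a - (m - c - 1)).toNat m P (ha.mono (by omega))

theorem del_one_mul_coeff (P : PDO δ) (m : ℤ) :
    (del δ 1 * P).coeff m = P.coeff (m - 1) + δ (P.coeff m) := by
  obtain ⟨a, ha⟩ := P.exists_ordLE
  rw [coeff_del_mul ha 1 m (N := (a - m).toNat + 2) (by omega), Finset.sum_range_succ',
    Finset.sum_range_succ', Finset.sum_eq_zero]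
  · simp [add_comm]
  · intro k _
    have : Ring.choose (1 : ℤ) (k + 1 + 1) = 0 := by
      rw [← Nat.cast_one, Ring.choose_natCast, Nat.choose_eq_zero_of_lt (by omega), Nat.cast_zero]
    rw [this, zero_smul]

/-- Pascal's rule for generalized binomials, which is valid for every integer exponent. -/
theorem del_one_mul_del_mul (i : ℤ) (P : PDO δ) :
    del δ 1 * (del δ i * P) = del δ (i + 1) * P := by
  ext m
  obtain ⟨a, ha⟩ := P.exists_ordLE
  set N : ℕ := (a - m + i + 1).toNat + 1 with hN
  rw [del_one_mul_coeff, coeff_del_mul ha i (m - 1) (N := N + 1) (by omega),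
    coeff_del_mul ha i m (N := N) (by omega),
    coeff_del_mul ha (i + 1) m (N := N + 1) (by omega), Finset.sum_range_succ',
    Finset.sum_range_succ' (n := N) (f := fun k => Ring.choose (i + 1) k • _), map_sum]
  rw [add_right_comm, ← Finset.sum_add_distrib]
  congr 1
  · refine Finset.sum_congr rfl fun k _ => ?_
    rw [Ring.choose_succ_succ, add_smul, map_zsmul, ← Function.iterate_succ_apply' δ, add_comm,
      show m - 1 - i + ((k + 1 : ℕ) : ℤ) = m - i + k by push_cast; ring,
      show m - (i + 1) + ((k + 1 : ℕ) : ℤ) = m - i + k by push_cast; ring]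
  · simp [show m - 1 - i = m - (i + 1) by ring]

theorem mulOp_mul_mul (f : R) (P Q : PDO δ) : (mulOp δ f * P) * Q = mulOp δ f * (P * Q) := by
  ext m
  rw [coeff_mulOp_mul, coeff_mul, coeff_mul, mul_finsum' _ _ (finite_mulTerm _ _ _)]
  exact finsum_congr fun x => by
    rw [mulTerm, mulTerm, coeff_mulOp_mul, mul_assoc, mul_smul_comm]

/-- By additivity it is enough to treat `P = f ∂^i`, where `∂ f = f ∂ + f_x` moves the function to
the left. -/
theorem del_one_mul_mul (P Q : PDO δ) : (del δ 1 * P) * Q = del δ 1 * (P * Q) := by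
  obtain ⟨b, hb⟩ := Q.exists_ordLE
  have h := eq_zero_of_single
    (((mulRightHom Q).comp (mulLeftHom (del δ 1)))
      - ((mulLeftHom (del δ 1)).comp (mulRightHom Q))) (1 + b)
    (fun n P hP => OrdLE.sub
      ((((ordLE_del 1).mul hP).mul hb).mono (by linarith))
      (((ordLE_del 1).mul (hP.mul hb)).mono (by linarith)))
    (fun i f => ?_) P
  · exact sub_eq_zero.1 h
  · change (del δ 1 * single δ i f) * Q - del δ 1 * (single δ i f * Q) = 0
    have hd : ∀ S : PDO δ,
        del δ 1 * (mulOp δ f * S) = mulOp δ f * (del δ 1 * S) + mulOp δ (δ f) * S := fun S => by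
      ext m
      simp only [del_one_mul_coeff, coeff_mulOp_mul, coeff_add, Derivation.leibniz, smul_eq_mul]
      ring
    rw [single_eq, hd, mulOp_mul_mul, hd, PDO.add_mul', mulOp_mul_mul, mulOp_mul_mul]
    have h1 : del δ 1 * del δ i = del δ (i + 1) := by
      ext m; simp [coeff_mul_del, coeff_del, sub_eq_iff_eq_add, add_comm]
    rw [h1, del_one_mul_del_mul, sub_self]

/-- Left multiplication by `∂` preserves the leading coefficient, so the order of the difference can
be lowered forever. This reduces statements about `∂⁻¹` to statements about `∂`, with no binomial
sums. -/
theorem del_one_mul_injective {P Q : PDO δ} (h : del δ 1 * P = del δ 1 * Q) : P = Q := by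
  have h0 : del δ 1 * (P - Q) = 0 := by
    have := map_sub (mulLeftHom (del δ 1)) P Q
    change del δ 1 * (P - Q) = del δ 1 * P - del δ 1 * Q at this
    rw [this, h, sub_self]
  obtain ⟨a, ha⟩ := (P - Q).exists_ordLE
  have key : ∀ k : ℕ, (P - Q).OrdLE (a - k) := by
    intro k
    induction k with
    | zero => simpa using ha
    | succ k ih =>
      intro m hm
      have := congrArg (fun S => PDO.coeff S (m + 1)) h0
      simp only [del_one_mul_coeff, ih (m + 1) (by push_cast at hm; omega), coeff_zero',
        map_zero, add_zero] at this
      simpa using this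
  have : P - Q = 0 := by
    ext m
    exact key (a - m + 1).toNat m (by omega)
  exact sub_eq_zero.1 this

theorem one_mul' (P : PDO δ) : 1 * P = P := by
  ext m
  exact (coeff_mulOp_mul 1 P m).trans (one_mul _)

theorem del_neg_one_mul_mul (P Q : PDO δ) : (del δ (-1) * P) * Q = del δ (-1) * (P * Q) := by
  have h : ∀ S : PDO δ, del δ 1 * (del δ (-1) * S) = S := fun S => by
    rw [del_one_mul_del_mul]; exact one_mul' S
  apply del_one_mul_injective
  rw [← del_one_mul_mul, h, h]

theorem del_mul_mul (i : ℤ) (P Q : PDO δ) : (del δ i * P) * Q = del δ i * (P * Q) := by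
  have hs : ∀ (i : ℤ) (S : PDO δ), del δ (-1) * (del δ (i + 1) * S) = del δ i * S := fun i S => by
    apply del_one_mul_injective
    rw [del_one_mul_del_mul, del_one_mul_del_mul]
    exact one_mul' _
  induction i using Int.induction_on with
  | zero => rw [del_zero, one_mul', one_mul']
  | succ i ih =>
    rw [← del_one_mul_del_mul, ← del_one_mul_del_mul, del_one_mul_mul, ih]
  | pred i ih =>
    have h := hs (-(i : ℤ) - 1)
    rw [sub_add_cancel] at h
    rw [← h, ← h, del_neg_one_mul_mul, ih]

protected theorem mul_assoc' (P Q S : PDO δ) : P * Q * S = P * (Q * S) := by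
  obtain ⟨b, hb⟩ := Q.exists_ordLE
  obtain ⟨c, hc⟩ := S.exists_ordLE
  have h := eq_zero_of_single
    (((mulRightHom S).comp (mulRightHom Q)) - mulRightHom (Q * S)) (b + c)
    (fun n P hP => OrdLE.sub
      (((hP.mul hb).mul hc).mono (by linarith)) ((hP.mul (hb.mul hc)).mono (by linarith)))
    (fun i f => ?_) P
  · exact sub_eq_zero.1 h
  · change (single δ i f * Q) * S - single δ i f * (Q * S) = 0
    rw [single_eq, mulOp_mul_mul, mulOp_mul_mul, mulOp_mul_mul, del_mul_mul, sub_self]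

instance : Ring (PDO δ) where
  left_distrib := PDO.mul_add'
  right_distrib := PDO.add_mul'
  zero_mul P := (mulRightHom P).map_zero
  mul_zero P := (mulLeftHom P).map_zero
  mul_assoc := PDO.mul_assoc'
  one_mul := one_mul'
  mul_one P := by
    ext m
    exact (coeff_mul_del P 0 m).trans (by rw [sub_zero])
  zsmul := zsmulRec
  neg_add_cancel := neg_add_cancel
  sub_eq_add_neg P Q := rfl

theorem pow_eq (P : PDO δ) (n : ℕ) : P.pow n = P ^ n := by
  induction n with
  | zero => rw [pow_zero]; rfl
  | succ n ih => rw [pow_succ, ← ih]; rfl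

end Ring

end PDO

end CMBKP

end

/-! ### Adjoints, residues, differential parts and values of operators. -/

noncomputable section

namespace CMBKP

namespace PDO

section Adjoint

variable {R : Type*} [CommRing R] [Algebra ℂ R] {δ : Derivation ℂ R R}

/-! ### Multiplication operators and powers of `∂` -/

@[simp] theorem mulOp_zero : mulOp δ 0 = 0 := by ext m; simp [coeff_mulOp]

@[simp] theorem mulOp_one : mulOp δ 1 = 1 := rfl

theorem mulOp_add (f g : R) : mulOp δ (f + g) = mulOp δ f + mulOp δ g := by
  ext m; by_cases h : m = 0 <;> simp [coeff_mulOp, h]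

theorem mulOp_neg (f : R) : mulOp δ (-f) = -mulOp δ f := by
  ext m; by_cases h : m = 0 <;> simp [coeff_mulOp, h]

theorem mulOp_sub (f g : R) : mulOp δ (f - g) = mulOp δ f - mulOp δ g := by
  rw [sub_eq_add_neg, mulOp_add, mulOp_neg, sub_eq_add_neg]

theorem mulOp_mul (f g : R) : mulOp δ (f * g) = mulOp δ f * mulOp δ g := by
  ext m; by_cases h : m = 0 <;> simp [coeff_mulOp_mul, coeff_mulOp, h]

theorem mulOp_comm (f g : R) : mulOp δ f * mulOp δ g = mulOp δ g * mulOp δ f := by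
  rw [← mulOp_mul, mul_comm, mulOp_mul]

/-- `f ↦ f` as a ring homomorphism to the operators. -/
def mulOpHom (δ : Derivation ℂ R R) : R →+* PDO δ where
  toFun := mulOp δ
  map_one' := rfl
  map_mul' := mulOp_mul
  map_zero' := mulOp_zero
  map_add' := mulOp_add

theorem mulOp_two_mul (f : R) : mulOp δ (2 * f) = 2 * mulOp δ f := by
  rw [two_mul, mulOp_add, two_mul]

theorem mulOp_two : mulOp δ (2 : R) = 2 := map_ofNat (mulOpHom δ) 2

theorem del_mul_del (i j : ℤ) : del δ i * del δ j = del δ (i + j) := by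
  ext m; simp [coeff_mul_del, coeff_del, sub_eq_iff_eq_add]

@[simp] theorem del_mul_del_inv : del δ 1 * del δ (-1) = 1 := del_mul_del 1 (-1)

@[simp] theorem del_inv_mul_del : del δ (-1) * del δ 1 = 1 := del_mul_del (-1) 1

theorem del_mul_del_inv_mul (P : PDO δ) : del δ 1 * (del δ (-1) * P) = P := by
  rw [← mul_assoc, del_mul_del_inv, one_mul]

theorem del_inv_mul_del_mul (P : PDO δ) : del δ (-1) * (del δ 1 * P) = P := by
  rw [← mul_assoc, del_inv_mul_del, one_mul]

theorem mul_del_mul_del_inv (P : PDO δ) : P * del δ 1 * del δ (-1) = P := by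
  rw [mul_assoc, del_mul_del_inv, mul_one]

theorem mul_del_inv_mul_del (P : PDO δ) : P * del δ (-1) * del δ 1 = P := by
  rw [mul_assoc, del_inv_mul_del, mul_one]

theorem del_mul_mulOp (f : R) :
    del δ 1 * mulOp δ f = mulOp δ f * del δ 1 + mulOp δ (δ f) := by
  ext m
  by_cases h0 : m = 0
  · subst h0; simp [del_one_mul_coeff, coeff_mulOp, coeff_mulOp_mul, coeff_del]
  · by_cases h1 : m = 1
    · subst h1; simp [del_one_mul_coeff, coeff_mulOp, coeff_mulOp_mul, coeff_del]
    · simp [del_one_mul_coeff, coeff_mulOp, coeff_mulOp_mul, coeff_del, h0, h1, sub_eq_zero]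

theorem mulOp_deriv (f : R) :
    mulOp δ (δ f) = del δ 1 * mulOp δ f - mulOp δ f * del δ 1 := by
  rw [del_mul_mulOp]; abel

/-- Integration by parts: `∂⁻¹ f_x ∂⁻¹ = f ∂⁻¹ - ∂⁻¹ f`. -/
theorem del_inv_mul_deriv_mul_del_inv (f : R) :
    del δ (-1) * mulOp δ (δ f) * del δ (-1) = mulOp δ f * del δ (-1) - del δ (-1) * mulOp δ f := by
  rw [mulOp_deriv, mul_sub, del_inv_mul_del_mul, sub_mul, mul_assoc, mul_del_mul_del_inv]

theorem coeff_mulOp_mul_del (f : R) (i m : ℤ) :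
    (mulOp δ f * del δ i).coeff m = if m = i then f else 0 := by
  rw [← single_eq, coeff_single]

/-! ### The adjoint -/

/-- A term of a coefficient of the adjoint. -/
def adjTerm (P : PDO δ) (m : ℤ) (k : ℕ) : R :=
  ((m + k).negOnePow * Ring.choose (m + k) k : ℤ) • δ^[k] (P.coeff (m + k))

theorem coeff_adjoint (P : PDO δ) (m : ℤ) : P.adjoint.coeff m = ∑ᶠ k, adjTerm P m k := rfl

theorem adjTerm_eq_zero {P : PDO δ} {a : ℤ} (hP : P.OrdLE a) {m : ℤ} {k : ℕ} (h : a < m + k) :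
    adjTerm P m k = 0 := by
  rw [adjTerm, hP _ h, iterate_zero', smul_zero]

theorem finite_adjTerm (P : PDO δ) (m : ℤ) : (adjTerm P m).HasFiniteSupport := by
  obtain ⟨a, ha⟩ := P.exists_ordLE
  refine (Finset.finite_toSet (Finset.range (a - m + 1).toNat)).subset fun k hk => ?_
  by_contra hk'
  refine hk (adjTerm_eq_zero ha ?_)
  simp only [Finset.mem_coe, Finset.mem_range] at hk'
  omega

theorem OrdLE.adjoint {P : PDO δ} {a : ℤ} (hP : P.OrdLE a) : P.adjoint.OrdLE a := fun m hm =>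
  finsum_eq_zero_of_forall_eq_zero fun k => adjTerm_eq_zero hP (by omega)

theorem adjoint_add (P Q : PDO δ) : (P + Q).adjoint = P.adjoint + Q.adjoint := by
  ext m
  simp only [coeff_adjoint, coeff_add]
  rw [← finsum_add_distrib (finite_adjTerm _ _) (finite_adjTerm _ _)]
  exact finsum_congr fun x => by simp [adjTerm]

/-- The adjoint as an additive map. -/
def adjointHom (δ : Derivation ℂ R R) : PDO δ →+ PDO δ := AddMonoidHom.mk' adjoint adjoint_add

theorem adjoint_sub (P Q : PDO δ) : (P - Q).adjoint = P.adjoint - Q.adjoint :=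
  map_sub (adjointHom δ) P Q

theorem adjoint_zsmul (n : ℤ) (P : PDO δ) : (n • P).adjoint = n • P.adjoint :=
  map_zsmul (adjointHom δ) n P

theorem coeff_zsmul (n : ℤ) (P : PDO δ) (m : ℤ) : (n • P).coeff m = n • P.coeff m :=
  map_zsmul (coeffHom δ m) n P

theorem adjoint_single (i : ℤ) (f : R) :
    (single δ i f).adjoint = (i.negOnePow : ℤ) • (del δ i * mulOp δ f) := by
  ext m
  have hL := coeff_del_mul (ordLE_mulOp (δ := δ) f) i m (N := (i - m + 1).toNat) (by omega)
  rw [coeff_zsmul, hL, coeff_adjoint, finsum_eq_sum_of_support_subset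
    (s := Finset.range (i - m + 1).toNat), Finset.smul_sum]
  · refine Finset.sum_congr rfl fun k _ => ?_
    rw [adjTerm, coeff_single, coeff_mulOp, mul_smul]
    by_cases h : m + k = i
    · rw [if_pos h, if_pos (by omega), h]
    · rw [if_neg h, if_neg (by omega), iterate_zero', smul_zero, smul_zero, smul_zero, smul_zero]
  · intro k hk
    by_contra hk'
    refine hk (adjTerm_eq_zero (ordLE_single i f) ?_)
    simp only [Finset.mem_coe, Finset.mem_range] at hk'
    omega

@[simp] theorem adjoint_mulOp (f : R) : (mulOp δ f).adjoint = mulOp δ f := by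
  have := adjoint_single (δ := δ) 0 f
  rw [del_zero, one_mul] at this
  exact this.trans (by simp)

@[simp] theorem adjoint_one : (1 : PDO δ).adjoint = 1 := adjoint_mulOp 1

theorem adjoint_del (i : ℤ) : (del δ i).adjoint = (i.negOnePow : ℤ) • del δ i := by
  have := adjoint_single (δ := δ) i 1
  rwa [mulOp_one, mul_one] at this

@[simp] theorem adjoint_del_one : (del δ 1).adjoint = -del δ 1 := by
  rw [adjoint_del]; simp

@[simp] theorem adjoint_del_neg_one : (del δ (-1)).adjoint = -del δ (-1) := by
  rw [adjoint_del]; simp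

theorem adjoint_mulOp_mul (f : R) (X : PDO δ) :
    (mulOp δ f * X).adjoint = X.adjoint * mulOp δ f := by
  have h := eq_zero_of_single
    (((adjointHom δ).comp (mulLeftHom (mulOp δ f)))
      - ((mulRightHom (mulOp δ f)).comp (adjointHom δ))) 0
    (fun n P hP => OrdLE.sub
      (((ordLE_mulOp f).mul hP).adjoint.mono (by linarith))
      ((hP.adjoint.mul (ordLE_mulOp f)).mono (by linarith)))
    (fun i g => ?_) X
  · exact sub_eq_zero.1 h
  · change (mulOp δ f * single δ i g).adjoint - (single δ i g).adjoint * mulOp δ f = 0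
    rw [single_eq, ← mul_assoc, ← mulOp_mul, ← single_eq, ← single_eq, adjoint_single,
      adjoint_single, smul_mul_assoc, mul_assoc, ← mulOp_mul, mul_comm, sub_self]

theorem adjoint_del_one_mul (X : PDO δ) : (del δ 1 * X).adjoint = -(X.adjoint * del δ 1) := by
  have h := eq_zero_of_single
    (((adjointHom δ).comp (mulLeftHom (del δ 1)))
      + ((mulRightHom (del δ 1)).comp (adjointHom δ))) 1
    (fun n P hP => OrdLE.add
      (((ordLE_del 1).mul hP).adjoint.mono (by linarith))
      ((hP.adjoint.mul (ordLE_del 1)).mono (by linarith)))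
    (fun i g => ?_) X
  · exact eq_neg_of_add_eq_zero_left h
  · change (del δ 1 * single δ i g).adjoint + (single δ i g).adjoint * del δ 1 = 0
    have : del δ 1 * single δ i g = single δ (i + 1) g + single δ i (δ g) := by
      rw [single_eq, single_eq, single_eq, ← mul_assoc, del_mul_mulOp, add_mul, mul_assoc,
        del_mul_del, add_comm 1 i]
    rw [this, adjoint_add, adjoint_single, adjoint_single, adjoint_single, smul_mul_assoc,
      mulOp_deriv, mul_sub, ← mul_assoc (del δ i), del_mul_del, Int.negOnePow_succ, smul_sub,
      Units.val_neg, neg_smul, mul_assoc]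
    abel

theorem adjoint_del_neg_one_mul (X : PDO δ) :
    (del δ (-1) * X).adjoint = -(X.adjoint * del δ (-1)) := by
  have h := adjoint_del_one_mul (del δ (-1) * X)
  rw [del_mul_del_inv_mul] at h
  rw [h, neg_mul, neg_neg, mul_del_mul_del_inv]

/-- The left factors that obey the rule against all right factors are closed under products. They
include the functions and `∂^{±1}`, hence all `f ∂^i`, and additivity does the rest. -/
theorem adjoint_mul (P Q : PDO δ) : (P * Q).adjoint = Q.adjoint * P.adjoint := by
  have hmul : ∀ P₁ P₂ : PDO δ, (∀ X, (P₁ * X).adjoint = X.adjoint * P₁.adjoint) →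
      (∀ X, (P₂ * X).adjoint = X.adjoint * P₂.adjoint) →
      ∀ X, (P₁ * P₂ * X).adjoint = X.adjoint * (P₁ * P₂).adjoint := fun P₁ P₂ h₁ h₂ X => by
    rw [mul_assoc, h₁, h₂, h₁, mul_assoc]
  have h1 : ∀ X : PDO δ, (del δ 1 * X).adjoint = X.adjoint * (del δ 1).adjoint := fun X => by
    rw [adjoint_del_one_mul, adjoint_del_one, mul_neg]
  have h2 : ∀ X : PDO δ, (del δ (-1) * X).adjoint = X.adjoint * (del δ (-1)).adjoint :=
    fun X => by rw [adjoint_del_neg_one_mul, adjoint_del_neg_one, mul_neg]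
  have hdel : ∀ (i : ℤ) (X : PDO δ), (del δ i * X).adjoint = X.adjoint * (del δ i).adjoint := by
    intro i
    induction i using Int.induction_on with
    | zero => intro X; rw [del_zero, one_mul, adjoint_one, mul_one]
    | succ i ih => rw [add_comm, ← del_mul_del]; exact hmul _ _ h1 ih
    | pred i ih => rw [sub_eq_add_neg, add_comm, ← del_mul_del]; exact hmul _ _ h2 ih
  obtain ⟨b, hb⟩ := Q.exists_ordLE
  have h := eq_zero_of_single
    (((adjointHom δ).comp (mulRightHom Q)) - ((mulLeftHom Q.adjoint).comp (adjointHom δ))) b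
    (fun n P hP => OrdLE.sub (hP.mul hb).adjoint ((hb.adjoint.mul hP.adjoint).mono (by linarith)))
    (fun i g => ?_) P
  · exact sub_eq_zero.1 h
  · change (single δ i g * Q).adjoint - Q.adjoint * (single δ i g).adjoint = 0
    rw [single_eq, hmul _ _ (fun X => by rw [adjoint_mulOp_mul, adjoint_mulOp]) (hdel i), sub_self]

theorem adjoint_adjoint (P : PDO δ) : P.adjoint.adjoint = P := by
  have h := eq_zero_of_single
    (((adjointHom δ).comp (adjointHom δ)) - AddMonoidHom.id _) 0
    (fun n P hP => OrdLE.sub (hP.adjoint.adjoint.mono (by linarith)) (hP.mono (by linarith)))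
    (fun i g => ?_) P
  · exact sub_eq_zero.1 h
  · change (single δ i g).adjoint.adjoint - single δ i g = 0
    rw [adjoint_single, adjoint_zsmul, adjoint_mul, adjoint_mulOp, adjoint_del, mul_smul_comm,
      smul_smul, single_eq, ← Units.val_mul, ← Int.negOnePow_add, Int.negOnePow_even _ ⟨i, rfl⟩]
    simp

theorem adjoint_pow (P : PDO δ) (n : ℕ) : (P ^ n).adjoint = P.adjoint ^ n := by
  induction n with
  | zero => simp
  | succ n ih => rw [pow_succ, adjoint_mul, ih, pow_succ']

/-! ### Residues -/

theorem res_mulOp_mul (f : R) (P : PDO δ) :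
    (mulOp δ f * P).coeff (-1) = f * P.coeff (-1) := coeff_mulOp_mul f P (-1)

theorem res_adjoint (P : PDO δ) : P.adjoint.coeff (-1) = -P.coeff (-1) := by
  rw [coeff_adjoint, finsum_eq_single _ 0]
  · simp [adjTerm]
  · rintro (_ | k) hk
    · exact absurd rfl hk
    · have : Ring.choose (-1 + ((k + 1 : ℕ) : ℤ)) (k + 1) = 0 := by
        rw [show -1 + ((k + 1 : ℕ) : ℤ) = (k : ℕ) by push_cast; ring, Ring.choose_natCast]
        simp
      rw [adjTerm, this, mul_zero, zero_smul]

/-- The residue changes sign under the adjoint and `2` is invertible. This is what removes the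
constant term of `(L^{2k+1})_+`. -/
theorem res_eq_zero_of_adjoint_eq {P : PDO δ} (h : P.adjoint = P) : P.coeff (-1) = 0 := by
  have h1 := res_adjoint P
  rw [h] at h1
  have h2 : (2 : ℂ) • P.coeff (-1) = 0 := by
    rw [two_smul]; nth_rewrite 1 [h1]; exact neg_add_cancel _
  exact ((IsUnit.mk0 (2 : ℂ) two_ne_zero).smul_eq_zero).1 h2

theorem OrdLE.res {P : PDO δ} (h : P.OrdLE (-2)) : P.coeff (-1) = 0 := h _ (by norm_num)

/-! ### Differential and integral parts -/

/-- `P` is a differential operator. -/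
def IsDiff (P : PDO δ) : Prop := ∀ m, m < 0 → P.coeff m = 0

theorem isDiff_pos (P : PDO δ) : P.pos.IsDiff := fun m hm => by
  rw [coeff_pos, if_neg (by omega)]

theorem ordLE_neg (P : PDO δ) : P.neg.OrdLE (-1) := fun m hm => by
  rw [coeff_neg_part, if_neg (by omega)]

theorem pos_add_neg (P : PDO δ) : P.pos + P.neg = P := by
  ext m
  rw [coeff_add, coeff_pos, coeff_neg_part]
  split_ifs <;> first | omega | simp

theorem IsDiff.pos_eq {P : PDO δ} (h : P.IsDiff) : P.pos = P := by
  ext m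
  rw [coeff_pos]
  split_ifs with hm
  · rfl
  · rw [h m (by omega)]

theorem IsDiff.neg_eq {P : PDO δ} (h : P.IsDiff) : P.neg = 0 := by
  ext m
  rw [coeff_neg_part]
  split_ifs with hm
  · rw [h m (by omega), coeff_zero']
  · rfl

theorem OrdLE.neg_eq {P : PDO δ} (h : P.OrdLE (-1)) : P.neg = P := by
  ext m
  rw [coeff_neg_part]
  split_ifs with hm
  · rfl
  · rw [h m (by omega)]

theorem OrdLE.pos_eq {P : PDO δ} (h : P.OrdLE (-1)) : P.pos = 0 := by
  ext m
  rw [coeff_pos]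
  split_ifs with hm
  · rw [h m (by omega), coeff_zero']
  · rfl

theorem neg_add' (P Q : PDO δ) : (P + Q).neg = P.neg + Q.neg := by
  ext m; simp only [coeff_neg_part, coeff_add]; split_ifs <;> simp

theorem neg_sub' (P Q : PDO δ) : (P - Q).neg = P.neg - Q.neg := by
  ext m; simp only [coeff_neg_part, coeff_sub]; split_ifs <;> simp

theorem pos_add' (P Q : PDO δ) : (P + Q).pos = P.pos + Q.pos := by
  ext m; simp only [coeff_pos, coeff_add]; split_ifs <;> simp

theorem IsDiff.add {P Q : PDO δ} (hP : P.IsDiff) (hQ : Q.IsDiff) : (P + Q).IsDiff :=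
  fun m hm => by rw [coeff_add, hP m hm, hQ m hm, add_zero]

theorem IsDiff.smul {P : PDO δ} (hP : P.IsDiff) (c : ℂ) : (c • P).IsDiff :=
  fun m hm => by rw [coeff_smul, hP m hm, smul_zero]

theorem isDiff_mulOp (f : R) : (mulOp δ f).IsDiff := fun m hm => by
  rw [coeff_mulOp, if_neg (by omega)]

theorem isDiff_one : (1 : PDO δ).IsDiff := isDiff_mulOp 1

theorem isDiff_del (n : ℕ) : (del δ n).IsDiff := fun m hm => by
  rw [coeff_del, if_neg (by omega)]

theorem IsDiff.diff {P : PDO δ} (hP : P.IsDiff) (e : Derivation ℂ R R) : (P.diff e).IsDiff :=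
  fun m hm => by rw [coeff_diff, hP m hm, map_zero]

theorem IsDiff.mul {P Q : PDO δ} (hP : P.IsDiff) (hQ : Q.IsDiff) : (P * Q).IsDiff := fun m hm => by
  rw [coeff_mul]
  refine finsum_eq_zero_of_forall_eq_zero ?_
  rintro ⟨i, k⟩
  by_cases hi : i < 0
  · simp [mulTerm, hP i hi]
  · by_cases hk : m - i + k < 0
    · simp [mulTerm, hQ _ hk]
    · obtain ⟨j, rfl⟩ := Int.eq_ofNat_of_zero_le (not_lt.1 hi)
      rw [mulTerm, Ring.choose_natCast, Nat.choose_eq_zero_of_lt (by dsimp only; omega)]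
      simp

theorem IsDiff.adjoint {P : PDO δ} (hP : P.IsDiff) : P.adjoint.IsDiff := fun m hm => by
  rw [coeff_adjoint]
  refine finsum_eq_zero_of_forall_eq_zero fun k => ?_
  by_cases hi : m + k < 0
  · simp [adjTerm, hP _ hi]
  · obtain ⟨j, hj⟩ := Int.eq_ofNat_of_zero_le (not_lt.1 hi)
    rw [adjTerm, hj, Ring.choose_natCast, Nat.choose_eq_zero_of_lt (by omega)]
    simp

theorem adjoint_pos (P : PDO δ) : P.adjoint.pos = P.pos.adjoint := by
  conv_lhs => rw [← pos_add_neg P, adjoint_add, pos_add', (ordLE_neg P).adjoint.pos_eq, add_zero,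
    (isDiff_pos P).adjoint.pos_eq]

theorem IsDiff.res {P : PDO δ} (h : P.IsDiff) : P.coeff (-1) = 0 := h _ (by norm_num)

theorem IsDiff.mul_del_inv {P : PDO δ} (h : P.IsDiff) :
    P * del δ (-1) = (P * del δ (-1)).pos + mulOp δ (P.coeff 0) * del δ (-1) := by
  ext m
  rw [coeff_add, coeff_mulOp_mul_del, coeff_pos, coeff_mul_del]
  split_ifs with h1 h2 h2
  · omega
  · rw [add_zero]
  · subst h2; simp
  · rw [h _ (by omega), add_zero]

/-! ### Values of differential operators -/

/-- In order zero only `∂^j` paired with the `j`-th derivative of `f` contributes. Values of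
operators thus become coefficients of products, accessible to residue calculus. -/
theorem apply_eq (P : PDO δ) (f : R) : P.apply f = (P * mulOp δ f).coeff 0 := by
  obtain ⟨a, ha⟩ := P.exists_ordLE
  rw [apply, coeff_mul,
    finsum_eq_sum_of_support_subset (s := (Finset.range (a + 1).toNat).image fun j : ℕ => ((j : ℤ), j)),
    Finset.sum_image (fun _ _ _ _ h => (Prod.ext_iff.1 h).2),
    finsum_eq_sum_of_support_subset (s := Finset.range (a + 1).toNat)]
  · refine Finset.sum_congr rfl fun j _ => ?_
    simp [mulTerm, coeff_mulOp, Ring.choose_natCast]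
  · intro j hj
    by_contra hj'
    simp only [Finset.mem_coe, Finset.mem_range] at hj'
    exact hj (by simp [ha j (by omega)])
  · rintro ⟨i, k⟩ hx
    by_contra hx'
    simp only [Finset.coe_image, Set.mem_image, Finset.mem_coe, Finset.mem_range] at hx'
    refine hx ?_
    by_cases hi : a < i
    · simp [mulTerm, ha _ hi]
    · have : 0 - i + (k : ℤ) ≠ 0 := fun h => hx' ⟨k, by omega, by ext <;> simp; omega⟩
      rw [mulTerm, coeff_mulOp, if_neg this, iterate_zero', mul_zero, smul_zero]

theorem res_mul_mulOp_mul_del_inv (P : PDO δ) (f : R) :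
    (P * mulOp δ f * del δ (-1)).coeff (-1) = P.apply f := by
  rw [coeff_mul_del, apply_eq]; rfl

theorem apply_neg (P : PDO δ) (f : R) : P.apply (-f) = -P.apply f := by
  simp only [apply_eq, mulOp_neg, mul_neg, coeff_neg]

/-- `D f ∂⁻¹ = C + D(f) ∂⁻¹` with `C` a differential operator. -/
theorem IsDiff.mul_mulOp_del_inv {D : PDO δ} (h : D.IsDiff) (f : R) :
    ∃ C : PDO δ, C.IsDiff ∧
      D * mulOp δ f * del δ (-1) = C + mulOp δ (D.apply f) * del δ (-1) :=
  ⟨_, isDiff_pos _, by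
    conv_lhs => rw [(h.mul (isDiff_mulOp f)).mul_del_inv]
    rw [apply_eq]⟩

/-- `∂⁻¹ g D = C + ∂⁻¹ D^*(g)` with `C` a differential operator. -/
theorem IsDiff.del_inv_mulOp_mul {D : PDO δ} (h : D.IsDiff) (g : R) :
    ∃ C : PDO δ, C.IsDiff ∧
      del δ (-1) * mulOp δ g * D = C + del δ (-1) * mulOp δ (D.adjoint.apply g) := by
  obtain ⟨C, hC, hCe⟩ := h.adjoint.mul_mulOp_del_inv g
  refine ⟨-C.adjoint, fun m hm => by rw [coeff_neg, hC.adjoint m hm, neg_zero], ?_⟩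
  have := congrArg PDO.adjoint hCe
  rw [adjoint_mul, adjoint_mul, adjoint_add, adjoint_mul, adjoint_adjoint, adjoint_mulOp,
    adjoint_mulOp, adjoint_del_neg_one, neg_mul, neg_mul] at this
  rw [mul_assoc, neg_eq_iff_eq_neg.1 this]
  abel

theorem IsDiff.res_del_inv_mulOp_mul {D : PDO δ} (h : D.IsDiff) (g : R) :
    (del δ (-1) * mulOp δ g * D).coeff (-1) = D.adjoint.apply g := by
  obtain ⟨C, hC, hCe⟩ := h.del_inv_mulOp_mul g
  rw [hCe, coeff_add, hC.res, zero_add, res_mul_mulOp, coeff_del, if_pos rfl, one_mul]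

theorem ordLE_mulOp_del_inv (f : R) (g : R) :
    (mulOp δ f * del δ (-1) * mulOp δ g).OrdLE (-1) :=
  ((ordLE_mulOp f).mul (ordLE_del (-1))).mul (ordLE_mulOp g)

theorem IsDiff.neg_mul {D : PDO δ} (h : D.IsDiff) (f g : R) :
    (D * (mulOp δ f * del δ (-1) * mulOp δ g)).neg
      = mulOp δ (D.apply f) * del δ (-1) * mulOp δ g := by
  obtain ⟨C, hC, hCe⟩ := h.mul_mulOp_del_inv f
  rw [← mul_assoc, ← mul_assoc, hCe, add_mul, neg_add', (hC.mul (isDiff_mulOp g)).neg_eq, zero_add,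
    (ordLE_mulOp_del_inv _ _).neg_eq]

theorem IsDiff.mul_neg {D : PDO δ} (h : D.IsDiff) (f g : R) :
    (mulOp δ f * del δ (-1) * mulOp δ g * D).neg
      = mulOp δ f * del δ (-1) * mulOp δ (D.adjoint.apply g) := by
  obtain ⟨C, hC, hCe⟩ := h.del_inv_mulOp_mul g
  rw [mul_assoc, mul_assoc, ← mul_assoc (del δ (-1)), hCe, mul_add, neg_add',
    ((isDiff_mulOp f).mul hC).neg_eq, zero_add, ← mul_assoc, (ordLE_mulOp_del_inv _ _).neg_eq]

/-! ### Derivations of the coefficients -/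

theorem diff_add (e : Derivation ℂ R R) (P Q : PDO δ) :
    (P + Q).diff e = P.diff e + Q.diff e := by ext m; simp

theorem diff_sub (e : Derivation ℂ R R) (P Q : PDO δ) :
    (P - Q).diff e = P.diff e - Q.diff e := by ext m; simp

theorem diff_mulOp (e : Derivation ℂ R R) (f : R) : (mulOp δ f).diff e = mulOp δ (e f) := by
  ext m; by_cases h : m = 0 <;> simp [coeff_mulOp, h]

theorem diff_del (e : Derivation ℂ R R) (i : ℤ) : (del δ i).diff e = 0 := by
  ext m; by_cases h : m = i <;> simp [coeff_del, h]

theorem diff_one (e : Derivation ℂ R R) : (1 : PDO δ).diff e = 0 := diff_del e 0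

theorem diff_mul {e : Derivation ℂ R R} (he : ∀ a, e (δ a) = δ (e a)) (P Q : PDO δ) :
    (P * Q).diff e = P.diff e * Q + P * Q.diff e := by
  have hit : ∀ (k : ℕ) (a : R), e (δ^[k] a) = δ^[k] (e a) := fun k a => by
    induction k with
    | zero => rfl
    | succ k ih => rw [Function.iterate_succ_apply', he, ih, Function.iterate_succ_apply']
  ext m
  rw [coeff_diff, coeff_add, coeff_mul, coeff_mul, coeff_mul,
    ← finsum_add_distrib (finite_mulTerm _ _ _) (finite_mulTerm _ _ _)]
  have := (e : R →ₗ[ℂ] R).toAddMonoidHom.map_finsum (finite_mulTerm P Q m)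
  refine this.trans (finsum_congr fun x => ?_)
  change e (mulTerm P Q m x) = _
  rw [mulTerm, map_zsmul, e.leibniz, hit, mulTerm, mulTerm, ← smul_add]
  simp only [coeff_diff, smul_eq_mul]
  congr 1; ring

end Adjoint

end PDO

end CMBKP

end

/-! ### Operators of B type, the concomitant `omega` and the Lax equations. -/

noncomputable section

namespace CMBKP

namespace PDO

section BType

variable {R : Type*} [CommRing R] [Algebra ℂ R] {d : ℕ → Derivation ℂ R R}

local notation "𝐃" => PDO.del (d 0) 1
local notation "𝐈" => PDO.del (d 0) (-1)
local notation "𝐦" => PDO.mulOp (d 0)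

/-! ### Operators of B type -/

theorem del_mul_sub_mul_del (P : PDO (d 0)) : 𝐃 * P - P * 𝐃 = P.diff (d 0) := by
  ext m; simp [del_one_mul_coeff, coeff_mul_del]

theorem deriv_res (P : PDO (d 0)) :
    d 0 (P.coeff (-1)) = (𝐃 * P).coeff (-1) - (P * 𝐃).coeff (-1) := by
  rw [← coeff_sub, del_mul_sub_mul_del, coeff_diff]

/-- Substitute `∂⁻¹ v_x = v - ∂⁻¹ v ∂`, and likewise for `u_x`; the local terms `u v` cancel. The
factor in front of `∂` is self-adjoint, which is the B type condition. -/
theorem laxOp_eq (u v : R) :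
    laxOp d u v = (1 + 𝐦 v * 𝐈 * 𝐦 u - 𝐦 u * 𝐈 * 𝐦 v) * 𝐃 := by
  have h : ∀ f g : R, 𝐦 f * 𝐈 * 𝐦 (d 0 g) = 𝐦 (f * g) - 𝐦 f * 𝐈 * 𝐦 g * 𝐃 := fun f g => by
    rw [mulOp_deriv, mul_sub, ← mul_assoc, mul_del_inv_mul_del, mulOp_mul, ← mul_assoc]
  rw [laxOp, h, h, sub_mul, add_mul, one_mul, mul_comm v u]
  abel

theorem laxOp_sub_del_ordLE (u v : R) : (laxOp d u v - 𝐃).OrdLE (-1) := by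
  have : laxOp d u v - 𝐃 = 𝐦 u * 𝐈 * 𝐦 (d 0 v) - 𝐦 v * 𝐈 * 𝐦 (d 0 u) := by rw [laxOp]; abel
  rw [this]
  exact (ordLE_mulOp_del_inv _ _).sub (ordLE_mulOp_del_inv _ _)

theorem coeff_laxOp (u v : R) {m : ℤ} (hm : -1 < m) :
    (laxOp d u v).coeff m = if m = 1 then 1 else 0 := by
  have := laxOp_sub_del_ordLE (d := d) u v m hm
  rw [coeff_sub, sub_eq_zero] at this
  rw [this, coeff_del]

theorem laxOp_bType (u v : R) : (laxOp d u v).adjoint * 𝐃 = -(𝐃 * laxOp d u v) := by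
  have hK : (1 + 𝐦 v * 𝐈 * 𝐦 u - 𝐦 u * 𝐈 * 𝐦 v).adjoint
      = 1 + 𝐦 v * 𝐈 * 𝐦 u - 𝐦 u * 𝐈 * 𝐦 v := by
    simp only [adjoint_add, adjoint_sub, adjoint_mul, adjoint_mulOp, adjoint_del_neg_one,
      adjoint_one, neg_mul, mul_neg, mul_assoc]
    abel
  rw [laxOp_eq, adjoint_mul, hK, adjoint_del_one]
  simp only [neg_mul, mul_assoc]

theorem bType_pow {L : PDO (d 0)} (h : L.adjoint * 𝐃 = -(𝐃 * L)) (k : ℕ) :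
    (L ^ (2 * k + 1)).adjoint * 𝐃 = -(𝐃 * L ^ (2 * k + 1)) := by
  have h2 : ∀ n : ℕ, L.adjoint ^ n * 𝐃 = (-1) ^ n * (𝐃 * L ^ n) := fun n => by
    induction n with
    | zero => simp
    | succ n ih =>
      rw [pow_succ, mul_assoc, h, mul_neg, ← mul_assoc, ih, pow_succ L, pow_succ (-1 : PDO (d 0))]
      simp only [mul_assoc, mul_neg, neg_mul, one_mul]
  rw [adjoint_pow, h2, Odd.neg_one_pow ⟨k, rfl⟩, neg_one_mul]

/-- `B = Y ∂` for a self-adjoint differential operator `Y`. -/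
def IsBOp (B : PDO (d 0)) : Prop := ∃ Y : PDO (d 0), Y.IsDiff ∧ Y.adjoint = Y ∧ B = Y * 𝐃

/-- The operator `Q ∂⁻¹` is self-adjoint, so its residue, which is the constant term of `Q`,
vanishes. Therefore truncation commutes with division by `∂`. -/
theorem isBOp_pos {Q : PDO (d 0)} (h : Q.adjoint * 𝐃 = -(𝐃 * Q)) : IsBOp Q.pos := by
  have hY : (Q * 𝐈).adjoint = Q * 𝐈 := by
    have h' := congrArg (fun P => 𝐈 * (P * 𝐈)) h
    simp only [mul_del_mul_del_inv, neg_mul, mul_neg, ← mul_assoc, del_inv_mul_del, one_mul] at h'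
    rw [adjoint_mul, adjoint_del_neg_one, neg_mul, h', neg_neg]
  refine ⟨(Q * 𝐈).pos, isDiff_pos _, by rw [← adjoint_pos, hY], ?_⟩
  have hr := res_eq_zero_of_adjoint_eq hY
  ext m
  rw [coeff_mul_del, coeff_pos, coeff_pos, coeff_mul_del]
  rw [coeff_mul_del] at hr
  by_cases hm : m = 0
  · subst hm; simpa using hr
  · by_cases hm' : 0 ≤ m
    · rw [if_pos hm', if_pos (by omega)]; congr 1; omega
    · rw [if_neg hm', if_neg (by omega)]

theorem isBOp_flowOp {L : PDO (d 0)} (h : L.adjoint * 𝐃 = -(𝐃 * L)) (k : ℕ) :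
    IsBOp (flowOp d L k) := by
  rw [flowOp, pow_eq]
  exact isBOp_pos (bType_pow h k)

theorem isBOp_flowOp_laxOp (u v : R) (k : ℕ) : IsBOp (flowOp d (laxOp d u v) k) :=
  isBOp_flowOp (laxOp_bType u v) k

theorem IsBOp.isDiff {B : PDO (d 0)} (hB : IsBOp B) : B.IsDiff := by
  obtain ⟨Y, hY, -, rfl⟩ := hB
  exact hY.mul (isDiff_del 1)

theorem IsBOp.coeff_zero {B : PDO (d 0)} (hB : IsBOp B) : B.coeff 0 = 0 := by
  obtain ⟨Y, hY, -, rfl⟩ := hB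
  rw [coeff_mul_del]
  exact hY _ (by norm_num)

theorem apply_mul_del {Y : PDO (d 0)} (hY : Y.IsDiff) (f : R) :
    (Y * 𝐃).apply f = Y.apply (d 0 f) := by
  rw [apply_eq, apply_eq, mul_assoc, del_mul_mulOp, mul_add, coeff_add, ← mul_assoc, coeff_mul_del,
    (hY.mul (isDiff_mulOp f)) _ (by norm_num), zero_add]

/-- From `B = Y ∂` follows `B^* = -∂ Y`. Along the flow of `B`, the derivative of an eigenfunction
is thus an adjoint eigenfunction. -/
theorem IsBOp.adjoint_apply {B : PDO (d 0)} (hB : IsBOp B) (f : R) :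
    B.adjoint.apply (d 0 f) = -d 0 (B.apply f) := by
  obtain ⟨Y, hY, hYa, rfl⟩ := hB
  rw [apply_mul_del hY, adjoint_mul, hYa, adjoint_del_one, apply_eq, apply_eq, neg_mul, neg_mul,
    coeff_neg, mul_assoc, del_one_mul_coeff, (hY.mul (isDiff_mulOp _)) _ (by norm_num), zero_add]

/-- The bilinear concomitant `res ∂⁻¹ f_x B g ∂⁻¹`, which is the derivative of `∫ f_x g` along the
flow of `B`. -/
def omega (B : PDO (d 0)) (f g : R) : R := (𝐈 * 𝐦 (d 0 f) * B * 𝐦 g * 𝐈).coeff (-1)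

theorem omega_eq_res {B C : PDO (d 0)} {g : R} (hC : B * 𝐦 g * 𝐈 = C + 𝐦 (B.apply g) * 𝐈) (f : R) :
    omega B f g = (𝐈 * 𝐦 (d 0 f) * C).coeff (-1) := by
  have : 𝐈 * 𝐦 (d 0 f) * B * 𝐦 g * 𝐈 = 𝐈 * 𝐦 (d 0 f) * (B * 𝐦 g * 𝐈) := by
    simp only [mul_assoc]
  rw [omega, this, hC, mul_add, coeff_add, add_eq_left]
  exact OrdLE.res (((ordLE_del (-1)).mul (ordLE_mulOp _)).mul
    ((ordLE_mulOp _).mul (ordLE_del (-1))))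

/-- Infinitesimal form of `∫ f_x g + ∫ g_x f = f g`. The relation `∂ g ∂⁻¹ = g + g_x ∂⁻¹` splits
`omega` into `g B(f)` and a residue that is antisymmetric because `Y` is self-adjoint. -/
theorem IsBOp.omega_symm {B : PDO (d 0)} (hB : IsBOp B) (f g : R) :
    omega B f g + omega B g f = f * B.apply g + g * B.apply f := by
  obtain ⟨Y, hY, hYa, rfl⟩ := hB
  have h : ∀ f g : R, omega (Y * 𝐃) f g = g * (Y * 𝐃).apply f
      + (𝐈 * 𝐦 (d 0 f) * Y * 𝐦 (d 0 g) * 𝐈).coeff (-1) := fun f g => by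
    have : 𝐈 * 𝐦 (d 0 f) * (Y * 𝐃) * 𝐦 g * 𝐈
        = 𝐈 * 𝐦 (d 0 f) * Y * 𝐦 g + 𝐈 * 𝐦 (d 0 f) * Y * 𝐦 (d 0 g) * 𝐈 := by
      have hg : 𝐃 * 𝐦 g * 𝐈 = 𝐦 g + 𝐦 (d 0 g) * 𝐈 := by
        rw [del_mul_mulOp, add_mul, mul_del_mul_del_inv]
      calc _ = 𝐈 * 𝐦 (d 0 f) * Y * (𝐃 * 𝐦 g * 𝐈) := by simp only [mul_assoc]
        _ = _ := by rw [hg, mul_add]; simp only [mul_assoc]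
    rw [omega, this, coeff_add, res_mul_mulOp, hY.res_del_inv_mulOp_mul, hYa, apply_mul_del hY,
      mul_comm]
  have ha : (𝐈 * 𝐦 (d 0 f) * Y * 𝐦 (d 0 g) * 𝐈).coeff (-1)
      = -(𝐈 * 𝐦 (d 0 g) * Y * 𝐦 (d 0 f) * 𝐈).coeff (-1) := by
    rw [← res_adjoint]
    simp only [adjoint_mul, adjoint_mulOp, adjoint_del_neg_one, hYa, mul_assoc, neg_mul, mul_neg,
      neg_neg]
  rw [h, h, ha]
  ring

theorem IsBOp.omega_self {B : PDO (d 0)} (hB : IsBOp B) (f : R) :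
    omega B f f = f * B.apply f := by
  have h := hB.omega_symm f f
  rw [← two_smul ℂ (omega B f f), ← two_smul ℂ (f * B.apply f)] at h
  exact (IsUnit.mk0 (2 : ℂ) two_ne_zero).smul_left_cancel.1 h

theorem IsBOp.deriv_omega {B : PDO (d 0)} (hB : IsBOp B) (f g : R) :
    d 0 (omega B f g) = d 0 f * B.apply g + g * d 0 (B.apply f) := by
  rw [omega, deriv_res, mul_del_inv_mul_del, res_mul_mulOp, hB.isDiff.res_del_inv_mulOp_mul,
    hB.adjoint_apply]
  have : 𝐃 * (𝐈 * 𝐦 (d 0 f) * B * 𝐦 g * 𝐈) = 𝐦 (d 0 f) * (B * 𝐦 g * 𝐈) := by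
    simp only [mul_assoc, del_mul_del_inv_mul]
  rw [this, res_mulOp_mul, res_mul_mulOp_mul_del_inv]
  ring

theorem omega_del (f g : R) : omega (d := d) 𝐃 f g = d 0 f * g := by
  have : 𝐈 * 𝐦 (d 0 f) * 𝐃 * 𝐦 g * 𝐈
      = 𝐈 * 𝐦 (d 0 f) * 𝐦 g + 𝐈 * 𝐦 (d 0 f) * (𝐦 (d 0 g) * 𝐈) := by
    rw [mul_assoc, mul_assoc, ← mul_assoc 𝐃, del_mul_mulOp, add_mul, mul_del_mul_del_inv, mul_add]
  rw [omega, this, coeff_add, res_mul_mulOp, res_mul_mulOp, coeff_del, if_pos rfl, one_mul,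
    add_eq_left]
  exact OrdLE.res (((ordLE_del (-1)).mul (ordLE_mulOp _)).mul
    ((ordLE_mulOp _).mul (ordLE_del (-1))))

theorem omega_neg_left (B : PDO (d 0)) (f g : R) : omega B (-f) g = -omega B f g := by
  simp only [omega, map_neg, mulOp_neg, mul_neg, neg_mul, coeff_neg]

theorem flowOp_zero (u v : R) : flowOp d (laxOp d u v) 0 = 𝐃 := by
  rw [flowOp, pow_eq, mul_zero, zero_add, pow_one]
  ext m
  rw [coeff_pos, coeff_del]
  split_ifs with h1 h2 h2
  · rw [coeff_laxOp u v (by omega), if_pos h2]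
  · rw [coeff_laxOp u v (by omega), if_neg h2]
  · omega
  · rfl

theorem del_apply (f : R) : (𝐃).apply f = d 0 f := by
  rw [apply_eq, del_mul_mulOp, coeff_add, coeff_mul_del, coeff_mulOp, coeff_mulOp]; simp

/-! ### The Lax equations -/

theorem flowOp_eq_sub (L : PDO (d 0)) (k : ℕ) :
    flowOp d L k = L ^ (2 * k + 1) - (L ^ (2 * k + 1)).neg := by
  rw [flowOp, pow_eq, eq_sub_iff_add_eq, pos_add_neg]

/-- As `L` commutes with its powers, the commutator equals `[L, (L^{2k+1})_-]`, and commuting with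
`∂` only differentiates coefficients. -/
theorem commutator_ordLE {L : PDO (d 0)} (hL : (L - 𝐃).OrdLE (-1)) (k : ℕ) :
    (flowOp d L k * L - L * flowOp d L k).OrdLE (-1) := by
  set Q := (L ^ (2 * k + 1)).neg with hQdef
  set N := L - 𝐃 with hN
  have hQ : Q.OrdLE (-1) := ordLE_neg _
  have : flowOp d L k * L - L * flowOp d L k = Q.diff (d 0) + (N * Q - Q * N) := by
    rw [flowOp_eq_sub, ← del_mul_sub_mul_del, hN, ← hQdef, sub_mul, mul_sub, ← pow_succ,
      ← pow_succ', sub_mul, mul_sub]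
    abel
  rw [this]
  exact (hQ.diff _).add (((hL.mul hQ).mono (by norm_num)).sub ((hQ.mul hL).mono (by norm_num)))

/-- The commutator `[B, L]` is its own integral part. There `B u ∂⁻¹ v_x` contributes `B(u) ∂⁻¹ v_x`
and `u ∂⁻¹ v_x B` contributes `-u ∂⁻¹ B(v)_x`, so together with the terms with `u` and `v` exchanged
one finds the time derivative of `L`. -/
theorem isLaxSolution_of_isConstrainedSolution (hd : ∀ i j a, d i (d j a) = d j (d i a)) {u v : R}
    (h : IsConstrainedSolution d u v) : IsLaxSolution d (laxOp d u v) where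
  coeff_of_one_lt m hm := by rw [coeff_laxOp u v (by omega), if_neg (by omega)]
  coeff_one := by rw [coeff_laxOp u v (by omega), if_pos rfl]
  coeff_zero := by rw [coeff_laxOp u v (by omega), if_neg (by omega)]
  bType := by
    have := congrArg (fun P => P * 𝐈) (laxOp_bType (d := d) u v)
    simpa only [mul_del_mul_del_inv, neg_mul] using this
  lax k := by
    set B := flowOp d (laxOp d u v) k with hBdef
    have hB : IsBOp B := isBOp_flowOp_laxOp u v k
    have hu : d k u = B.apply u := (h k).1
    have hv : d k v = B.apply v := (h k).2
    have hc := (commutator_ordLE (laxOp_sub_del_ordLE (d := d) u v) k).neg_eq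
    rw [← hBdef] at hc
    rw [← hc]
    have h1 : B * laxOp d u v - laxOp d u v * B = (B * 𝐃 - 𝐃 * B)
        + (B * (𝐦 u * 𝐈 * 𝐦 (d 0 v)) - B * (𝐦 v * 𝐈 * 𝐦 (d 0 u)))
        - (𝐦 u * 𝐈 * 𝐦 (d 0 v) * B - 𝐦 v * 𝐈 * 𝐦 (d 0 u) * B) := by
      rw [laxOp]; noncomm_ring
    have h2 : (B * 𝐃 - 𝐃 * B).neg = 0 := by
      rw [← neg_sub, del_mul_sub_mul_del]
      refine IsDiff.neg_eq fun m hm => ?_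
      rw [coeff_neg, hB.isDiff.diff _ m hm, neg_zero]
    rw [h1, neg_sub', neg_add', h2, neg_sub', neg_sub', hB.isDiff.neg_mul, hB.isDiff.neg_mul,
      hB.isDiff.mul_neg, hB.isDiff.mul_neg, hB.adjoint_apply, hB.adjoint_apply, ← hu, ← hv, laxOp]
    have he : ∀ a, d k (d 0 a) = d 0 (d k a) := hd k 0
    simp only [diff_add, diff_sub, diff_mul he, diff_del, diff_mulOp, mulOp_neg, he]
    noncomm_ring

end BType

end PDO

end CMBKP

end

/-! ### The elementary gauge operator and conjugation of the Lax operator. -/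

noncomputable section

namespace CMBKP

namespace PDO

section Gauge

variable {R : Type*} [CommRing R] [Algebra ℂ R] {d : ℕ → Derivation ℂ R R}

local notation "𝐃" => PDO.del (d 0) 1
local notation "𝐈" => PDO.del (d 0) (-1)
local notation "𝐦" => PDO.mulOp (d 0)

/-! ### The elementary gauge operator -/

variable (d) in
/-- The operator `1 - 2 r ∂⁻¹ u_x`, where `r` is the inverse of `u`. -/
def stepOp (u r : R) : PDO (d 0) := 1 - 𝐦 (2 * r) * 𝐈 * 𝐦 (d 0 u)

variable (d) in
/-- The operator `1 - 2 u ∂⁻¹ r_x`, where `r` is the inverse of `u`. -/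
def stepInv (u r : R) : PDO (d 0) := 1 - 𝐦 u * 𝐈 * 𝐦 (d 0 (2 * r))

theorem del_inv_mul_del_inv_of_deriv {S g : R} (hS : d 0 S = g) :
    𝐈 * 𝐦 g * 𝐈 = 𝐦 S * 𝐈 - 𝐈 * 𝐦 S := by
  rw [← hS, del_inv_mul_deriv_mul_del_inv]

theorem deriv_inv (e : Derivation ℂ R R) {u r : R} (h : u * r = 1) : e r = -(r * r * e u) := by
  have := congrArg e h
  rw [e.leibniz, e.map_one_eq_zero, smul_eq_mul, smul_eq_mul] at this
  linear_combination r * this - (e r) * h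

theorem deriv_two_mul (e : Derivation ℂ R R) (r : R) : e (2 * r) = 2 * e r := by
  rw [two_mul, map_add, two_mul]

theorem deriv_mul (e : Derivation ℂ R R) (a b : R) : e (a * b) = a * e b + b * e a := e.leibniz a b

theorem eq_of_two_mul_eq {a b : R} (h : 2 * a = 2 * b) : a = b := by
  rw [two_mul, two_mul, ← two_smul ℂ a, ← two_smul ℂ b] at h
  exact (IsUnit.mk0 (2 : ℂ) two_ne_zero).smul_left_cancel.1 h

theorem deriv_half_sq (e : Derivation ℂ R R) {u h : R} (hh : 2 * h = u * u) :
    e h = u * e u := by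
  have := congrArg e hh
  rw [deriv_two_mul, deriv_mul] at this
  exact eq_of_two_mul_eq (by rw [this]; ring)

/-- `T f ∂⁻¹ = T(f) ∂⁻¹ + 2 r ∂⁻¹ S` with `S = ∫ u_x f`. -/
theorem stepOp_mul (u r : R) {f S : R} (hS : d 0 S = d 0 u * f) :
    stepOp d u r * 𝐦 f * 𝐈 = 𝐦 (f - 2 * r * S) * 𝐈 + 𝐦 (2 * r) * 𝐈 * 𝐦 S := by
  have h := del_inv_mul_del_inv_of_deriv hS
  have h1 : stepOp d u r * 𝐦 f * 𝐈 = 𝐦 f * 𝐈 - 𝐦 (2 * r) * (𝐈 * 𝐦 (d 0 u * f) * 𝐈) := by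
    rw [stepOp, mulOp_mul (d 0 u)]; noncomm_ring
  rw [h1, h, mulOp_sub, mulOp_mul (2 * r)]
  noncomm_ring

/-- With `∫ u_x u` normalized to `u²/2`, the gauge operator annihilates `u`, and only the nonlocal
remainder of `stepOp_mul` is left. -/
theorem stepOp_mul_self {u r h : R} (hr : u * r = 1) (hh : 2 * h = u * u) :
    stepOp d u r * 𝐦 u * 𝐈 = 𝐦 (2 * r) * 𝐈 * 𝐦 h := by
  have hS : d 0 h = d 0 u * u := by rw [deriv_half_sq _ hh, mul_comm]
  have h0 : u - 2 * r * h = 0 := by linear_combination (-r) * hh - u * hr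
  rw [stepOp_mul u r hS, h0, mulOp_zero, zero_mul, zero_add]

/-- The density between the two `∂⁻¹` is `(2r)_x · 2r = (2r²)_x`, so one integration by parts turns
the double integral into single ones that cancel the rest. -/
theorem stepInv_mul_stepOp {u r : R} (hr : u * r = 1) : stepInv d u r * stepOp d u r = 1 := by
  have hq : d 0 (2 * r * r) = d 0 (2 * r) * (2 * r) := by
    rw [deriv_mul, deriv_two_mul]; ring
  have h := del_inv_mul_del_inv_of_deriv hq
  have h1 : stepInv d u r * stepOp d u r = 1 - 𝐦 u * 𝐈 * 𝐦 (d 0 (2 * r))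
      - 𝐦 (2 * r) * 𝐈 * 𝐦 (d 0 u)
      + 𝐦 u * (𝐈 * 𝐦 (d 0 (2 * r) * (2 * r)) * 𝐈) * 𝐦 (d 0 u) := by
    rw [stepInv, stepOp, mulOp_mul (d 0 (2 * r))]; noncomm_ring
  have h2 : 𝐦 u * 𝐦 (2 * r * r) = 𝐦 (2 * r) := by
    rw [← mulOp_mul]; congr 1; linear_combination (2 * r) * hr
  have h3 : 𝐦 (2 * r * r) * 𝐦 (d 0 u) = -𝐦 (d 0 (2 * r)) := by
    rw [← mulOp_mul, ← mulOp_neg, deriv_two_mul, deriv_inv _ hr]; congr 1; ring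
  rw [h1, h]
  have h4 : 𝐦 u * (𝐦 (2 * r * r) * 𝐈 - 𝐈 * 𝐦 (2 * r * r)) * 𝐦 (d 0 u)
      = (𝐦 u * 𝐦 (2 * r * r)) * 𝐈 * 𝐦 (d 0 u)
        - 𝐦 u * 𝐈 * (𝐦 (2 * r * r) * 𝐦 (d 0 u)) := by noncomm_ring
  rw [h4, h2, h3]
  noncomm_ring

theorem stepOp_adjoint (u r : R) :
    (stepOp d u r).adjoint = 1 + 𝐦 (d 0 u) * 𝐈 * 𝐦 (2 * r) := by
  rw [stepOp]
  simp only [adjoint_sub, adjoint_mul, adjoint_mulOp, adjoint_del_neg_one, adjoint_one, mul_neg,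
    neg_mul, mul_assoc]
  abel

theorem stepOp_adjoint_mul_del {u r : R} (hr : u * r = 1) :
    (stepOp d u r).adjoint * 𝐃 = 𝐃 * stepInv d u r := by
  have h1 : 𝐈 * 𝐦 (2 * r) * 𝐃 = 𝐦 (2 * r) - 𝐈 * 𝐦 (d 0 (2 * r)) := by
    rw [mulOp_deriv, mul_sub, del_inv_mul_del_mul, mul_assoc]; abel
  have h2 : 𝐃 * 𝐦 u * 𝐈 = 𝐦 u + 𝐦 (d 0 u) * 𝐈 := by
    rw [del_mul_mulOp, add_mul, mul_del_mul_del_inv]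
  have h3 : 𝐦 u * 𝐦 (d 0 (2 * r)) = -(𝐦 (d 0 u) * 𝐦 (2 * r)) := by
    rw [← mulOp_mul, ← mulOp_mul, ← mulOp_neg, deriv_two_mul, deriv_inv _ hr]
    congr 1
    linear_combination (-(2 * r * d 0 u)) * hr
  calc (stepOp d u r).adjoint * 𝐃 = 𝐃 + 𝐦 (d 0 u) * (𝐈 * 𝐦 (2 * r) * 𝐃) := by
        rw [stepOp_adjoint]; noncomm_ring
    _ = 𝐃 - (𝐃 * 𝐦 u * 𝐈) * 𝐦 (d 0 (2 * r)) := by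
        rw [h1, h2, add_mul, h3]; noncomm_ring
    _ = _ := by rw [stepInv]; noncomm_ring

theorem stepOp_bType {u r : R} (hr : u * r = 1) :
    (stepOp d u r).adjoint * 𝐃 * stepOp d u r = 𝐃 := by
  rw [stepOp_adjoint_mul_del hr, mul_assoc, stepInv_mul_stepOp hr, mul_one]

theorem stepOp_sub_one_ordLE (u r : R) : (stepOp d u r - 1).OrdLE (-1) := by
  rw [stepOp, sub_sub_cancel_left]
  exact (ordLE_mulOp_del_inv _ _).neg'

/-- `∂⁻¹ T(f)_x = ∂⁻¹ f_x T⁻¹ + N ∂⁻¹ (2 r)_x` with `N = ∫ u f_x`. -/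
theorem del_inv_mul_deriv_step {u r f N : R} (hr : u * r = 1) (hN : d 0 N = u * d 0 f) :
    𝐈 * 𝐦 (d 0 (2 * r * N - f)) = 𝐈 * 𝐦 (d 0 f) * stepInv d u r + 𝐦 N * 𝐈 * 𝐦 (d 0 (2 * r)) := by
  have h := del_inv_mul_del_inv_of_deriv hN
  have h1 : 𝐈 * 𝐦 (d 0 f) * stepInv d u r
      = 𝐈 * 𝐦 (d 0 f) - (𝐈 * 𝐦 (u * d 0 f) * 𝐈) * 𝐦 (d 0 (2 * r)) := by
    rw [stepInv, mul_comm u, mulOp_mul]; noncomm_ring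
  have h2 : d 0 (2 * r * N - f) = d 0 f + N * d 0 (2 * r) := by
    rw [map_sub, deriv_mul, hN]; linear_combination (2 * d 0 f) * hr
  rw [h1, h, h2, mulOp_add, mulOp_mul]
  noncomm_ring

/-- Writing `L = K ∂` and `L' = K' ∂`, it suffices that `T K T^* = K'`, because `T^* ∂ T = ∂`. -/
theorem stepOp_conj {u v r h a b f₁ : R} (hr : u * r = 1) (hh : 2 * h = u * u)
    (ha : d 0 a = d 0 v * u) (hf : f₁ = d 0 u + u * a - v * h) (hb : d 0 b = d 0 u * f₁) :
    laxOp d (f₁ - 2 * r * b) (-(2 * r)) * stepOp d u r = stepOp d u r * laxOp d u v := by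
  have hK : stepOp d u r * (1 + 𝐦 v * 𝐈 * 𝐦 u - 𝐦 u * 𝐈 * 𝐦 v) * (stepOp d u r).adjoint
      = 1 + 𝐦 (-(2 * r)) * 𝐈 * 𝐦 (f₁ - 2 * r * b) - 𝐦 (f₁ - 2 * r * b) * 𝐈 * 𝐦 (-(2 * r)) := by
    have e1 := stepOp_mul_self (d := d) hr hh
    have e2 : 𝐈 * 𝐦 u * (stepOp d u r).adjoint = 𝐦 h * 𝐈 * 𝐦 (2 * r) := by
      have := congrArg adjoint e1
      simp only [adjoint_mul, adjoint_mulOp, adjoint_del_neg_one, mul_neg, neg_mul,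
        neg_inj] at this
      simpa only [mul_assoc] using this
    set s := 2 * r with hs
    set T := stepOp d u r with hT
    have e3 : T = 1 - 𝐦 s * 𝐈 * 𝐦 (d 0 u) := rfl
    have e4 : T.adjoint = 1 + 𝐦 (d 0 u) * 𝐈 * 𝐦 s := stepOp_adjoint u r
    have e5 : T * (1 + 𝐦 v * 𝐈 * 𝐦 u - 𝐦 u * 𝐈 * 𝐦 v) * T.adjoint
        = 1 + 𝐦 (d 0 u + v * h) * 𝐈 * 𝐦 s - 𝐦 s * 𝐈 * 𝐦 (d 0 u + v * h)
          - 𝐦 s * (𝐈 * 𝐦 (d 0 u * (d 0 u + v * h + v * h)) * 𝐈) * 𝐦 s := by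
      calc _ = T * T.adjoint + T * 𝐦 v * (𝐈 * 𝐦 u * T.adjoint)
            - (T * 𝐦 u * 𝐈) * 𝐦 v * T.adjoint := by noncomm_ring
        _ = _ := by
          rw [e2, e1, e4, e3]
          simp only [mulOp_mul, mulOp_add]
          have c1 : 𝐦 h * 𝐦 v = 𝐦 v * 𝐦 h := mulOp_comm _ _
          have c2 : 𝐦 v * 𝐦 h * 𝐦 (d 0 u) = 𝐦 (d 0 u) * (𝐦 v * 𝐦 h) := by
            rw [← mulOp_mul, mulOp_comm]
          have : 𝐦 s * 𝐈 * 𝐦 h * 𝐦 v * (1 + 𝐦 (d 0 u) * 𝐈 * 𝐦 s)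
              = 𝐦 s * 𝐈 * (𝐦 v * 𝐦 h) + 𝐦 s * 𝐈 * (𝐦 (d 0 u) * (𝐦 v * 𝐦 h)) * 𝐈 * 𝐦 s := by
            rw [← c2, ← c1]; noncomm_ring
          rw [this]
          noncomm_ring
    -- An explicit primitive for the density in the remaining double integral, found from `(u v -
    -- a)_x = v u_x`.
    have e6 : d 0 (h * (u * v - a) + b) = d 0 u * (d 0 u + v * h + v * h) := by
      rw [map_add, deriv_mul, map_sub, deriv_mul, hb, ha, deriv_half_sq _ hh, hf]
      linear_combination (-(d 0 u) * v) * hh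
    have e7 : d 0 u + v * h = f₁ + s * (h * (u * v - a)) := by
      rw [hf, hs]
      linear_combination (-r * (u * v - a)) * hh + (-u * (u * v - a)) * hr + v * hh
    rw [e5, del_inv_mul_del_inv_of_deriv e6, e7]
    generalize h * (u * v - a) = c
    have c1 : 𝐦 s * 𝐦 c = 𝐦 c * 𝐦 s := mulOp_comm _ _
    have c2 : 𝐦 s * 𝐦 b = 𝐦 b * 𝐦 s := mulOp_comm _ _
    have c3 : 𝐈 * (𝐦 c * 𝐦 s) = 𝐈 * (𝐦 s * 𝐦 c) := by rw [c1]
    have c4 : 𝐈 * (𝐦 b * 𝐦 s) = 𝐈 * (𝐦 s * 𝐦 b) := by rw [c2]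
    simp only [mulOp_add, mulOp_sub, mulOp_neg, mulOp_mul]
    noncomm_ring [c3, c4]
  have e8 := stepOp_bType (d := d) hr
  rw [laxOp_eq, laxOp_eq, ← hK]
  calc _ = stepOp d u r * (1 + 𝐦 v * 𝐈 * 𝐦 u - 𝐦 u * 𝐈 * 𝐦 v)
        * ((stepOp d u r).adjoint * 𝐃 * stepOp d u r) := by simp only [mul_assoc]
    _ = _ := by rw [e8, mul_assoc]

end Gauge

end PDO

end CMBKP

end

/-! ### Flows under the elementary gauge transformation. -/

noncomputable section

namespace CMBKP

namespace PDO

section GaugeFlow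

variable {R : Type*} [CommRing R] [Algebra ℂ R] {d : ℕ → Derivation ℂ R R}

local notation "𝐃" => PDO.del (d 0) 1
local notation "𝐈" => PDO.del (d 0) (-1)
local notation "𝐦" => PDO.mulOp (d 0)

/-- The elementary gauge operator of the invertible eigenfunction `u` intertwines the flow `e` of
`B` with the flow of `B'`. -/
structure IsStepFlow (e : Derivation ℂ R R) (u r h : R) (B B' : PDO (d 0)) : Prop where
  comm : ∀ a, e (d 0 a) = d 0 (e a)
  mul_inv : u * r = 1
  half_sq : 2 * h = u * u
  bOp : IsBOp B
  bOp' : IsBOp B'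
  eigen : e u = B.apply u
  flow : (stepOp d u r).diff e = B' * stepOp d u r - stepOp d u r * B
  eigen_inv : e (2 * r) = B'.apply (2 * r)

theorem diff_stepOp {e : Derivation ℂ R R} (he : ∀ a, e (d 0 a) = d 0 (e a)) (u r : R) :
    (stepOp d u r).diff e
      = -(𝐦 (e (2 * r)) * 𝐈 * 𝐦 (d 0 u) + 𝐦 (2 * r) * 𝐈 * 𝐦 (d 0 (e u))) := by
  rw [stepOp]
  simp only [diff_sub, diff_mul he, diff_one, diff_del, diff_mulOp, he]
  noncomm_ring

/-- The defect `T_t + T B - B' T` has negative order, since `T` intertwines the full powers of `L`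
and `L'`. Its integral part is explicit: the `u_x`-terms cancel and `ρ ∂⁻¹ u_x` remains, with `ρ =
B'(2r) - (2r)_t`. -/
theorem isStepFlow (hd : ∀ i j a, d i (d j a) = d j (d i a)) {u r h : R} (hr : u * r = 1)
    (hh : 2 * h = u * u) {L L' : PDO (d 0)} (hL : L.adjoint * 𝐃 = -(𝐃 * L))
    (hL' : L'.adjoint * 𝐃 = -(𝐃 * L')) (hc : L' * stepOp d u r = stepOp d u r * L) (k : ℕ)
    (hu : d k u = (flowOp d L k).apply u) :
    IsStepFlow (d k) u r h (flowOp d L k) (flowOp d L' k) := by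
  set B := flowOp d L k with hBdef
  set B' := flowOp d L' k with hBdef'
  set T := stepOp d u r with hT
  have hB : IsBOp B := isBOp_flowOp hL k
  have hB' : IsBOp B' := isBOp_flowOp hL' k
  have he : ∀ a, d k (d 0 a) = d 0 (d k a) := hd k 0
  have hTo : T.OrdLE 0 := by
    have := (stepOp_sub_one_ordLE (d := d) u r).mono (show (-1 : ℤ) ≤ 0 by norm_num)
    have h1 := this.add (ordLE_mulOp 1)
    rwa [mulOp_one, sub_add_cancel] at h1
  have hdT := diff_stepOp he u r
  have hord : (T.diff (d k) + T * B - B' * T).OrdLE (-1) := by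
    have hp : L' ^ (2 * k + 1) * T = T * L ^ (2 * k + 1) :=
      ((show SemiconjBy T L L' from hc.symm).pow_right (2 * k + 1)).eq.symm
    have : T.diff (d k) + T * B - B' * T = T.diff (d k)
        + ((L' ^ (2 * k + 1)).neg * T - T * (L ^ (2 * k + 1)).neg) := by
      rw [hBdef, hBdef', flowOp_eq_sub, flowOp_eq_sub, mul_sub, sub_mul, hp]; abel
    rw [this, hdT]
    exact (((ordLE_mulOp_del_inv _ _).add (ordLE_mulOp_del_inv _ _)).neg').add
      ((((ordLE_neg _).mul hTo).mono (by norm_num)).sub ((hTo.mul (ordLE_neg _)).mono (by norm_num)))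
  have hZ : T.diff (d k) + T * B - B' * T
      = 𝐦 (B'.apply (2 * r) - d k (2 * r)) * 𝐈 * 𝐦 (d 0 u) := by
    have h1 : T * B = B - 𝐦 (2 * r) * 𝐈 * 𝐦 (d 0 u) * B := by rw [hT, stepOp]; noncomm_ring
    have h2 : B' * T = B' - B' * (𝐦 (2 * r) * 𝐈 * 𝐦 (d 0 u)) := by rw [hT, stepOp]; noncomm_ring
    rw [← hord.neg_eq, neg_sub', neg_add', h1, h2, neg_sub', neg_sub', hB.isDiff.neg_eq,
      hB'.isDiff.neg_eq, hB.isDiff.mul_neg, hB'.isDiff.neg_mul, hB.adjoint_apply, hdT,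
      (OrdLE.neg' ((ordLE_mulOp_del_inv _ _).add (ordLE_mulOp_del_inv _ _))).neg_eq, ← hu,
      mulOp_neg, mulOp_sub]
    noncomm_ring
  have hself := stepOp_mul_self (d := d) hr hh
  rw [← hT] at hself
  -- The defect times `u ∂⁻¹` has order at most `-2` and hence no residue. Computing that residue
  -- from `T u ∂⁻¹ = 2r ∂⁻¹ h` gives `-ρ h`, and `h` is invertible with inverse `2r²`.
  have hρ : B'.apply (2 * r) = d k (2 * r) := by
    obtain ⟨C, hC, hCe⟩ := hB.isDiff.mul_mulOp_del_inv u
    have h1 : ((T.diff (d k) + T * B - B' * T) * 𝐦 u * 𝐈).coeff (-1) = 0 := by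
      rw [hZ]
      exact OrdLE.res (((ordLE_mulOp_del_inv _ _).mul (ordLE_mulOp u)).mul (ordLE_del (-1)))
    have h2 : (T.diff (d k) + T * B - B' * T) * 𝐦 u * 𝐈
        = 𝐦 (d k (2 * r)) * 𝐈 * 𝐦 h + 𝐦 (2 * r) * 𝐈 * 𝐦 (d k h) + T * C
          - B' * 𝐦 (2 * r) * 𝐈 * 𝐦 h := by
      have h3 := congrArg (PDO.diff (d k)) hself
      simp only [diff_mul he, diff_mulOp, diff_del, mul_zero, add_zero] at h3
      have h4 : (T.diff (d k) + T * B - B' * T) * 𝐦 u * 𝐈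
        = (T.diff (d k) * 𝐦 u + T * 𝐦 (d k u)) * 𝐈 - T * (𝐦 (d k u) * 𝐈) + T * (B * 𝐦 u * 𝐈)
          - B' * (T * 𝐦 u * 𝐈) := by noncomm_ring
      rw [h4, h3, hself, hCe, hu]
      noncomm_ring
    have h5 : (T * C).coeff (-1) = -(2 * r * (u * B.apply u)) := by
      have : T * C = C - 𝐦 (2 * r) * (𝐈 * 𝐦 (d 0 u) * C) := by rw [hT, stepOp]; noncomm_ring
      rw [this, coeff_sub, hC.res, res_mulOp_mul, ← omega_eq_res hCe, hB.omega_self, zero_sub]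
    rw [h2, coeff_sub, coeff_add, coeff_add, h5, res_mul_mulOp, res_mul_mulOp, res_mul_mulOp,
      res_mul_mulOp_mul_del_inv, coeff_mulOp_mul_del, coeff_mulOp_mul_del, if_pos rfl, if_pos rfl,
      deriv_half_sq _ hh, ← hu] at h1
    have h6 : h * (2 * r * r) = 1 := by linear_combination (r * r) * hh + (u * r + 1) * hr
    linear_combination (B'.apply (2 * r) - d k (2 * r)) * (-h6) - (2 * r * r) * h1
  refine ⟨he, hr, hh, hB, hB', hu, ?_, hρ.symm⟩
  rw [hρ, sub_self, mulOp_zero, zero_mul, zero_mul] at hZ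
  rw [← sub_eq_zero, ← hZ]
  abel

namespace IsStepFlow

variable {e : Derivation ℂ R R} {u r h : R} {B B' : PDO (d 0)}

/-- Represents the new eigenfunction `2r`, which is not an image under `T`, through the kernel
element `u`; here `h⁻¹ = 2r²`. -/
theorem inv_mul_del_inv (H : IsStepFlow e u r h B B') :
    𝐦 (2 * r) * 𝐈 = stepOp d u r * 𝐦 u * 𝐈 * 𝐦 (2 * r * r) := by
  rw [stepOp_mul_self H.mul_inv H.half_sq, mul_assoc, ← mulOp_mul,
    show h * (2 * r * r) = 1 by
      linear_combination (r * r) * H.half_sq + (u * r + 1) * H.mul_inv, mulOp_one, mul_one]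

/-- The image `f - 2 r S`, `S = ∫ u_x f`, of an eigenfunction is an eigenfunction. -/
theorem eigen_step (H : IsStepFlow e u r h B B') {f S : R} (hf : e f = B.apply f)
    (hSx : d 0 S = d 0 u * f) (hS : e S = omega B u f) :
    e (f - 2 * r * S) = B'.apply (f - 2 * r * S) := by
  obtain ⟨C, hC, hCe⟩ := H.bOp.isDiff.mul_mulOp_del_inv f
  have h0 := stepOp_mul (d := d) u r hSx
  -- Differentiate the formula for `T f ∂⁻¹` along the flow and compare residues: the contribution
  -- of `C` cancels that of the time derivative of `S`.
  have h1 := congrArg (PDO.diff e) h0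
  simp only [diff_mul H.comm, diff_add, diff_mulOp, diff_del, mul_zero, add_zero, H.flow] at h1
  have h2 : ((B' * stepOp d u r - stepOp d u r * B) * 𝐦 f + stepOp d u r * 𝐦 (e f)) * 𝐈
      = B' * (stepOp d u r * 𝐦 f * 𝐈) - stepOp d u r * (B * 𝐦 f * 𝐈)
        + stepOp d u r * (𝐦 (e f) * 𝐈) := by noncomm_ring
  have h3 : (stepOp d u r * C).coeff (-1) = -(2 * r * omega B u f) := by
    have : stepOp d u r * C = C - 𝐦 (2 * r) * (𝐈 * 𝐦 (d 0 u) * C) := by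
      rw [stepOp]; noncomm_ring
    rw [this, coeff_sub, hC.res, res_mulOp_mul, ← omega_eq_res hCe, zero_sub]
  have h4 : B' * (𝐦 (f - 2 * r * S) * 𝐈 + 𝐦 (2 * r) * 𝐈 * 𝐦 S)
        - stepOp d u r * (C + 𝐦 (B.apply f) * 𝐈) + stepOp d u r * (𝐦 (e f) * 𝐈)
      = B' * 𝐦 (f - 2 * r * S) * 𝐈 + B' * 𝐦 (2 * r) * 𝐈 * 𝐦 S - stepOp d u r * C := by
    rw [hf]; noncomm_ring
  rw [h2, hCe, h0, h4] at h1
  have h5 := congrArg (fun P => PDO.coeff P (-1)) h1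
  simp only [coeff_add, coeff_sub, h3, res_mul_mulOp_mul_del_inv, res_mul_mulOp,
    coeff_mulOp_mul_del, if_true, ← H.eigen_inv, hS] at h5
  linear_combination -h5

theorem ordLE_inv_mul_flow (H : IsStepFlow e u r h B B') :
    ∃ E : PDO (d 0), E.OrdLE (-1) ∧ stepInv d u r * B' * stepOp d u r = B + E := by
  refine ⟨stepInv d u r * (stepOp d u r).diff e, ?_, ?_⟩
  · have h1 : (stepInv d u r).OrdLE 0 := by
      rw [stepInv]
      exact (ordLE_mulOp 1).sub ((ordLE_mulOp_del_inv _ _).mono (by norm_num))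
    rw [diff_stepOp H.comm]
    exact (h1.mul ((ordLE_mulOp_del_inv _ _).add (ordLE_mulOp_del_inv _ _)).neg').mono (by norm_num)
  · rw [H.flow, mul_sub, ← mul_assoc, ← mul_assoc (stepInv d u r) (stepOp d u r),
      stepInv_mul_stepOp H.mul_inv, one_mul]
    abel

/-- The operators `T⁻¹ B' T` and `B` differ by a term of negative order, which between two factors
`∂⁻¹` has no residue. -/
theorem res_step (H : IsStepFlow e u r h B B') (f g : R) :
    (𝐈 * 𝐦 (d 0 f) * stepInv d u r * B' * stepOp d u r * 𝐦 g * 𝐈).coeff (-1) = omega B f g := by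
  obtain ⟨E, hE, hEe⟩ := H.ordLE_inv_mul_flow
  have : 𝐈 * 𝐦 (d 0 f) * stepInv d u r * B' * stepOp d u r * 𝐦 g * 𝐈
      = 𝐈 * 𝐦 (d 0 f) * B * 𝐦 g * 𝐈 + 𝐈 * 𝐦 (d 0 f) * E * 𝐦 g * 𝐈 := by
    calc _ = 𝐈 * 𝐦 (d 0 f) * (stepInv d u r * B' * stepOp d u r) * 𝐦 g * 𝐈 := by noncomm_ring
      _ = _ := by rw [hEe]; noncomm_ring
  rw [this, coeff_add, omega, add_eq_left]
  exact OrdLE.res ((((((ordLE_del (-1)).mul (ordLE_mulOp _)).mul hE).mul (ordLE_mulOp _)).mul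
    (ordLE_del (-1))).mono (by norm_num))

/-- Here and in the next two lemmas `omega` of transformed functions turns out to be an exact time
derivative, so that an explicit expression can serve as the transformed integral. -/
theorem omega_step_inv (H : IsStepFlow e u r h B B') {f N : R} (hNx : d 0 N = u * d 0 f)
    (hN : e N = omega B f u) :
    omega B' (2 * r * N - f) (2 * r) = e (2 * r * r * N) := by
  have h1 : 𝐈 * 𝐦 (d 0 (2 * r * N - f)) * B' * 𝐦 (2 * r) * 𝐈
      = 𝐈 * 𝐦 (d 0 f) * stepInv d u r * B' * stepOp d u r * 𝐦 u * 𝐈 * 𝐦 (2 * r * r)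
        + 𝐦 N * (𝐈 * 𝐦 (d 0 (2 * r)) * B' * 𝐦 (2 * r) * 𝐈) := by
    calc _ = 𝐈 * 𝐦 (d 0 (2 * r * N - f)) * B' * (𝐦 (2 * r) * 𝐈) := by noncomm_ring
      _ = 𝐈 * 𝐦 (d 0 f) * stepInv d u r * B' * (𝐦 (2 * r) * 𝐈)
          + 𝐦 N * (𝐈 * 𝐦 (d 0 (2 * r)) * B' * 𝐦 (2 * r) * 𝐈) := by
        rw [del_inv_mul_deriv_step H.mul_inv hNx]; noncomm_ring
      _ = _ := by
        congr 1
        rw [H.inv_mul_del_inv]; noncomm_ring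
  have h2 := H.bOp'.omega_self (2 * r)
  rw [omega] at h2
  rw [omega, h1, coeff_add, res_mul_mulOp, res_mulOp_mul, H.res_step, h2, ← H.eigen_inv, ← hN,
    deriv_mul e (2 * r * r), deriv_mul e (2 * r), deriv_two_mul]
  ring

/-- With `N = u f - S` the image of `f` is also `2 r N - f`, so the preceding case applies;
`omega_symm` exchanges the arguments. -/
theorem omega_inv_step (H : IsStepFlow e u r h B B') {f S : R} (hf : e f = B.apply f)
    (hSx : d 0 S = d 0 u * f) (hS : e S = omega B u f) :
    omega B' (2 * r) (f - 2 * r * S) = -e (2 * r * r * S) := by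
  have hN : e (u * f - S) = omega B f u := by
    have := H.bOp.omega_symm u f
    rw [map_sub, deriv_mul, hS, hf, H.eigen]
    linear_combination -this
  have hNx : d 0 (u * f - S) = u * d 0 f := by rw [map_sub, deriv_mul, hSx]; ring
  have h1 := H.omega_step_inv hNx hN
  have h2 : 2 * r * (u * f - S) - f = f - 2 * r * S := by linear_combination (2 * f) * H.mul_inv
  rw [h2] at h1
  have h3 := H.bOp'.omega_symm (2 * r) (f - 2 * r * S)
  rw [h1, ← H.eigen_inv, ← H.eigen_step hf hSx hS] at h3
  have h4 : e (2 * r * (f - 2 * r * S))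
      = 2 * r * e (f - 2 * r * S) + (f - 2 * r * S) * e (2 * r) := deriv_mul _ _ _
  have h5 : 2 * r * (f - 2 * r * S) = 2 * r * r * (u * f - S) - 2 * r * r * S := by
    linear_combination (-(2 * r * f)) * H.mul_inv
  rw [h5, map_sub] at h4
  linear_combination h3 - h4

/-- Removing the gauge operator on both sides leaves `omega B f g` and terms with an argument `2r`,
already known. The expression under `e` is the Schur complement `M - N h⁻¹ S`. -/
theorem omega_step_step (H : IsStepFlow e u r h B B') {f g M N S : R} (hg : e g = B.apply g)
    (hM : e M = omega B f g) (hNx : d 0 N = u * d 0 f) (hN : e N = omega B f u)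
    (hSx : d 0 S = d 0 u * g) (hS : e S = omega B u g) :
    omega B' (2 * r * N - f) (g - 2 * r * S) = e (M - 2 * r * r * N * S) := by
  have e1 := stepOp_mul (d := d) u r hSx
  have e2 := del_inv_mul_deriv_step (d := d) H.mul_inv hNx
  have h1 : 𝐈 * 𝐦 (d 0 (2 * r * N - f)) * B' * 𝐦 (g - 2 * r * S) * 𝐈
      = 𝐈 * 𝐦 (d 0 f) * stepInv d u r * B' * stepOp d u r * 𝐦 g * 𝐈
        + 𝐦 N * (𝐈 * 𝐦 (d 0 (2 * r)) * B' * 𝐦 (g - 2 * r * S) * 𝐈)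
        + 𝐦 N * (𝐈 * 𝐦 (d 0 (2 * r)) * B' * 𝐦 (2 * r) * 𝐈) * 𝐦 S
        - 𝐈 * 𝐦 (d 0 (2 * r * N - f)) * B' * 𝐦 (2 * r) * 𝐈 * 𝐦 S := by
    calc _ = 𝐈 * 𝐦 (d 0 (2 * r * N - f)) * B' * (𝐦 (g - 2 * r * S) * 𝐈 + 𝐦 (2 * r) * 𝐈 * 𝐦 S)
          - 𝐈 * 𝐦 (d 0 (2 * r * N - f)) * B' * 𝐦 (2 * r) * 𝐈 * 𝐦 S := by noncomm_ring
      _ = 𝐈 * 𝐦 (d 0 f) * stepInv d u r * B' * (stepOp d u r * 𝐦 g * 𝐈)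
          + 𝐦 N * 𝐈 * 𝐦 (d 0 (2 * r)) * B' * (stepOp d u r * 𝐦 g * 𝐈)
          - 𝐈 * 𝐦 (d 0 (2 * r * N - f)) * B' * 𝐦 (2 * r) * 𝐈 * 𝐦 S := by
        rw [← e1]
        congr 1
        rw [e2]; noncomm_ring
      _ = 𝐈 * 𝐦 (d 0 f) * stepInv d u r * B' * (stepOp d u r * 𝐦 g * 𝐈)
          + 𝐦 N * 𝐈 * 𝐦 (d 0 (2 * r)) * B'
            * (𝐦 (g - 2 * r * S) * 𝐈 + 𝐦 (2 * r) * 𝐈 * 𝐦 S)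
          - 𝐈 * 𝐦 (d 0 (2 * r * N - f)) * B' * 𝐦 (2 * r) * 𝐈 * 𝐦 S := by
        rw [← e1]
      _ = _ := by noncomm_ring
  have h2 := H.bOp'.omega_self (2 * r)
  have h3 := H.omega_inv_step hg hSx hS
  have h4 := H.omega_step_inv hNx hN
  rw [omega] at h2 h3 h4
  rw [omega, h1, coeff_sub, coeff_add, coeff_add, res_mul_mulOp, res_mul_mulOp, res_mulOp_mul,
    res_mulOp_mul, H.res_step, h2, h3, h4, ← H.eigen_inv, ← hM, map_sub, deriv_mul e _ S,
    deriv_mul e _ S, deriv_mul e _ N, deriv_mul e _ r, deriv_two_mul]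
  ring

end IsStepFlow

end GaugeFlow

end PDO

end CMBKP

end

/-! ### Chains of eigenfunctions and integrals. -/

noncomputable section

namespace CMBKP

namespace PDO

section Level

variable {R : Type*} [CommRing R] [Algebra ℂ R] {d : ℕ → Derivation ℂ R R}

variable (d) in
/-- A solution `(u, v)` of the constrained hierarchy together with the eigenfunctions
`f j = L^j u` and the integrals `M i j = ∫ (f i)_x (f j)` and `a j = ∫ v_x (f j)`. -/
structure IsChain (u v : R) (f : ℕ → R) (M : ℕ → ℕ → R) (a : ℕ → R) : Prop where
  sol : IsConstrainedSolution d u v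
  f_zero : f 0 = u
  f_flow : ∀ k j, d k (f j) = (flowOp d (laxOp d u v) k).apply (f j)
  M_flow : ∀ k i j, d k (M i j) = omega (flowOp d (laxOp d u v) k) (f i) (f j)
  a_flow : ∀ k j, d k (a j) = omega (flowOp d (laxOp d u v) k) v (f j)
  M_symm : ∀ i j, M i j + M j i = f i * f j
  f_succ : ∀ j, f (j + 1) = d 0 (f j) + u * a j - v * M 0 j
  M_succ : ∀ i j, M (i + 1) j + M i (j + 1)
    = d 0 (f i) * f j + f i * (f (j + 1) - d 0 (f j)) + a i * M 0 j - a j * M 0 i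

/-- The eigenfunctions after an elementary gauge transformation. -/
def stepF (r : R) (f : ℕ → R) (M : ℕ → ℕ → R) (j : ℕ) : R := f (j + 1) - 2 * r * M 0 (j + 1)

/-- The integrals after an elementary gauge transformation. -/
def stepM (r : R) (M : ℕ → ℕ → R) (i j : ℕ) : R :=
  M (i + 1) (j + 1) - 2 * r * r * M (i + 1) 0 * M 0 (j + 1)

namespace IsChain

variable {u v : R} {f : ℕ → R} {M : ℕ → ℕ → R} {a : ℕ → R}

theorem deriv_M (H : IsChain d u v f M a) (i j : ℕ) : d 0 (M i j) = d 0 (f i) * f j := by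
  rw [H.M_flow, flowOp_zero, omega_del]

theorem deriv_a (H : IsChain d u v f M a) (j : ℕ) : d 0 (a j) = d 0 v * f j := by
  rw [H.a_flow, flowOp_zero, omega_del]

theorem two_mul_M (H : IsChain d u v f M a) : 2 * M 0 0 = u * u := by
  rw [two_mul, H.M_symm, H.f_zero]

theorem conj (H : IsChain d u v f M a) {r : R} (hr : u * r = 1) :
    laxOp d (stepF r f M 0) (-(2 * r)) * stepOp d u r = stepOp d u r * laxOp d u v := by
  refine stepOp_conj (h := M 0 0) (a := a 0) (b := M 0 1) (f₁ := f 1) hr H.two_mul_M ?_ ?_ ?_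
  · rw [H.deriv_a, H.f_zero]
  · rw [H.f_succ 0, H.f_zero]
  · rw [H.deriv_M, H.f_zero]

theorem isStepFlow (hd : ∀ i j a, d i (d j a) = d j (d i a)) (H : IsChain d u v f M a) {r : R}
    (hr : u * r = 1) (k : ℕ) :
    IsStepFlow (d k) u r (M 0 0) (flowOp d (laxOp d u v) k)
      (flowOp d (laxOp d (stepF r f M 0) (-(2 * r))) k) :=
  PDO.isStepFlow hd hr H.two_mul_M (laxOp_bType _ _) (laxOp_bType _ _) (H.conj hr) k (H.sol k).1

/-- Because `T` annihilates `f 0 = u`, the new chain consists of the images of `f 1, f 2, …`. All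
new integrals are expressions in the old ones, so no antiderivative has to be chosen; the algebraic
relations are polynomial consequences of the old ones and of `u r = 1`. -/
theorem step (hd : ∀ i j a, d i (d j a) = d j (d i a)) (H : IsChain d u v f M a) {r : R}
    (hr : u * r = 1) :
    IsChain d (stepF r f M 0) (-(2 * r)) (stepF r f M) (stepM r M)
      (fun j => 2 * r * r * M 0 (j + 1)) := by
  have hk : 2 * r * r * M 0 0 = 1 := by
    linear_combination r * r * H.two_mul_M + (u * r + 1) * hr
  have hk' : 2 * r * M 0 0 = u := by linear_combination r * H.two_mul_M + u * hr
  have hS : ∀ j, d 0 (M 0 j) = d 0 u * f j := fun j => by rw [H.deriv_M, H.f_zero]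
  have hSk : ∀ k j, d k (M 0 j) = omega (flowOp d (laxOp d u v) k) u (f j) := fun k j => by
    rw [H.M_flow, H.f_zero]
  have hN : ∀ i, d 0 (M i 0) = u * d 0 (f i) := fun i => by rw [H.deriv_M, H.f_zero, mul_comm]
  have hNk : ∀ k i, d k (M i 0) = omega (flowOp d (laxOp d u v) k) (f i) u := fun k i => by
    rw [H.M_flow, H.f_zero]
  have hf : ∀ k j, d k (stepF r f M j)
      = (flowOp d (laxOp d (stepF r f M 0) (-(2 * r))) k).apply (stepF r f M j) := fun k j =>
    (H.isStepFlow hd hr k).eigen_step (H.f_flow k _) (hS _) (hSk k _)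
  have hs : ∀ i, M 0 i + M i 0 = u * f i := fun i => by rw [H.M_symm, H.f_zero]
  -- Integration by parts gives the form of the new eigenfunction that `omega_step_step` needs for
  -- its first argument.
  have hF : ∀ i, stepF r f M i = 2 * r * M (i + 1) 0 - f (i + 1) := fun i => by
    rw [stepF]
    linear_combination (-2 * f (i + 1)) * hr - 2 * r * hs (i + 1)
  have hdF : ∀ i, d 0 (stepF r f M i)
      = d 0 (f (i + 1)) - 2 * (-(r * r * d 0 u) * M 0 (i + 1) + r * (d 0 u * f (i + 1))) :=
    fun i => by
      rw [stepF, map_sub, deriv_mul, deriv_two_mul, hS, deriv_inv _ hr]; ring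
  refine ⟨fun k => ⟨hf k 0, ?_⟩, rfl, hf, ?_, ?_, ?_, ?_, ?_⟩
  · rw [map_neg, apply_neg, (H.isStepFlow hd hr k).eigen_inv]
  · intro k i j
    have := (H.isStepFlow hd hr k).omega_step_step (H.f_flow k (j + 1)) (H.M_flow k (i + 1) (j + 1))
      (hN (i + 1)) (hNk k (i + 1)) (hS (j + 1)) (hSk k (j + 1))
    rw [← hF i] at this
    exact this.symm
  · intro k j
    have := (H.isStepFlow hd hr k).omega_inv_step (H.f_flow k (j + 1)) (hS (j + 1)) (hSk k (j + 1))
    rw [omega_neg_left]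
    exact (neg_eq_iff_eq_neg.2 this).symm
  · intro i j
    simp only [stepM, stepF]
    linear_combination H.M_symm (i + 1) (j + 1) - 2 * r * r * M 0 (j + 1) * hs (i + 1)
      - 2 * r * r * M 0 (i + 1) * hs (j + 1)
      - 2 * r * (f (i + 1) * M 0 (j + 1) + f (j + 1) * M 0 (i + 1)) * hr
  · intro j
    rw [hdF]
    simp only [stepM, stepF]
    have e3 := H.M_succ 0 (j + 1)
    have e1 := H.f_succ 0
    rw [H.f_zero, zero_add] at e3
    rw [H.f_zero, zero_add] at e1
    have e4 := hs 1
    simp only [zero_add]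
    linear_combination (-1 : R) * H.f_succ (j + 1) - 2 * r * e3 + 4 * r * r * r * M 0 (j + 1) * e4
      + 2 * r * r * M 0 (j + 1) * e1 + (4 * r * r * M 0 (j + 1) * f 1 + 2 * r * a 0 * M 0 (j + 1)
        - 2 * (f (j + 1 + 1) - d 0 (f (j + 1)))) * hr - v * M 0 (j + 1) * hk + a (j + 1) * hk'
  · intro i j
    rw [hdF, hdF]
    simp only [stepM, stepF]
    have e3 := H.M_succ 0 (i + 1)
    have e3' := H.M_succ 0 (j + 1)
    rw [H.f_zero, zero_add] at e3 e3'
    simp only [zero_add]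
    linear_combination H.M_succ (i + 1) (j + 1) - 2 * r * r * M 0 (j + 1 + 1) * hs (i + 1)
      - 2 * r * r * M 0 (i + 1) * e3' - 2 * r * r * M 0 (j + 1) * hs (i + 1 + 1)
      + 2 * r * r * M 0 (j + 1) * e3
      + (-2 * r * f (i + 1) * M 0 (j + 1 + 1)
        - 2 * r * M 0 (i + 1) * (f (j + 1 + 1) - d 0 (f (j + 1)))
        - 2 * r * M 0 (j + 1) * d 0 (f (i + 1))) * hr
      + (a (j + 1) * M 0 (i + 1) - a (i + 1) * M 0 (j + 1)) * hk

end IsChain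

end Level

end PDO

end CMBKP

end

/-! ### Composition of gauge transformations and Schur complements. -/

noncomputable section

namespace CMBKP

namespace PDO

section Iterate

variable {R : Type*} [CommRing R] [Algebra ℂ R] {d : ℕ → Derivation ℂ R R}

local notation "𝐃" => PDO.del (d 0) 1
local notation "𝐈" => PDO.del (d 0) (-1)
local notation "𝐦" => PDO.mulOp (d 0)

/-! ### Composition of gauge transformations -/

theorem monic_iff {δ : Derivation ℂ R R} {W : PDO δ} :
    (W - 1).OrdLE (-1) ↔ (∀ m, 0 < m → W.coeff m = 0) ∧ W.coeff 0 = 1 := by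
  constructor
  · refine fun h => ⟨fun m hm => ?_, ?_⟩
    · have := h m (by omega)
      rwa [coeff_sub, coeff_one, if_neg (by omega), sub_zero] at this
    · have := h 0 (by omega)
      rwa [coeff_sub, coeff_one, if_pos rfl, sub_eq_zero] at this
  · rintro ⟨h1, h2⟩ m hm
    rw [coeff_sub, coeff_one]
    split_ifs with h
    · rw [h, h2, sub_self]
    · rw [h1 m (by omega), sub_zero]

theorem monic_mul {δ : Derivation ℂ R R} {P Q : PDO δ} (hP : (P - 1).OrdLE (-1))
    (hQ : (Q - 1).OrdLE (-1)) : (P * Q - 1).OrdLE (-1) := by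
  have : P * Q - 1 = (P - 1) * (Q - 1) + (P - 1) + (Q - 1) := by noncomm_ring
  rw [this]
  exact (((hP.mul hQ).mono (by norm_num)).add hP).add hQ

theorem isGaugeTransformation_one (L : PDO (d 0)) : IsGaugeTransformation d L L 1 where
  coeff_of_pos m hm := by rw [coeff_one, if_neg (by omega)]
  coeff_zero := by rw [coeff_one, if_pos rfl]
  conj := by rw [mul_one, one_mul]
  bType := by rw [adjoint_one, one_mul, mul_one]
  flow k := by rw [diff_one, mul_one, one_mul, sub_self]

theorem conj_pow {L L' W : PDO (d 0)} (h : L' * W = W * L) (n : ℕ) : L' ^ n * W = W * L ^ n :=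
  ((show SemiconjBy W L L' from h.symm).pow_right n).eq.symm

theorem _root_.CMBKP.IsGaugeTransformation.comp (hd : ∀ i j a, d i (d j a) = d j (d i a))
    {L L' L'' W T : PDO (d 0)} (hW : IsGaugeTransformation d L L' W)
    (hT : IsGaugeTransformation d L' L'' T) : IsGaugeTransformation d L L'' (T * W) := by
  have h := monic_iff.1 (monic_mul (monic_iff.2 ⟨hT.coeff_of_pos, hT.coeff_zero⟩)
    (monic_iff.2 ⟨hW.coeff_of_pos, hW.coeff_zero⟩))
  refine ⟨h.1, h.2, ?_, ?_, fun k => ?_⟩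
  · rw [← mul_assoc, hT.conj, mul_assoc, hW.conj, mul_assoc]
  · calc (T * W).adjoint * 𝐃 * (T * W) = W.adjoint * (T.adjoint * 𝐃 * T) * W := by
          rw [adjoint_mul]; simp only [mul_assoc]
      _ = 𝐃 := by rw [hT.bType, hW.bType]
  · rw [diff_mul (hd k 0), hT.flow, hW.flow]
    noncomm_ring

theorem _root_.CMBKP.IsGaugeTransformation.isDressing (hd : ∀ i j a, d i (d j a) = d j (d i a))
    {L L' W Φ : PDO (d 0)} (hW : IsGaugeTransformation d L L' W) (hΦ : IsDressing d L Φ) :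
    IsDressing d L' (W * Φ) := by
  have h := monic_iff.1 (monic_mul (monic_iff.2 ⟨hW.coeff_of_pos, hW.coeff_zero⟩)
    (monic_iff.2 ⟨hΦ.coeff_of_pos, hΦ.coeff_zero⟩))
  refine ⟨h.1, h.2, ?_, ?_, fun k => ?_⟩
  · rw [← mul_assoc, hW.conj, mul_assoc, hΦ.conj, mul_assoc]
  · calc (W * Φ).adjoint * 𝐃 * (W * Φ) = Φ.adjoint * (W.adjoint * 𝐃 * W) * Φ := by
          rw [adjoint_mul]; simp only [mul_assoc]
      _ = 𝐃 := by rw [hW.bType, hΦ.bType]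
  · rw [diff_mul (hd k 0), hW.flow, hΦ.flow, flowOp_eq_sub, flowOp_eq_sub, pow_eq, pow_eq,
      sub_mul _ _ W, conj_pow hW.conj]
    noncomm_ring

omit [Algebra ℂ R] in
theorem inverse_eq_of_mul_eq_one {u r : R} (h : u * r = 1) : Ring.inverse u = r := by
  have hu : IsUnit u := .of_mul_eq_one _ h
  rw [← mul_one (Ring.inverse u), ← h, Ring.inverse_mul_cancel_left _ _ hu]

/-- The elementary gauge operator `T_I(ψ) T_D(u)` with `ψ = -u / 2`. -/
theorem TI_mul_TD {u r : R} (hr : u * r = 1) :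
    TI d (-((1 / 2 : ℂ) • u)) * TD d u = stepOp d u r := by
  have h1 : Ring.inverse u = r := inverse_eq_of_mul_eq_one hr
  have h2 : Ring.inverse (-((1 / 2 : ℂ) • u)) = -((2 : ℂ) • r) := by
    refine inverse_eq_of_mul_eq_one ?_
    rw [neg_mul_neg, smul_mul_smul_comm, hr]
    norm_num
  have h3 : 𝐈 * 𝐦 (u * u) * 𝐃 = 𝐦 (u * u) - 𝐈 * 𝐦 (2 * (u * d 0 u)) := by
    have : d 0 (u * u) = 2 * (u * d 0 u) := by rw [deriv_mul]; ring
    rw [← this, mulOp_deriv, mul_sub, del_inv_mul_del_mul, mul_assoc]; abel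
  -- The constant `-1/2` in `ψ` cancels against its inverse.
  have h4 : 𝐦 (-((2 : ℂ) • r)) * 𝐈 * 𝐦 (-((1 / 2 : ℂ) • u)) = 𝐦 r * 𝐈 * 𝐦 u := by
    have e1 : 𝐦 (-((2 : ℂ) • r)) = -(𝐦 2 * 𝐦 r) := by
      rw [mulOp_neg, ← mulOp_mul, two_smul, two_mul]
    have e2 : 𝐦 (-((1 / 2 : ℂ) • u)) = -(𝐦 u * 𝐦 (algebraMap ℂ R (1 / 2))) := by
      rw [mulOp_neg, ← mulOp_mul, Algebra.smul_def, mul_comm]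
    have e3 : 𝐦 2 * (𝐦 r * 𝐈 * 𝐦 u) = 𝐦 r * 𝐈 * 𝐦 u * 𝐦 2 := by
      rw [mulOp_two, two_mul, mul_two]
    have e4 : 𝐦 2 * 𝐦 (algebraMap ℂ R (1 / 2)) = 1 := by
      rw [← mulOp_mul, ← map_ofNat (algebraMap ℂ R) 2, ← map_mul]; norm_num
    calc _ = 𝐦 2 * (𝐦 r * 𝐈 * 𝐦 u) * 𝐦 (algebraMap ℂ R (1 / 2)) := by
          rw [e1, e2]; noncomm_ring
      _ = _ := by rw [e3, mul_assoc, e4, mul_one]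
  rw [TI, TD, h1, h2, h4, stepOp]
  calc 𝐦 r * 𝐈 * 𝐦 u * (𝐦 u * 𝐃 * 𝐦 r) = 𝐦 r * (𝐈 * 𝐦 (u * u) * 𝐃) * 𝐦 r := by
        rw [mulOp_mul]; simp only [mul_assoc]
    _ = 𝐦 (r * (u * u) * r) - 𝐦 r * 𝐈 * 𝐦 (2 * (u * d 0 u) * r) := by
        rw [h3, mulOp_mul _ r, mulOp_mul r, mulOp_mul _ r]; noncomm_ring
    _ = 1 - 𝐦 r * 𝐈 * 𝐦 (2 * d 0 u) := by
        rw [show r * (u * u) * r = 1 by linear_combination (u * r + 1) * hr, mulOp_one,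
          show 2 * (u * d 0 u) * r = 2 * d 0 u by linear_combination (2 * d 0 u) * hr]
    _ = _ := by
        rw [mulOp_two_mul, mulOp_two_mul]; noncomm_ring

theorem IsChain.isGaugeTransformation (hd : ∀ i j a, d i (d j a) = d j (d i a)) {u v : R}
    {f : ℕ → R} {M : ℕ → ℕ → R} {a : ℕ → R} (H : IsChain d u v f M a) {r : R} (hr : u * r = 1) :
    IsGaugeTransformation d (laxOp d u v) (laxOp d (stepF r f M 0) (-(2 * r))) (stepOp d u r) := by
  have h := monic_iff.1 (stepOp_sub_one_ordLE (d := d) u r)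
  exact ⟨h.1, h.2, H.conj hr, stepOp_bType hr, fun k => (H.isStepFlow hd hr k).flow⟩

/-! ### Determinants -/

/-- The determinant with rows `M (k - 1), …, M 0` and then copies of `f`. -/
def bordered (k n : ℕ) (M : ℕ → ℕ → R) (f : ℕ → R) : R :=
  Matrix.det (Matrix.of fun r c : Fin n => if (r : ℕ) < k then M (k - 1 - r) c else f c)

omit [Algebra ℂ R] in
-- Schur complement with pivot `M 0 0`. Its row is the last of the moment rows, at position `k`;
-- once it has cleared the first column, expansion along that column gives the sign `(-1)^k`.
theorem bordered_succ {k n : ℕ} (hk : k ≤ n) (M : ℕ → ℕ → R) (f : ℕ → R) {q : R}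
    (hq : q * M 0 0 = 1) :
    bordered (k + 1) (n + 1) M f = (-1) ^ k * M 0 0 *
      bordered k n (fun i j => M (i + 1) (j + 1) - q * M (i + 1) 0 * M 0 (j + 1))
        (fun j => f (j + 1) - q * f 0 * M 0 (j + 1)) := by
  set A : Matrix (Fin (n + 1)) (Fin (n + 1)) R :=
    Matrix.of fun r c => if (r : ℕ) < k + 1 then M (k + 1 - 1 - r) c else f c with hA
  let p : Fin (n + 1) := ⟨k, by omega⟩
  have hAp : ∀ c, A p c = M 0 c := fun c => by simp [hA, p]
  let c : Fin (n + 1) → R := fun i => if i = p then 0 else q * A i 0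
  let B : Matrix (Fin (n + 1)) (Fin (n + 1)) R := Matrix.of fun i j => A i j - c i * A p j
  have hdet : A.det = B.det := by
    refine Matrix.det_eq_of_forall_row_eq_smul_add_const c p (if_pos rfl) fun i j => ?_
    simp [B, c]
  have hB0 : ∀ i, i ≠ p → B i 0 = 0 := fun i hi => by
    simp only [B, c, Matrix.of_apply, if_neg hi, hAp]
    simp only [Fin.val_zero]
    linear_combination (-A i 0) * hq
  change A.det = _
  rw [hdet, Matrix.det_succ_column_zero, Finset.sum_eq_single p]
  · have hBp : B p 0 = M 0 0 := by simp [B, c, hAp]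
    rw [hBp]
    congr 1
    rw [bordered]
    congr 1
    ext i j
    simp only [Matrix.submatrix_apply, Matrix.of_apply, B, c, if_neg (Fin.succAbove_ne p i), hAp]
    by_cases hi : (i : ℕ) < k
    · have h1 : p.succAbove i = i.castSucc := Fin.succAbove_of_castSucc_lt _ _ hi
      rw [h1, if_pos hi]
      simp only [hA, Matrix.of_apply, Fin.val_castSucc, Fin.val_succ, Fin.val_zero]
      rw [if_pos (by omega), show k + 1 - 1 - (i : ℕ) = k - 1 - i + 1 by omega, if_pos (by omega)]
    · have h1 : p.succAbove i = i.succ :=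
        Fin.succAbove_of_le_castSucc _ _ (Nat.le_of_not_lt hi)
      rw [h1, if_neg hi]
      simp only [hA, Matrix.of_apply, Fin.val_succ, Fin.val_zero]
      rw [if_neg (by omega), if_neg (by omega)]
  · intro i _ hi
    rw [hB0 i hi, mul_zero, zero_mul]
  · intro h
    exact absurd (Finset.mem_univ p) h

/-! ### Iterated gauge transformations -/

/-- The eigenfunctions and integrals after `n` elementary gauge transformations. -/
def level (f : ℕ → R) (M : ℕ → ℕ → R) : ℕ → (ℕ → R) × (ℕ → ℕ → R)
  | 0 => (f, M)
  | n + 1 =>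
    (stepF (Ring.inverse ((level f M n).1 0)) (level f M n).1 (level f M n).2,
      stepM (Ring.inverse ((level f M n).1 0)) (level f M n).2)

/-- The second potential after `n` elementary gauge transformations. -/
def levelV (v : R) (f : ℕ → R) (M : ℕ → ℕ → R) : ℕ → R
  | 0 => v
  | n + 1 => -(2 * Ring.inverse ((level f M n).1 0))

/-- Each step removes one pivot from the determinant. The value `ε = 0` covers pure moment
determinants, `ε = 1` those with one row of eigenfunctions. -/
theorem level_spec (hd : ∀ i j a, d i (d j a) = d j (d i a)) {u v : R} {f : ℕ → R}
    {M : ℕ → ℕ → R} {a : ℕ → R} (H : IsChain d u v f M a) (n : ℕ)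
    (hn : ∀ k, k ≤ n → IsUnit (bordered k k M f)) :
    (∃ b, IsChain d ((level f M n).1 0) (levelV v f M n) (level f M n).1 (level f M n).2 b) ∧
      (∀ m ε, ε ≤ 1 → bordered (n + m) (n + m + ε) M f
        = (-1) ^ (n * m) * bordered n n M f *
          bordered m (m + ε) (level f M n).2 (level f M n).1) ∧
      (n ≠ 0 → IsUnit ((level f M (n - 1)).1 0)) := by
  induction n with
  | zero =>
    refine ⟨⟨a, ?_⟩, fun m ε _ => ?_, fun h => absurd rfl h⟩
    · change IsChain d (f 0) v f M a
      rwa [H.f_zero]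
    · rw [zero_mul, pow_zero, one_mul, show bordered 0 0 M f = 1 from Matrix.det_fin_zero, one_mul,
        Nat.zero_add]
      rfl
  | succ n ih =>
    obtain ⟨⟨b, hb⟩, hdet, -⟩ := ih fun k hk => hn k (by omega)
    set F := (level f M n).1 with hF
    set N := (level f M n).2 with hN
    have h1 : bordered (n + 1) (n + 1) M f = (-1) ^ n * bordered n n M f * N 0 0 := by
      have := hdet 1 0 (by omega)
      rw [add_zero, mul_one, add_zero] at this
      rw [this]
      simp [bordered]
    have hun : IsUnit (N 0 0) := by
      have := hn (n + 1) le_rfl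
      rw [h1] at this
      exact isUnit_of_mul_isUnit_right this
    -- The pivot `N 0 0` divides the invertible determinant of size `n + 1`, and `2 N 0 0` is the
    -- square of the current potential.
    have huF : IsUnit (F 0) := by
      have h2 : IsUnit (2 : R) := by
        have := (IsUnit.mk0 (2 : ℂ) two_ne_zero).map (algebraMap ℂ R)
        rwa [map_ofNat] at this
      have := h2.mul hun
      rw [hb.two_mul_M] at this
      exact isUnit_of_mul_isUnit_left this
    set r := Ring.inverse (F 0) with hr
    have hru : F 0 * r = 1 := Ring.mul_inverse_cancel _ huF
    refine ⟨⟨_, hb.step hd hru⟩, fun m ε hε => ?_, fun _ => huF⟩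
    have hq : 2 * r * r * N 0 0 = 1 := by
      linear_combination r * r * hb.two_mul_M + (F 0 * r + 1) * hru
    have h2 := hdet (m + 1) ε hε
    have h3 := bordered_succ (k := m) (n := m + ε) (by omega) N F hq
    rw [show n + 1 + m = n + (m + 1) by ring, h2, show m + 1 + ε = m + ε + 1 by ring, h3, h1]
    have h4 : (fun j => F (j + 1) - 2 * r * r * F 0 * N 0 (j + 1)) = (level f M (n + 1)).1 := by
      funext j
      change _ = F (j + 1) - 2 * r * N 0 (j + 1)
      linear_combination (-2 * r * N 0 (j + 1)) * hru
    rw [h4]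
    change _ = _ * bordered m (m + ε) (fun i j => N (i + 1) (j + 1)
      - 2 * r * r * N (i + 1) 0 * N 0 (j + 1)) _
    ring

end Iterate

end PDO

end CMBKP

end

/-! ### The initial chain from an integration class. -/

noncomputable section

namespace CMBKP

namespace PDO

section Lax

variable {R : Type*} [CommRing R] [Algebra ℂ R] {d : ℕ → Derivation ℂ R R}

local notation "𝐃" => PDO.del (d 0) 1
local notation "𝐈" => PDO.del (d 0) (-1)
local notation "𝐦" => PDO.mulOp (d 0)

/-- The value `f_x + u ∫ v_x f - v ∫ u_x f` of the Lax operator at an eigenfunction `f` is an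
eigenfunction. -/
theorem eigen_laxOp {e : Derivation ℂ R R} (he : ∀ a, e (d 0 a) = d 0 (e a)) {u v f a b : R}
    {B : PDO (d 0)} (hB : B.IsDiff) (hu : e u = B.apply u) (hv : e v = B.apply v)
    (hL : (laxOp d u v).diff e = B * laxOp d u v - laxOp d u v * B) (hf : e f = B.apply f)
    (hax : d 0 a = d 0 v * f) (ha : e a = omega B v f)
    (hbx : d 0 b = d 0 u * f) (hb : e b = omega B u f) :
    e (d 0 f + u * a - v * b) = B.apply (d 0 f + u * a - v * b) := by
  obtain ⟨C, hC, hCe⟩ := hB.mul_mulOp_del_inv f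
  set g := d 0 f + u * a - v * b with hg
  have h0 : laxOp d u v * 𝐦 f * 𝐈 = 𝐦 f + 𝐦 g * 𝐈 - 𝐦 u * 𝐈 * 𝐦 a + 𝐦 v * 𝐈 * 𝐦 b := by
    have e1 := del_inv_mul_del_inv_of_deriv hax
    have e2 := del_inv_mul_del_inv_of_deriv hbx
    have e3 : laxOp d u v * 𝐦 f * 𝐈 = 𝐃 * 𝐦 f * 𝐈 + 𝐦 u * (𝐈 * 𝐦 (d 0 v * f) * 𝐈)
        - 𝐦 v * (𝐈 * 𝐦 (d 0 u * f) * 𝐈) := by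
      rw [laxOp, mulOp_mul, mulOp_mul]; noncomm_ring
    rw [e3, e1, e2, del_mul_mulOp, add_mul, mul_del_mul_del_inv, hg]
    simp only [mulOp_add, mulOp_sub, mulOp_mul]
    noncomm_ring
  -- As for the gauge operator: differentiate the expansion of `L f ∂⁻¹` along the flow and compare
  -- residues.
  have h1 := congrArg (PDO.diff e) h0
  simp only [diff_mul he, diff_add, diff_sub, diff_mulOp, diff_del, mul_zero, add_zero, hL] at h1
  have h2 : ((B * laxOp d u v - laxOp d u v * B) * 𝐦 f + laxOp d u v * 𝐦 (e f)) * 𝐈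
      = B * (laxOp d u v * 𝐦 f * 𝐈) - laxOp d u v * (B * 𝐦 f * 𝐈)
        + laxOp d u v * (𝐦 (e f) * 𝐈) := by noncomm_ring
  have h3 : (laxOp d u v * C).coeff (-1) = u * omega B v f - v * omega B u f := by
    have : laxOp d u v * C = 𝐃 * C + 𝐦 u * (𝐈 * 𝐦 (d 0 v) * C) - 𝐦 v * (𝐈 * 𝐦 (d 0 u) * C) := by
      rw [laxOp]; noncomm_ring
    have hD : (𝐃 * C).coeff (-1) = 0 := ((isDiff_del 1).mul hC).res
    rw [this, coeff_sub, coeff_add, hD, res_mulOp_mul, res_mulOp_mul,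
      ← omega_eq_res hCe, ← omega_eq_res hCe, zero_add]
  have h4 : B * (𝐦 f + 𝐦 g * 𝐈 - 𝐦 u * 𝐈 * 𝐦 a + 𝐦 v * 𝐈 * 𝐦 b)
        - laxOp d u v * (C + 𝐦 (B.apply f) * 𝐈) + laxOp d u v * (𝐦 (e f) * 𝐈)
      = B * 𝐦 f + B * 𝐦 g * 𝐈 - B * 𝐦 u * 𝐈 * 𝐦 a + B * 𝐦 v * 𝐈 * 𝐦 b - laxOp d u v * C := by
    rw [hf]; noncomm_ring
  rw [h2, hCe, h0, h4] at h1
  have h5 := congrArg (fun P => PDO.coeff P (-1)) h1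
  simp only [coeff_add, coeff_sub, h3, res_mul_mulOp_mul_del_inv, res_mul_mulOp,
    coeff_mulOp_mul_del, if_true, (hB.mul (isDiff_mulOp f)).res, (isDiff_mulOp (e f)).res,
    ← hu, ← hv, ha, hb] at h5
  linear_combination -h5

end Lax

section CoeffIn

variable {R : Type*} [CommRing R] [Algebra ℂ R] {δ : Derivation ℂ R R}

/-- All coefficients of `P` lie in `S`. -/
def CoeffIn (S : Set R) (P : PDO δ) : Prop := ∀ m, P.coeff m ∈ S

theorem CoeffIn.mul {S T : Set R} {K : Submodule ℂ R} {P Q : PDO δ} (hP : CoeffIn S P)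
    (hQ : CoeffIn T Q) (hT : ∀ f ∈ T, δ f ∈ T) (hK : ∀ f ∈ S, ∀ g ∈ T, f * g ∈ K) :
    CoeffIn (K : Set R) (P * Q) := fun m => by
  rw [coeff_mul]
  refine finsum_induction (· ∈ K) K.zero_mem (fun _ _ => K.add_mem) fun x => ?_
  have hit : ∀ k : ℕ, ∀ f ∈ T, δ^[k] f ∈ T := fun k => by
    induction k with
    | zero => exact fun f hf => hf
    | succ k ih => exact fun f hf => ih _ (hT f hf)
  exact zsmul_mem (hK _ (hP _) _ (hit _ _ (hQ _))) _

theorem coeffIn_single {K : Submodule ℂ R} (i : ℤ) {f : R} (hf : f ∈ K) :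
    CoeffIn (K : Set R) (single δ i f) := fun m => by
  rw [coeff_single]
  split_ifs
  · exact hf
  · exact K.zero_mem

theorem CoeffIn.pos {K : Submodule ℂ R} {P : PDO δ} (hP : CoeffIn (K : Set R) P) :
    CoeffIn (K : Set R) P.pos := fun m => by
  rw [coeff_pos]
  split_ifs
  · exact hP m
  · exact K.zero_mem

end CoeffIn

end PDO

namespace IntegrationClass

open PDO

variable {R : Type*} [CommRing R] [Algebra ℂ R] {d : ℕ → Derivation ℂ R R}
variable (J : IntegrationClass d)

theorem integral_mem {f : R} (hf : f ∈ J.dec) : J.integral f ∈ J.dec :=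
  Function.invFunOn_mem (J.bijOn.surjOn hf)

theorem deriv_integral {f : R} (hf : f ∈ J.dec) : d 0 (J.integral f) = f :=
  Function.invFunOn_eq (J.bijOn.surjOn hf)

theorem eq_of_deriv_eq {f g : R} (hf : f ∈ J.dec) (hg : g ∈ J.dec) (h : d 0 f = d 0 g) : f = g :=
  J.bijOn.injOn hf hg h

theorem mul_mem' {f b : R} (hf : f ∈ J.dec) (hb : b ∈ J.reg) : f * b ∈ J.dec := by
  rw [mul_comm]; exact J.mul_mem b hb f hf

theorem coeffIn_reg_mul {P Q : PDO (d 0)} (hP : CoeffIn (J.reg.toSubmodule : Set R) P)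
    (hQ : CoeffIn (J.reg.toSubmodule : Set R) Q) :
    CoeffIn (J.reg.toSubmodule : Set R) (P * Q) :=
  hP.mul hQ (J.d_reg 0) fun _ hf _ hg => J.reg.mul_mem hf hg

theorem coeffIn_laxOp {u v : R} (hu : u ∈ J.reg) (hv : v ∈ J.reg) :
    CoeffIn (J.reg.toSubmodule : Set R) (laxOp d u v) := by
  have h1 : ∀ i, CoeffIn (J.reg.toSubmodule : Set R) (del (d 0) i) := fun i =>
    coeffIn_single i J.reg.one_mem
  have h2 : ∀ f ∈ J.reg, CoeffIn (J.reg.toSubmodule : Set R) (mulOp (d 0) f) := fun f hf =>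
    coeffIn_single 0 hf
  have h3 : ∀ f ∈ J.reg, ∀ g ∈ J.reg, CoeffIn (J.reg.toSubmodule : Set R)
      (mulOp (d 0) f * del (d 0) (-1) * mulOp (d 0) (d 0 g)) := fun f hf g hg =>
    J.coeffIn_reg_mul (J.coeffIn_reg_mul (h2 f hf) (h1 _)) (h2 _ (J.d_reg 0 g hg))
  intro m
  rw [laxOp, PDO.coeff_sub, PDO.coeff_add]
  exact sub_mem (add_mem (h1 1 m) (h3 u hu v hv m)) (h3 v hv u hu m)

theorem coeffIn_flowOp {u v : R} (hu : u ∈ J.reg) (hv : v ∈ J.reg) (k : ℕ) :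
    CoeffIn (J.reg.toSubmodule : Set R) (flowOp d (laxOp d u v) k) := by
  rw [flowOp, pow_eq]
  refine CoeffIn.pos ?_
  generalize 2 * k + 1 = n
  induction n with
  | zero => rw [pow_zero]; exact coeffIn_single 0 J.reg.one_mem
  | succ n ih => rw [pow_succ]; exact J.coeffIn_reg_mul ih (J.coeffIn_laxOp hu hv)

/-- The factor `g` lies in the ideal `dec` and all other coefficients lie in `reg`. Membership in
`dec` is what allows identities for `omega` to be checked after applying `∂`. -/
theorem omega_mem {B : PDO (d 0)} (hB : CoeffIn (J.reg.toSubmodule : Set R) B) {f g : R}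
    (hf : f ∈ J.reg) (hg : g ∈ J.dec) : omega B f g ∈ J.dec := by
  have h1 : ∀ i, CoeffIn (J.reg.toSubmodule : Set R) (del (d 0) i) := fun i =>
    coeffIn_single i J.reg.one_mem
  have h2 : CoeffIn (J.reg.toSubmodule : Set R) (mulOp (d 0) (d 0 f)) :=
    coeffIn_single 0 (J.d_reg 0 f hf)
  have h3 : CoeffIn (J.dec : Set R) (mulOp (d 0) g) := coeffIn_single 0 hg
  have h4 : CoeffIn (J.dec : Set R)
      (del (d 0) (-1) * mulOp (d 0) (d 0 f) * B * mulOp (d 0) g) :=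
    (J.coeffIn_reg_mul (J.coeffIn_reg_mul (h1 (-1)) h2) hB).mul h3 (J.d_dec 0)
      fun b hb f hf => J.mul_mem b hb f hf
  exact (h4.mul (h1 (-1)) (J.d_reg 0) fun f hf b hb => J.mul_mem' hf hb) (-1)

variable {J} {u v : R}

theorem laxAct_mem (hu : u ∈ J.dec) (hv : v ∈ J.reg) {f : R} (hf : f ∈ J.dec) :
    J.laxAct u v f ∈ J.dec :=
  sub_mem (add_mem (J.d_dec 0 f hf)
    (J.mul_mem u (J.dec_le u hu) _ (J.integral_mem (J.mul_mem _ (J.d_reg 0 v hv) _ hf))))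
    (J.mul_mem v hv _ (J.integral_mem (J.mul_mem _ (J.d_reg 0 u (J.dec_le u hu)) _ hf)))

theorem phi_succ (j : ℕ) : J.phi u v (j + 1) = J.laxAct u v (J.phi u v j) :=
  Function.iterate_succ_apply' _ _ _

theorem phi_mem (hu : u ∈ J.dec) (hv : v ∈ J.reg) (j : ℕ) : J.phi u v j ∈ J.dec := by
  induction j with
  | zero => exact hu
  | succ j ih => rw [phi_succ]; exact laxAct_mem hu hv ih

/-- Both sides lie in `dec`, where `∂` is injective, and `deriv_omega` identifies their derivatives.
This fixes the integration constants. -/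
theorem diff_integral {e : Derivation ℂ R R} (he : ∀ a, e (d 0 a) = d 0 (e a))
    (hed : ∀ f ∈ J.dec, e f ∈ J.dec) {f g : R} {B : PDO (d 0)} (hB : IsBOp B)
    (hBr : CoeffIn (J.reg.toSubmodule : Set R) B) (hf : f ∈ J.reg) (hg : g ∈ J.dec)
    (hfe : e f = B.apply f) (hge : e g = B.apply g) :
    e (J.integral (d 0 f * g)) = omega B f g := by
  have hm : d 0 f * g ∈ J.dec := J.mul_mem _ (J.d_reg 0 f hf) _ hg
  refine J.eq_of_deriv_eq (hed _ (J.integral_mem hm)) (J.omega_mem hBr hf hg) ?_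
  rw [← he, J.deriv_integral hm, hB.deriv_omega, PDO.deriv_mul, he, hfe, hge]

theorem isChain (hd : ∀ i j a, d i (d j a) = d j (d i a)) (hu : u ∈ J.dec) (hv : v ∈ J.reg)
    (h : IsConstrainedSolution d u v) :
    IsChain d u v (J.phi u v) (fun i j => J.integral (J.psi u v i * J.phi u v j))
      (fun j => J.integral (d 0 v * J.phi u v j)) := by
  have hφ := phi_mem (J := J) hu hv
  have hur := J.dec_le u hu
  have hB := fun k => isBOp_flowOp_laxOp (d := d) u v k
  have hBr := J.coeffIn_flowOp hur hv
  have hm : ∀ i j, J.psi u v i * J.phi u v j ∈ J.dec := fun i j =>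
    J.mul_mem _ (J.d_reg 0 _ (J.dec_le _ (hφ i))) _ (hφ j)
  have hvm : ∀ j, d 0 v * J.phi u v j ∈ J.dec := fun j => J.mul_mem _ (J.d_reg 0 v hv) _ (hφ j)
  have hmx : ∀ i j, d 0 (J.integral (J.psi u v i * J.phi u v j))
      = d 0 (J.phi u v i) * J.phi u v j := fun i j => J.deriv_integral (hm i j)
  have hvx : ∀ j, d 0 (J.integral (d 0 v * J.phi u v j)) = d 0 v * J.phi u v j := fun j =>
    J.deriv_integral (hvm j)
  have hsucc : ∀ j, J.phi u v (j + 1) = d 0 (J.phi u v j)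
      + u * J.integral (d 0 v * J.phi u v j)
      - v * J.integral (J.psi u v 0 * J.phi u v j) := fun j => phi_succ j
  have hflow : ∀ k j, d k (J.phi u v j)
      = (flowOp d (laxOp d u v) k).apply (J.phi u v j) := by
    intro k j
    induction j with
    | zero => exact (h k).1
    | succ j ih =>
      rw [hsucc]
      exact eigen_laxOp (hd k 0) (hB k).isDiff (h k).1 (h k).2
        ((isLaxSolution_of_isConstrainedSolution hd h).lax k) ih (hvx j)
        (diff_integral (hd k 0) (J.d_dec k) (hB k) (hBr k) hv (hφ j) (h k).2 ih) (hmx 0 j)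
        (diff_integral (hd k 0) (J.d_dec k) (hB k) (hBr k) hur (hφ j) (h k).1 ih)
  refine ⟨h, rfl, hflow, fun k i j => ?_, fun k j => ?_, fun i j => ?_, hsucc, fun i j => ?_⟩
  · exact diff_integral (hd k 0) (J.d_dec k) (hB k) (hBr k) (J.dec_le _ (hφ i)) (hφ j)
      (hflow k i) (hflow k j)
  · exact diff_integral (hd k 0) (J.d_dec k) (hB k) (hBr k) hv (hφ j) (h k).2 (hflow k j)
  · refine J.eq_of_deriv_eq (add_mem (J.integral_mem (hm i j)) (J.integral_mem (hm j i)))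
      (J.mul_mem _ (J.dec_le _ (hφ i)) _ (hφ j)) ?_
    rw [map_add, hmx, hmx, PDO.deriv_mul]
    ring
  -- The relation for `M (i + 1) j + M i (j + 1)` is an identity in `dec`, so it is enough to
  -- compare `x`-derivatives.
  · have hdm : ∀ j, d 0 (J.phi u v j) ∈ J.dec := fun j => J.d_dec 0 _ (hφ j)
    refine J.eq_of_deriv_eq
      (add_mem (J.integral_mem (hm (i + 1) j)) (J.integral_mem (hm i (j + 1))))
      (sub_mem (add_mem (add_mem (J.mul_mem _ (J.dec_le _ (hdm i)) _ (hφ j))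
        (J.mul_mem _ (J.dec_le _ (hφ i)) _ (sub_mem (hφ (j + 1)) (hdm j))))
        (J.mul_mem _ (J.dec_le _ (J.integral_mem (hvm i))) _ (J.integral_mem (hm 0 j))))
        (J.mul_mem _ (J.dec_le _ (J.integral_mem (hvm j))) _ (J.integral_mem (hm 0 i)))) ?_
    have h0 : J.phi u v 0 = u := rfl
    rw [map_add, hmx, hmx, map_sub, map_add, map_add, PDO.deriv_mul, PDO.deriv_mul, PDO.deriv_mul, PDO.deriv_mul,
      hvx, hvx, hmx, hmx, hsucc i, hsucc j]
    simp only [map_add, map_sub, PDO.deriv_mul, hvx, hmx, h0]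
    ring

theorem GW_eq_bordered {k n : ℕ} (h : n ≤ k + 1) (g f : ℕ → R) :
    J.GW k n g f = bordered k n (fun i j => J.integral (g i * f j)) f := by
  rw [GW, bordered]
  congr 1
  ext r c
  simp only [Matrix.of_apply]
  split_ifs with hr
  · rfl
  · rw [show (r : ℕ) - k = 0 by omega]; rfl

end IntegrationClass

end CMBKP

end

/-! ### The iterated potentials in terms of generalized Wronskians. -/

noncomputable section

namespace CMBKP

namespace IntegrationClass

open PDO

section Iterated

variable {R : Type*} [CommRing R] [Algebra ℂ R] {d : ℕ → Derivation ℂ R R}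
variable (J : IntegrationClass d) (u v : R)

/-- The integrals `∫ ψ^{(i)} φ^{(j)}`. -/
def moment (i j : ℕ) : R := J.integral (J.psi u v i * J.phi u v j)

/-- The eigenfunctions and integrals after `n` elementary gauge transformations. -/
abbrev lev (n : ℕ) : (ℕ → R) × (ℕ → ℕ → R) := level (J.phi u v) (J.moment u v) n

theorem tauFactor_eq (n : ℕ) : J.tauFactor u v n = bordered n n (J.moment u v) (J.phi u v) :=
  GW_eq_bordered (by omega) _ _

theorem tauFactor_zero : J.tauFactor u v 0 = 1 := Matrix.det_fin_zero

variable {J u v} (hd : ∀ i j a, d i (d j a) = d j (d i a)) (hu : u ∈ J.dec) (hv : v ∈ J.reg)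
  (h : IsConstrainedSolution d u v) {n : ℕ}

include hd hu hv h

theorem lev_spec (hn : ∀ k, k ≤ n → IsUnit (J.tauFactor u v k)) :
    (∃ b, IsChain d ((J.lev u v n).1 0) (levelV v (J.phi u v) (J.moment u v) n) (J.lev u v n).1
        (J.lev u v n).2 b) ∧
      (∀ m ε, ε ≤ 1 → bordered (n + m) (n + m + ε) (J.moment u v) (J.phi u v)
        = (-1) ^ (n * m) * J.tauFactor u v n * bordered m (m + ε) (J.lev u v n).2 (J.lev u v n).1) ∧
      (n ≠ 0 → IsUnit ((J.lev u v (n - 1)).1 0)) := by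
  have := level_spec hd (isChain hd hu hv h) n fun k hk => by
    have := hn k hk
    rwa [tauFactor_eq] at this
  rwa [tauFactor_eq]

/-- The determinant factorization with `m = 0`, `ε = 1`: the complementary determinant is the single
entry `f 0` of the current chain. -/
theorem uNew_eq (hn : ∀ k, k ≤ n → IsUnit (J.tauFactor u v k)) :
    J.uNew u v n = (J.lev u v n).1 0 := by
  have h1 := (lev_spec hd hu hv h hn).2.1 0 1 le_rfl
  have h2 : bordered 0 (0 + 1) (J.lev u v n).2 (J.lev u v n).1 = (J.lev u v n).1 0 := by
    simp [bordered]
  rw [h2, mul_zero, pow_zero, one_mul, add_zero] at h1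
  rw [uNew, GW_eq_bordered (by omega), ← mul_one ((J.lev u v n).1 0),
    ← Ring.mul_inverse_cancel _ (hn n le_rfl)]
  change bordered _ _ (J.moment u v) _ * _ = _
  rw [h1]
  ring

theorem isUnit_uNew (hn : ∀ k, k ≤ n + 1 → IsUnit (J.tauFactor u v k)) :
    IsUnit (J.uNew u v n) := by
  rw [uNew_eq hd hu hv h fun k hk => hn k (by omega)]
  exact (lev_spec hd hu hv h hn).2.2 (by omega)

/-- The factorization with `m = 1`, `ε = 0`, where the complementary determinant is half the square
of the current potential. It drives the formula for `v` and the tau functions. -/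
theorem tauFactor_succ (hn : ∀ k, k ≤ n → IsUnit (J.tauFactor u v k)) :
    2 * J.tauFactor u v (n + 1)
      = (-1) ^ n * (J.uNew u v n * J.uNew u v n * J.tauFactor u v n) := by
  obtain ⟨⟨b, hb⟩, h1, -⟩ := lev_spec hd hu hv h hn
  have h2 := h1 1 0 (by omega)
  have h3 : bordered 1 (1 + 0) (J.lev u v n).2 (J.lev u v n).1 = (J.lev u v n).2 0 0 := by
    simp [bordered]
  rw [h3, mul_one, add_zero] at h2
  rw [tauFactor_eq, h2, uNew_eq hd hu hv h hn]
  linear_combination (-1) ^ n * J.tauFactor u v n * hb.two_mul_M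

theorem vNew_eq (hn : ∀ k, k ≤ n + 1 → IsUnit (J.tauFactor u v k)) :
    J.vNew u v (n + 1) = -(2 * Ring.inverse (J.uNew u v n)) := by
  have hn' : ∀ k, k ≤ n → IsUnit (J.tauFactor u v k) := fun k hk => hn k (by omega)
  have h1 : J.GW n (n + 1) (J.psi u v) (J.phi u v) = J.uNew u v n * J.tauFactor u v n := by
    rw [uNew, mul_assoc, Ring.inverse_mul_cancel _ (hn' n le_rfl), mul_one]
  have h2 := Ring.mul_inverse_cancel _ (isUnit_uNew hd hu hv h hn)
  have h3 := tauFactor_succ hd hu hv h hn'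
  have h4 := Ring.mul_inverse_cancel _ (hn (n + 1) le_rfl)
  rw [vNew, Nat.add_sub_cancel, h1]
  set r := Ring.inverse (J.uNew u v n)
  set q := Ring.inverse (J.tauFactor u v (n + 1))
  linear_combination (-1) ^ n * J.uNew u v n * J.tauFactor u v n * q * h2
    - 2 * r * h4 + r * q * h3

theorem gaugeOp_succ (hn : ∀ k, k ≤ n + 1 → IsUnit (J.tauFactor u v k)) :
    J.gaugeOp u v (n + 1)
      = stepOp d (J.uNew u v n) (Ring.inverse (J.uNew u v n)) * J.gaugeOp u v n := by
  rw [gaugeOp, TI_mul_TD (Ring.mul_inverse_cancel _ (isUnit_uNew hd hu hv h hn))]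

/-- At `n = 0` truncated subtraction makes `vNew` equal to `1`, not to `v`; inductions therefore run
with `levelV`. -/
theorem levelV_eq (hn : ∀ k, k ≤ n → IsUnit (J.tauFactor u v k)) (h0 : n ≠ 0) :
    levelV v (J.phi u v) (J.moment u v) n = J.vNew u v n := by
  obtain ⟨n, rfl⟩ := Nat.exists_eq_succ_of_ne_zero h0
  rw [Nat.succ_eq_add_one, vNew_eq hd hu hv h hn,
    uNew_eq hd hu hv h fun k hk => hn k (by omega)]
  rfl

theorem isConstrainedSolution_lev (hn : ∀ k, k ≤ n → IsUnit (J.tauFactor u v k)) :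
    IsConstrainedSolution d (J.uNew u v n) (levelV v (J.phi u v) (J.moment u v) n) := by
  rw [uNew_eq hd hu hv h hn]
  obtain ⟨⟨b, hb⟩, -⟩ := lev_spec hd hu hv h hn
  exact hb.sol

theorem isGaugeTransformation_lev (hn : ∀ k, k ≤ n → IsUnit (J.tauFactor u v k)) :
    IsGaugeTransformation d (laxOp d u v)
      (laxOp d (J.uNew u v n) (levelV v (J.phi u v) (J.moment u v) n)) (J.gaugeOp u v n) := by
  induction n with
  | zero =>
    rw [uNew_eq hd hu hv h hn]
    exact isGaugeTransformation_one _
  | succ n ih =>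
    have hn' : ∀ k, k ≤ n → IsUnit (J.tauFactor u v k) := fun k hk => hn k (by omega)
    have hU := isUnit_uNew hd hu hv h hn
    rw [gaugeOp_succ hd hu hv h hn]
    refine (ih hn').comp hd ?_
    rw [uNew_eq hd hu hv h hn, uNew_eq hd hu hv h hn'] at *
    obtain ⟨⟨b, hb⟩, -⟩ := lev_spec hd hu hv h hn'
    exact hb.isGaugeTransformation hd (Ring.mul_inverse_cancel _ hU)

end Iterated

end IntegrationClass

end CMBKP

end

/-! ### The shift of times as a solution of a recursion. -/

noncomputable section

namespace CMBKP

/-! ### The shift `t ↦ t - 2[z⁻¹]` -/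

section Shift

theorem sum_antidiagonal_assoc {M : Type*} [AddCommMonoid M] (F : ℕ → ℕ → ℕ → M) (n : ℕ) :
    ∑ p ∈ Finset.HasAntidiagonal.antidiagonal n, ∑ q ∈ Finset.HasAntidiagonal.antidiagonal p.1, F q.1 q.2 p.2
      = ∑ p ∈ Finset.HasAntidiagonal.antidiagonal n, ∑ q ∈ Finset.HasAntidiagonal.antidiagonal p.2, F p.1 q.1 q.2 := by
  simp only [Finset.sum_sigma']
  refine Finset.sum_nbij' (fun x => ⟨(x.2.1, x.2.2 + x.1.2), (x.2.2, x.1.2)⟩)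
    (fun x => ⟨(x.1.1 + x.2.1, x.2.2), (x.1.1, x.2.1)⟩) ?_ ?_ ?_ ?_ ?_ <;>
  · rintro ⟨⟨a, b⟩, ⟨c, e⟩⟩
    simp only [Finset.mem_sigma, Finset.HasAntidiagonal.mem_antidiagonal]
    rintro ⟨rfl, rfl⟩
    simp [add_assoc]

variable {U V W : Type*} [AddCommGroup U] [AddCommGroup V] [AddCommGroup W]

/-- The coefficients of `-2 ∑_k X^{2k} T_k`. -/
def shiftGen (T : ℕ → V →+ V) (a : ℕ) : V →+ V := if Even a then (-2 : ℤ) • T (a / 2) else 0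

/-- The sequence `e` consists of the coefficients of `exp (-2 ∑_k X^{2k+1} / (2k+1) T_k) (e 0)`:
its generating function satisfies the corresponding differential equation. -/
def IsShift (T : ℕ → V →+ V) (e : ℕ → V) : Prop :=
  ∀ m, (m + 1) • e (m + 1) = ∑ p ∈ Finset.HasAntidiagonal.antidiagonal m, shiftGen T p.1 (e p.2)

theorem shiftGen_map {S : ℕ → U →+ U} {T : ℕ → V →+ V} (φ : U →+ V) {x : U}
    (h : ∀ k, T k (φ x) = φ (S k x)) (a : ℕ) :
    shiftGen T a (φ x) = φ (shiftGen S a x) := by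
  unfold shiftGen
  split_ifs
  · rw [AddMonoidHom.zsmul_apply, AddMonoidHom.zsmul_apply, map_zsmul, h]
  · rw [AddMonoidHom.zero_apply, AddMonoidHom.zero_apply, map_zero]

theorem IsShift.map {S : ℕ → U →+ U} {T : ℕ → V →+ V} {e : ℕ → U} (he : IsShift S e)
    (φ : U →+ V) (h : ∀ k i, T k (φ (e i)) = φ (S k (e i))) : IsShift T fun i => φ (e i) := by
  intro m
  dsimp only
  rw [← map_nsmul, he m, map_sum]
  exact Finset.sum_congr rfl fun p _ => (shiftGen_map φ (fun k => h k p.2) p.1).symm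

theorem IsShift.of_map {S : ℕ → U →+ U} {T : ℕ → V →+ V} {e : ℕ → U} (φ : U →+ V)
    (hφ : Function.Injective φ) (he : IsShift T fun i => φ (e i))
    (h : ∀ k i, T k (φ (e i)) = φ (S k (e i))) : IsShift S e := by
  intro m
  apply hφ
  rw [map_nsmul, he m, map_sum]
  exact Finset.sum_congr rfl fun p _ => shiftGen_map φ (fun k => h k p.2) p.1

/-- The recursion determines each term from the earlier ones, as `m + 1` is invertible. Two shifts
are compared by this uniqueness instead of manipulating exponentials. -/
theorem IsShift.ext [Module ℂ V] {T : ℕ → V →+ V} {e f : ℕ → V} (he : IsShift T e)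
    (hf : IsShift T f) (h0 : e 0 = f 0) (m : ℕ) : e m = f m := by
  induction m using Nat.strong_induction_on with
  | _ m ih =>
    cases m with
    | zero => exact h0
    | succ m =>
      have h1 : (m + 1) • e (m + 1) = (m + 1) • f (m + 1) := by
        rw [he m, hf m]
        refine Finset.sum_congr rfl fun p hp => ?_
        rw [ih p.2 (Nat.lt_succ_of_le (Finset.HasAntidiagonal.antidiagonal.snd_le hp))]
      rw [← Nat.cast_smul_eq_nsmul ℂ, ← Nat.cast_smul_eq_nsmul ℂ] at h1
      exact smul_right_injective V (Nat.cast_ne_zero.2 m.succ_ne_zero) h1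

theorem IsShift.mem [Module ℂ V] {T : ℕ → V →+ V} {e : ℕ → V} (he : IsShift T e)
    (K : Submodule ℂ V) (hT : ∀ k, ∀ x ∈ K, T k x ∈ K) (h0 : e 0 ∈ K) (m : ℕ) : e m ∈ K := by
  induction m using Nat.strong_induction_on with
  | _ m ih =>
    cases m with
    | zero => exact h0
    | succ m =>
      have h1 : (m + 1) • e (m + 1) ∈ K := by
        rw [he m]
        refine K.sum_mem fun p hp => ?_
        have := ih p.2 (Nat.lt_succ_of_le (Finset.HasAntidiagonal.antidiagonal.snd_le hp))
        unfold shiftGen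
        split_ifs
        · rw [AddMonoidHom.zsmul_apply]
          exact zsmul_mem (hT _ _ this) _
        · exact K.zero_mem
      rw [← Nat.cast_smul_eq_nsmul ℂ] at h1
      exact (K.smul_mem_iff (Nat.cast_ne_zero.2 m.succ_ne_zero)).1 h1

/-- The Leibniz rule for shifts: they are multiplicative for a pairing that satisfies the Leibniz
rule. -/
theorem IsShift.mul {S : ℕ → U →+ U} {T : ℕ → V →+ V} {Q : ℕ → W →+ W} {e : ℕ → U} {f : ℕ → V}
    (he : IsShift S e) (hf : IsShift T f) (β : U →+ V →+ W)
    (h : ∀ k i j, Q k (β (e i) (f j)) = β (S k (e i)) (f j) + β (e i) (T k (f j))) :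
    IsShift Q fun m => ∑ p ∈ Finset.HasAntidiagonal.antidiagonal m, β (e p.1) (f p.2) := by
  intro m
  have hgen : ∀ a i j, shiftGen Q a (β (e i) (f j))
      = β (shiftGen S a (e i)) (f j) + β (e i) (shiftGen T a (f j)) := by
    intro a i j
    unfold shiftGen
    split_ifs
    · simp only [AddMonoidHom.zsmul_apply, map_zsmul, h, smul_add]
    · simp
  have h1 : ∑ p ∈ Finset.HasAntidiagonal.antidiagonal (m + 1), p.1 • β (e p.1) (f p.2)
      = ∑ p ∈ Finset.HasAntidiagonal.antidiagonal m, ∑ q ∈ Finset.HasAntidiagonal.antidiagonal p.2,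
          β (shiftGen S p.1 (e q.1)) (f q.2) := by
    rw [Finset.Nat.sum_antidiagonal_succ, zero_smul, zero_add,
      ← sum_antidiagonal_assoc fun a b c => β (shiftGen S a (e b)) (f c)]
    refine Finset.sum_congr rfl fun p _ => ?_
    rw [← AddMonoidHom.nsmul_apply, ← map_nsmul, he, map_sum, AddMonoidHom.finsetSum_apply]
  have h2 : ∑ p ∈ Finset.HasAntidiagonal.antidiagonal (m + 1), p.2 • β (e p.1) (f p.2)
      = ∑ p ∈ Finset.HasAntidiagonal.antidiagonal m, ∑ q ∈ Finset.HasAntidiagonal.antidiagonal p.2,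
          β (e q.1) (shiftGen T p.1 (f q.2)) := by
    rw [Finset.Nat.sum_antidiagonal_succ', zero_smul, zero_add,
      ← sum_antidiagonal_assoc fun a b c => β (e b) (shiftGen T a (f c))]
    have : ∀ p : ℕ × ℕ, ∑ q ∈ Finset.HasAntidiagonal.antidiagonal p.1, β (e q.2) (shiftGen T q.1 (f p.2))
        = ∑ q ∈ Finset.HasAntidiagonal.antidiagonal p.1, β (e q.1) (shiftGen T q.2 (f p.2)) := fun p =>
      (Finset.Nat.sum_antidiagonal_swap
        (f := fun q => β (e q.1) (shiftGen T q.2 (f p.2)))).symm ▸ rfl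
    simp only [this]
    rw [sum_antidiagonal_assoc fun a b c => β (e a) (shiftGen T b (f c))]
    refine Finset.sum_congr rfl fun p _ => ?_
    rw [← map_nsmul, hf, map_sum]
  calc (m + 1) • ∑ p ∈ Finset.HasAntidiagonal.antidiagonal (m + 1), β (e p.1) (f p.2)
      = ∑ p ∈ Finset.HasAntidiagonal.antidiagonal (m + 1),
          (p.1 • β (e p.1) (f p.2) + p.2 • β (e p.1) (f p.2)) := by
        rw [Finset.smul_sum]
        refine Finset.sum_congr rfl fun p hp => ?_
        rw [← add_smul, Finset.HasAntidiagonal.mem_antidiagonal.1 hp]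
    _ = _ := by
        rw [Finset.sum_add_distrib, h1, h2, ← Finset.sum_add_distrib]
        refine Finset.sum_congr rfl fun p _ => ?_
        rw [map_sum, ← Finset.sum_add_distrib]
        exact Finset.sum_congr rfl fun q _ => (hgen _ _ _).symm

end Shift

section ShiftCoeff

variable {R : Type*} [CommRing R] [Algebra ℂ R]

/-- The derivation `X d/dX` of power series over a possibly noncommutative ring. -/
def eulerOp {E : Type*} [Ring E] (F : PowerSeries E) : PowerSeries E :=
  PowerSeries.mk fun n => n • PowerSeries.coeff n F

theorem coeff_eulerOp {E : Type*} [Ring E] (F : PowerSeries E) (n : ℕ) :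
    PowerSeries.coeff n (eulerOp F) = n • PowerSeries.coeff n F := PowerSeries.coeff_mk _ _

theorem eulerOp_mul {E : Type*} [Ring E] (F G : PowerSeries E) :
    eulerOp (F * G) = eulerOp F * G + F * eulerOp G := by
  ext n
  rw [coeff_eulerOp, map_add, PowerSeries.coeff_mul, PowerSeries.coeff_mul, PowerSeries.coeff_mul,
    ← Finset.sum_add_distrib, Finset.smul_sum]
  refine Finset.sum_congr rfl fun p hp => ?_
  rw [coeff_eulerOp, coeff_eulerOp, smul_mul_assoc, mul_smul_comm, ← add_smul,
    Finset.HasAntidiagonal.mem_antidiagonal.1 hp]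

theorem eulerOp_pow {E : Type*} [Ring E] {F : PowerSeries E} (h : Commute (eulerOp F) F) (n : ℕ) :
    eulerOp (F ^ (n + 1)) = (n + 1) • (eulerOp F * F ^ n) := by
  induction n with
  | zero => simp
  | succ n ih =>
    rw [pow_succ, eulerOp_mul, ih, smul_mul_assoc, mul_assoc, ← pow_succ,
      ← (h.pow_right (n + 1)).eq, ← succ_nsmul]

variable (d : ℕ → Derivation ℂ R R)

/-- The derivations as additive maps. -/
def flowHom (k : ℕ) : R →+ R := ((d k : R →ₗ[ℂ] R)).toAddMonoidHom

theorem flowHom_apply (k : ℕ) (f : R) : flowHom d k f = d k f := rfl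

variable {d}

theorem commute_eulerOp_shiftExponent (hd : ∀ i j a, d i (d j a) = d j (d i a)) :
    Commute (eulerOp (shiftExponent d)) (shiftExponent d) := by
  have hc : ∀ i j, Commute (PowerSeries.coeff i (shiftExponent d))
      (PowerSeries.coeff j (shiftExponent d)) := by
    intro i j
    simp only [shiftExponent, PowerSeries.coeff_mk]
    split_ifs
    · refine Commute.smul_left (Commute.smul_right ?_ _) _
      ext a
      exact hd _ _ a
    · exact Commute.zero_right _
    · exact Commute.zero_left _
    · exact Commute.zero_left _
  ext1 n
  rw [PowerSeries.coeff_mul, PowerSeries.coeff_mul, ← Finset.Nat.sum_antidiagonal_swap]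
  refine Finset.sum_congr rfl fun p _ => ?_
  rw [coeff_eulerOp, coeff_eulerOp, Prod.fst_swap, Prod.snd_swap, smul_mul_assoc, mul_smul_comm,
    (hc _ _).eq]

theorem coeff_shiftExponent_pow {m j : ℕ} (h : m < j) :
    PowerSeries.coeff m (shiftExponent d ^ j) = 0 := by
  refine PowerSeries.coeff_of_lt_order _ ?_
  have h0 : PowerSeries.constantCoeff (shiftExponent d) = 0 := by
    rw [← PowerSeries.coeff_zero_eq_constantCoeff_apply, shiftExponent, PowerSeries.coeff_mk]
    simp
  have h1 : (j : ℕ∞) ≤ (shiftExponent d ^ j).order := by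
    refine PowerSeries.le_order_pow_of_constantCoeff_eq_zero _ h0
  exact lt_of_lt_of_le (by exact_mod_cast h) h1

theorem smul_coeff_shiftExponent (a : ℕ) (f : R) :
    ((a + 1) • PowerSeries.coeff (a + 1) (shiftExponent d)) f = shiftGen (flowHom d) a f := by
  rw [shiftExponent, PowerSeries.coeff_mk, shiftGen]
  by_cases ha : Even a
  · rw [if_pos ha, if_pos ha.add_one]
    obtain ⟨k, rfl⟩ := ha
    rw [show (k + k + 1) / 2 = (k + k) / 2 by omega, AddMonoidHom.zsmul_apply, flowHom_apply,
      LinearMap.smul_apply, LinearMap.smul_apply, ← Nat.cast_smul_eq_nsmul ℂ, smul_smul,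
      ← Int.cast_smul_eq_zsmul ℂ]
    congr 1
    have : ((k + k + 1 : ℕ) : ℂ) ≠ 0 := Nat.cast_ne_zero.2 (Nat.succ_ne_zero _)
    push_cast at this ⊢
    rw [mul_neg, mul_div_cancel₀ _ this]
  · rw [if_neg ha, if_neg fun h => ha (by simpa [parity_simps] using h)]
    simp

/-- Apply `X d/dX` to the exponential of `S`. The power rule is available because the derivations
commute, hence so do `S` and `X dS/dX`. -/
theorem isShift_shiftCoeff (hd : ∀ i j a, d i (d j a) = d j (d i a)) (f : R) :
    IsShift (flowHom d) fun m => shiftCoeff d m f := by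
  intro m
  set S := shiftExponent d with hS
  have h1 : ∀ j, (m + 1) • PowerSeries.coeff (m + 1) (S ^ (j + 1))
      = (j + 1) • ∑ p ∈ Finset.HasAntidiagonal.antidiagonal m,
        ((p.1 + 1) • PowerSeries.coeff (p.1 + 1) S) * PowerSeries.coeff p.2 (S ^ j) := by
    intro j
    rw [← coeff_eulerOp, eulerOp_pow (commute_eulerOp_shiftExponent hd), map_nsmul,
      PowerSeries.coeff_mul, Finset.Nat.sum_antidiagonal_succ]
    simp only [coeff_eulerOp, zero_smul, zero_mul, zero_add, hS]
  have h2 : ∀ j : ℕ, (m + 1) • (((j + 1).factorial : ℂ)⁻¹ • PowerSeries.coeff (m + 1) (S ^ (j + 1))) f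
      = ∑ p ∈ Finset.HasAntidiagonal.antidiagonal m,
        shiftGen (flowHom d) p.1 (((j.factorial : ℂ)⁻¹ • PowerSeries.coeff p.2 (S ^ j)) f) := by
    intro j
    rw [← LinearMap.smul_apply, smul_comm, h1, ← Nat.cast_smul_eq_nsmul ℂ, smul_smul,
      Nat.factorial_succ, Nat.cast_mul, mul_inv, mul_comm (_⁻¹), mul_assoc,
      inv_mul_cancel₀ (Nat.cast_ne_zero.2 j.succ_ne_zero), mul_one, LinearMap.smul_apply,
      LinearMap.sum_apply, Finset.smul_sum]
    refine Finset.sum_congr rfl fun p _ => ?_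
    rw [← smul_coeff_shiftExponent, LinearMap.smul_apply _ (PowerSeries.coeff p.2 (S ^ j)),
      map_smul]
    rfl
  -- The truncated exponentials are brought to a common length; the added terms vanish since `S` has
  -- no constant term.
  have h3 : ∀ n ≤ m, shiftCoeff d n f = ∑ j ∈ Finset.range (m + 1),
      ((j.factorial : ℂ)⁻¹ • PowerSeries.coeff n (S ^ j)) f := by
    intro n hn
    refine Finset.sum_subset (Finset.range_mono (by omega)) fun j _ hj => ?_
    rw [Finset.mem_range, not_lt] at hj
    rw [coeff_shiftExponent_pow (by omega)]
    simp
  have h4 : (PowerSeries.coeff (m + 1) (S ^ 0) : Module.End ℂ R) f = 0 := by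
    rw [pow_zero, PowerSeries.coeff_one, if_neg m.succ_ne_zero, LinearMap.zero_apply]
  dsimp only
  rw [shiftCoeff, Finset.sum_range_succ', h4, smul_zero, add_zero, Finset.smul_sum]
  calc _ = ∑ j ∈ Finset.range (m + 1), ∑ p ∈ Finset.HasAntidiagonal.antidiagonal m,
        shiftGen (flowHom d) p.1 (((j.factorial : ℂ)⁻¹ • PowerSeries.coeff p.2 (S ^ j)) f) :=
      Finset.sum_congr rfl fun j _ => h2 j
    _ = _ := by
      rw [Finset.sum_comm]
      refine Finset.sum_congr rfl fun p hp => ?_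
      rw [h3 p.2 (Finset.HasAntidiagonal.antidiagonal.snd_le hp), map_sum]

theorem shiftCoeff_zero (f : R) : shiftCoeff d 0 f = f := by
  simp [shiftCoeff]

variable (d) in
/-- The additive map `f ↦` coefficient of `z^{-m}` in `f(t - 2[z⁻¹])`. -/
def shiftHom (m : ℕ) : R →+ R :=
  (∑ j ∈ Finset.range (m + 1),
    ((j.factorial : ℂ)⁻¹) • PowerSeries.coeff m (shiftExponent d ^ j)).toAddMonoidHom

theorem shiftHom_apply (m : ℕ) (f : R) : shiftHom d m f = shiftCoeff d m f := by
  simp [shiftHom, shiftCoeff, LinearMap.sum_apply]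

theorem shiftCoeff_one (hd : ∀ i j a, d i (d j a) = d j (d i a)) (m : ℕ) :
    shiftCoeff d m 1 = if m = 0 then 1 else 0 := by
  refine (isShift_shiftCoeff hd 1).ext (f := fun m => if m = 0 then 1 else 0) (fun m => ?_) ?_ m
  · dsimp only
    rw [if_neg m.succ_ne_zero, smul_zero]
    refine (Finset.sum_eq_zero fun p _ => ?_).symm
    unfold shiftGen
    split_ifs <;> simp [flowHom_apply]
  · exact shiftCoeff_zero 1

variable (d) in
/-- The power series `f(t - 2[z⁻¹])` in `z⁻¹`. -/
def shiftSeries (f : R) : PowerSeries R := PowerSeries.mk fun m => shiftCoeff d m f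

/-- The exponential of a derivation is multiplicative: both sides obey the recursion with the same
initial term. -/
theorem shiftSeries_mul (hd : ∀ i j a, d i (d j a) = d j (d i a)) (f g : R) :
    shiftSeries d (f * g) = shiftSeries d f * shiftSeries d g := by
  ext m
  rw [PowerSeries.coeff_mul, shiftSeries, shiftSeries, shiftSeries, PowerSeries.coeff_mk]
  simp only [PowerSeries.coeff_mk]
  refine (isShift_shiftCoeff hd (f * g)).ext ((isShift_shiftCoeff hd f).mul (isShift_shiftCoeff hd g)
    AddMonoidHom.mul fun k i j => ?_) ?_ m
  · simp only [AddMonoidHom.mul_apply, flowHom_apply, PDO.deriv_mul]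
    ring
  · simp [shiftCoeff_zero]

end ShiftCoeff

end CMBKP

end

/-! ### Shifted wave operators and the transformation of tau functions. -/

noncomputable section

namespace CMBKP

namespace PDO

section Symbol

variable {R : Type*} [CommRing R] [Algebra ℂ R] {δ : Derivation ℂ R R}

/-- The coefficients of nonpositive order of `P` as a power series: the symbol of `P` when `P` has
order at most `0`. -/
def symbol (P : PDO δ) : PowerSeries R := PowerSeries.mk fun s => P.coeff (-(s : ℤ))

theorem coeff_symbol (P : PDO δ) (s : ℕ) :
    PowerSeries.coeff s P.symbol = P.coeff (-(s : ℤ)) := PowerSeries.coeff_mk _ _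

/-- The adjoint `(-1)^s ∂^{-s} b` of `b ∂^{-s}` selects the coefficient of `∂^s` in `A`. Terms of
`B` below order `-m` do not reach the residue. -/
theorem res_mul_del_inv_mul_adjoint {A B : PDO δ} {m : ℕ} (hA : A.OrdLE m) (hB : B.OrdLE 0) :
    (A * del δ (-1) * B.adjoint).coeff (-1)
      = ∑ s ∈ Finset.range (m + 1), (-1) ^ s * (A.coeff s * B.coeff (-(s : ℤ))) := by
  set B₁ : PDO δ := ∑ s ∈ Finset.range (m + 1), single δ (-(s : ℤ)) (B.coeff (-(s : ℤ))) with hB₁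
  have h1 : (B - B₁).OrdLE (-m - 1) := by
    intro j hj
    rw [coeff_sub, hB₁, coeff_sum]
    simp only [coeff_single]
    by_cases h : 0 < j
    · rw [hB j h, Finset.sum_eq_zero fun s _ => if_neg (by omega), sub_zero]
    · obtain ⟨n, hn⟩ := Int.eq_ofNat_of_zero_le (show 0 ≤ -j by omega)
      obtain rfl : j = -(n : ℤ) := by omega
      rw [Finset.sum_eq_single n, if_pos rfl, sub_self]
      · exact fun s _ hs => if_neg (by omega)
      · exact fun h => absurd (Finset.mem_range.2 (by omega)) h
  have h2 : (A * del δ (-1) * (B - B₁).adjoint).coeff (-1) = 0 := by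
    refine OrdLE.res ?_
    exact ((hA.mul (ordLE_del _)).mul h1.adjoint).mono (by omega)
  have h3 : (A * del δ (-1) * B.adjoint).coeff (-1)
      = (A * del δ (-1) * B₁.adjoint).coeff (-1) := by
    rw [adjoint_sub, mul_sub, coeff_sub, sub_eq_zero] at h2
    exact h2
  have h4 : B₁.adjoint
      = ∑ s ∈ Finset.range (m + 1), (single δ (-(s : ℤ)) (B.coeff (-(s : ℤ)))).adjoint :=
    map_sum (adjointHom δ) _ _
  rw [h3, h4, Finset.mul_sum, coeff_sum]
  refine Finset.sum_congr rfl fun s _ => ?_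
  rw [adjoint_single, mul_smul_comm, coeff_zsmul, ← mul_assoc, res_mul_mulOp, mul_assoc A,
    del_mul_del, coeff_mul_del, Int.negOnePow_neg, zsmul_eq_mul,
    show -1 - (-1 + -(s : ℤ)) = s by ring]
  simp [Int.negOnePow_def]

theorem OrdLE.eq_zero {P : PDO δ} (h : ∀ n, P.OrdLE n) : P = 0 := by
  ext m
  exact h (m - 1) m (by omega)

theorem eq_zero_of_mul_monic {X Φ : PDO δ} (hΦ : (Φ - 1).OrdLE (-1)) (h : X * Φ = 0) : X = 0 := by
  obtain ⟨a, ha⟩ := X.exists_ordLE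
  have hX : X = -(X * (Φ - 1)) := by rw [mul_sub, h, mul_one]; abel
  have key : ∀ k : ℕ, X.OrdLE (a - k) := by
    intro k
    induction k with
    | zero => simpa using ha
    | succ k ih =>
      rw [hX]
      exact (ih.mul hΦ).neg'.mono (by push_cast; omega)
  exact OrdLE.eq_zero fun n => (key (a - n).toNat).mono (by omega)

theorem del_one_pow (n : ℕ) : (del δ 1) ^ n = del δ n := by
  induction n with
  | zero => rw [pow_zero]; rfl
  | succ n ih => rw [pow_succ, ih, del_mul_del]; push_cast; rfl

theorem IsDiff.apply_mul {P B : PDO δ} (hP : P.IsDiff) (hB : B.IsDiff) (f : R) :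
    (P * B).apply f = P.apply (B.apply f) := by
  obtain ⟨C, hC, h⟩ := hB.mul_mulOp_del_inv f
  rw [← res_mul_mulOp_mul_del_inv, ← res_mul_mulOp_mul_del_inv,
    show P * B * mulOp δ f * del δ (-1) = P * (B * mulOp δ f * del δ (-1)) by
      simp only [mul_assoc], h, mul_add, coeff_add, (hP.mul hC).res, zero_add, mul_assoc]

theorem apply_one (P : PDO δ) : P.apply 1 = P.coeff 0 := by
  rw [apply_eq, mulOp_one, mul_one]

end Symbol

section Wave

variable {R : Type*} [CommRing R] [Algebra ℂ R] {d : ℕ → Derivation ℂ R R}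

local notation "𝐃" => PDO.del (d 0) 1
local notation "𝐈" => PDO.del (d 0) (-1)
local notation "𝐦" => PDO.mulOp (d 0)

variable (d) in
/-- The derivation `d k` of the coefficients as an additive map. -/
def diffHom (k : ℕ) : PDO (d 0) →+ PDO (d 0) := AddMonoidHom.mk' (diff (d k)) (diff_add (d k))

theorem diffHom_apply (k : ℕ) (P : PDO (d 0)) : diffHom d k P = P.diff (d k) := rfl

theorem mulRightHom_apply (P Q : PDO (d 0)) : mulRightHom Q P = P * Q := rfl

/-- The coefficient of `z^{-i}` in `P(t - 2[z⁻¹])`. -/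
def shiftOp (i : ℕ) (P : PDO (d 0)) : PDO (d 0) where
  coeff m := shiftCoeff d i (P.coeff m)
  bdd := by
    obtain ⟨a, ha⟩ := P.bdd
    exact ⟨a, fun m hm => by rw [ha m hm, ← shiftHom_apply, map_zero]⟩

theorem coeff_shiftOp (i : ℕ) (P : PDO (d 0)) (m : ℤ) :
    (shiftOp i P).coeff m = shiftCoeff d i (P.coeff m) := rfl

theorem isShift_shiftOp (hd : ∀ i j a, d i (d j a) = d j (d i a)) (P : PDO (d 0)) :
    IsShift (diffHom d) fun i => shiftOp i P := by
  intro m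
  ext j
  have h := isShift_shiftCoeff hd (P.coeff j) m
  refine (map_nsmul (coeffHom (d 0) j) (m + 1) (shiftOp (m + 1) P)).trans (.trans ?_
    (map_sum (coeffHom (d 0) j) _ _).symm)
  refine h.trans (Finset.sum_congr rfl fun p _ => ?_)
  exact shiftGen_map (S := diffHom d) (T := flowHom d) (coeffHom (d 0) j)
    (x := shiftOp p.2 P) (fun k => rfl) p.1

/-- The coefficients of `(1 - X) / (1 + X)`. -/
def cayleyCoeff (l : ℕ) : ℤ := 2 * (-1) ^ l - if l = 0 then 1 else 0

/-- Coefficients of `(1 - X)/(1 + X) · 1/(1 - X²) = 1/(1 + X)²`. -/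
theorem cayleyCoeff_sum (m : ℕ) :
    ∑ p ∈ Finset.HasAntidiagonal.antidiagonal m, (if Even p.1 then cayleyCoeff p.2 else 0)
      = (-1) ^ m * (m + 1) := by
  induction m using Nat.twoStepInduction with
  | zero => simp [cayleyCoeff]
  | one => simp [cayleyCoeff, Finset.Nat.sum_antidiagonal_succ]
  | more m ih _ =>
    rw [Finset.Nat.sum_antidiagonal_succ, Finset.Nat.sum_antidiagonal_succ]
    simp only [add_assoc, Nat.reduceAdd]
    have h : ∀ a : ℕ, Even (a + 2) ↔ Even a := fun a => by simp [parity_simps]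
    simp only [h, ih]
    simp [cayleyCoeff]
    ring

variable (d) in
/-- The term of order `l` of `(1 - ∂) / (1 + ∂)`. -/
def cayleyTerm (l : ℕ) : PDO (d 0) := cayleyCoeff l • del (d 0) l

/-- Identifies `(1 - z⁻¹∂)/(1 + z⁻¹∂)` with `exp(-2 ∑ z^{-j} ∂^j / j)`, `j` odd, the operator form
of the effect of the shift on `e^ξ`. -/
theorem isShift_cayleyTerm :
    IsShift (fun k => mulRightHom (del (d 0) ((2 * k + 1 : ℕ) : ℤ))) (cayleyTerm d) := by
  intro m
  have h : ∀ p ∈ Finset.HasAntidiagonal.antidiagonal m,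
      shiftGen (fun k => mulRightHom (del (d 0) ((2 * k + 1 : ℕ) : ℤ))) p.1 (cayleyTerm d p.2)
        = (-2 * if Even p.1 then cayleyCoeff p.2 else 0) • del (d 0) ((m + 1 : ℕ) : ℤ) := by
    intro p hp
    rw [Finset.HasAntidiagonal.mem_antidiagonal] at hp
    unfold shiftGen
    split_ifs with he
    · rw [AddMonoidHom.zsmul_apply, cayleyTerm, map_zsmul, mulRightHom_apply, del_mul_del,
        smul_smul]
      congr 2
      rw [← Nat.cast_add]
      congr 1
      obtain ⟨k, hk⟩ := he
      omega
    · simp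
  rw [Finset.sum_congr rfl h, ← Finset.sum_smul, ← Finset.mul_sum, cayleyCoeff_sum, cayleyTerm,
    ← natCast_zsmul, smul_smul]
  congr 1
  rw [cayleyCoeff, if_neg m.succ_ne_zero]
  push_cast
  ring

/-- The coefficient of `z^{-m}` in the shifted wave operator
`Φ(t - 2[z⁻¹]) (1 - z⁻¹∂) / (1 + z⁻¹∂)`. -/
def shiftedWave (Φ : PDO (d 0)) (m : ℕ) : PDO (d 0) :=
  ∑ p ∈ Finset.HasAntidiagonal.antidiagonal m, shiftOp p.1 Φ * cayleyTerm d p.2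

theorem isShift_shiftedWave (hd : ∀ i j a, d i (d j a) = d j (d i a)) (Φ : PDO (d 0)) :
    IsShift (fun k => diffHom d k + mulRightHom (del (d 0) ((2 * k + 1 : ℕ) : ℤ)))
      (shiftedWave Φ) := by
  refine (isShift_shiftOp hd Φ).mul isShift_cayleyTerm AddMonoidHom.mul fun k i j => ?_
  simp only [AddMonoidHom.mul_apply, AddMonoidHom.add_apply, diffHom_apply, mulRightHom_apply,
    diff_mul (hd k 0)]
  have : (cayleyTerm d j).diff (d k) = 0 := by
    have h := map_zsmul (diffHom d k) (cayleyCoeff j) (del (d 0) (j : ℤ))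
    simp only [diffHom_apply, diff_del, smul_zero] at h
    exact h
  rw [this, mul_zero, add_zero, mul_assoc]

variable {Φ : PDO (d 0)}

theorem ordLE_shiftedWave (hΦ : (Φ - 1).OrdLE (-1)) (m : ℕ) : (shiftedWave Φ m).OrdLE m := by
  intro j hj
  rw [shiftedWave, coeff_sum]
  refine Finset.sum_eq_zero fun p hp => ?_
  have hp2 := Finset.HasAntidiagonal.antidiagonal.snd_le hp
  rw [cayleyTerm, mul_smul_comm, coeff_zsmul, coeff_mul_del, coeff_shiftOp,
    (monic_iff.1 hΦ).1 _ (by omega), ← shiftHom_apply, map_zero, smul_zero]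

/-- The shift of the wave function with `z` replaced by `-z`. -/
def oppositeWave (Φ : PDO (d 0)) : PowerSeries R :=
  PowerSeries.mk fun n => ∑ p ∈ Finset.HasAntidiagonal.antidiagonal n,
    (-1) ^ p.2 * shiftCoeff d p.1 (Φ.coeff (-(p.2 : ℤ)))

/-- The terms with `p.2 < s` involve coefficients of `Φ` of positive order and vanish; the others
are those for `s = 0` up to the sign `(-1)^s`. -/
theorem sum_shift_coeff (hΦ : (Φ - 1).OrdLE (-1)) (n s : ℕ) :
    ∑ p ∈ Finset.HasAntidiagonal.antidiagonal (n + s),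
        (-1) ^ p.2 * shiftCoeff d p.1 (Φ.coeff (s - (p.2 : ℤ)))
      = (-1) ^ s * PowerSeries.coeff n (oppositeWave Φ) := by
  induction s with
  | zero => simp [oppositeWave]
  | succ s ih =>
    rw [← add_assoc, Finset.Nat.sum_antidiagonal_succ', (monic_iff.1 hΦ).1 _ (by simp),
      ← shiftHom_apply, map_zero, mul_zero, zero_add, pow_succ, mul_right_comm, ← ih,
      Finset.sum_mul]
    refine Finset.sum_congr rfl fun p _ => ?_
    rw [show ((s + 1 : ℕ) : ℤ) - ((p.2 + 1 : ℕ) : ℤ) = s - (p.2 : ℤ) by push_cast; ring]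
    ring

theorem coeff_shiftedWave (hd : ∀ i j a, d i (d j a) = d j (d i a)) (hΦ : (Φ - 1).OrdLE (-1))
    (n s : ℕ) :
    (-1) ^ s * (shiftedWave Φ (n + s)).coeff s
      = 2 * PowerSeries.coeff n (oppositeWave Φ) - if n + s = 0 then 1 else 0 := by
  have h1 : (shiftedWave Φ (n + s)).coeff s
      = 2 * ∑ p ∈ Finset.HasAntidiagonal.antidiagonal (n + s),
          (-1) ^ p.2 * shiftCoeff d p.1 (Φ.coeff (s - (p.2 : ℤ)))
        - ∑ p ∈ Finset.HasAntidiagonal.antidiagonal (n + s),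
          (if p.2 = 0 then shiftCoeff d p.1 (Φ.coeff (s - (p.2 : ℤ))) else 0) := by
    rw [shiftedWave, coeff_sum, Finset.mul_sum, ← Finset.sum_sub_distrib]
    refine Finset.sum_congr rfl fun p _ => ?_
    rw [cayleyTerm, mul_smul_comm, coeff_zsmul, coeff_mul_del, coeff_shiftOp, cayleyCoeff,
      zsmul_eq_mul]
    split_ifs <;> push_cast <;> ring
  have h2 : ∑ p ∈ Finset.HasAntidiagonal.antidiagonal (n + s),
      (if p.2 = 0 then shiftCoeff d p.1 (Φ.coeff (s - (p.2 : ℤ))) else 0)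
        = if n + s = 0 then 1 else 0 := by
    rw [Finset.sum_eq_single (n + s, 0)]
    · rw [if_pos rfl]
      rcases s with _ | s
      · rw [show ((0 : ℕ) : ℤ) - (((n + 0, 0) : ℕ × ℕ).2 : ℤ) = 0 by simp, (monic_iff.1 hΦ).2,
          shiftCoeff_one hd]
      · rw [(monic_iff.1 hΦ).1 _ (by simp), ← shiftHom_apply, map_zero, if_neg (by omega)]
    · rintro ⟨a, b⟩ hp hne
      rw [Finset.HasAntidiagonal.mem_antidiagonal] at hp
      refine if_neg fun hb => hne ?_
      dsimp only at hp hb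
      rw [Prod.mk.injEq]
      omega
    · intro h
      exact absurd (Finset.HasAntidiagonal.mem_antidiagonal.2 (by simp)) h
  rw [h1, h2, sum_shift_coeff hΦ, mul_sub]
  have h3 : ((-1 : R) ^ s) * (-1) ^ s = 1 := by rw [← mul_pow]; simp
  have h4 : ((-1 : R) ^ s) * (if n + s = 0 then 1 else 0) = if n + s = 0 then 1 else 0 := by
    split_ifs with h
    · obtain rfl : s = 0 := by omega
      simp
    · simp
  rw [h4]
  linear_combination 2 * PowerSeries.coeff n (oppositeWave Φ) * h3

theorem res_shiftedWave (hd : ∀ i j a, d i (d j a) = d j (d i a)) (hΦ : (Φ - 1).OrdLE (-1))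
    {B : PDO (d 0)} (hB : B.OrdLE 0) (m : ℕ) :
    (shiftedWave Φ m * 𝐈 * B.adjoint).coeff (-1)
      = 2 * PowerSeries.coeff m (B.symbol * oppositeWave Φ)
        - if m = 0 then B.coeff 0 else 0 := by
  rw [res_mul_del_inv_mul_adjoint (ordLE_shiftedWave hΦ m) hB, PowerSeries.coeff_mul,
    Finset.Nat.sum_antidiagonal_eq_sum_range_succ_mk, Finset.mul_sum]
  have h : ∀ s ∈ Finset.range (m + 1),
      (-1) ^ s * ((shiftedWave Φ m).coeff s * B.coeff (-(s : ℤ)))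
        = 2 * (PowerSeries.coeff s B.symbol * PowerSeries.coeff (m - s) (oppositeWave Φ))
          - if m = 0 then B.coeff (-(s : ℤ)) else 0 := by
    intro s hs
    obtain ⟨n, rfl⟩ : ∃ n, m = n + s := ⟨m - s, by have := Finset.mem_range.1 hs; omega⟩
    rw [← mul_assoc, coeff_shiftedWave hd hΦ, Nat.add_sub_cancel, coeff_symbol]
    split_ifs <;> ring
  rw [Finset.sum_congr rfl h, Finset.sum_sub_distrib]
  congr 1
  split_ifs with hm
  · subst hm
    simp
  · simp

/-! ### The tau function of an elementary gauge transformation -/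

theorem _root_.CMBKP.IsDressing.monic {L : PDO (d 0)} (h : IsDressing d L Φ) :
    (Φ - 1).OrdLE (-1) := monic_iff.2 ⟨h.coeff_of_pos, h.coeff_zero⟩

theorem _root_.CMBKP.IsDressing.mul_del_inv_mul_adjoint {L : PDO (d 0)} (h : IsDressing d L Φ) :
    Φ * 𝐈 * Φ.adjoint = 𝐈 := by
  have h1 : (Φ * 𝐈 * Φ.adjoint * 𝐃 - 1) * Φ = 0 := by
    rw [sub_mul, mul_assoc, mul_assoc, ← mul_assoc _ 𝐃, h.bType, mul_del_inv_mul_del, one_mul,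
      sub_self]
  have h2 := sub_eq_zero.1 (eq_zero_of_mul_monic h.monic h1)
  have h3 := congrArg (fun P => P * 𝐈) h2
  simpa only [mul_del_mul_del_inv, one_mul] using h3

/-- Operator form of the linear problem `w_t = (L^{2k+1})_+ w`. -/
theorem _root_.CMBKP.IsDressing.diff_add_mul_del {L : PDO (d 0)} (h : IsDressing d L Φ) (k : ℕ) :
    Φ.diff (d k) + Φ * del (d 0) ((2 * k + 1 : ℕ) : ℤ) = flowOp d L k * Φ := by
  rw [h.flow, flowOp_eq_sub, pow_eq, ← del_one_pow, ← conj_pow h.conj]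
  noncomm_ring

/-- The differential operator `P` such that `P Φ` is the coefficient of `z^{-m}` in the shifted wave
operator. -/
def shiftDiffOp (Φ : PDO (d 0)) (m : ℕ) : PDO (d 0) := shiftedWave Φ m * (𝐈 * Φ.adjoint * 𝐃)

section Dressing

variable {u v : R} (hd : ∀ i j a, d i (d j a) = d j (d i a)) (h : IsDressing d (laxOp d u v) Φ)

include h

theorem shiftDiffOp_mul (m : ℕ) : shiftDiffOp Φ m * Φ = shiftedWave Φ m := by
  rw [shiftDiffOp, mul_assoc, show 𝐈 * Φ.adjoint * 𝐃 * Φ = 𝐈 * (Φ.adjoint * 𝐃 * Φ) by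
    simp only [mul_assoc], h.bType, del_inv_mul_del, mul_one]

theorem shiftDiffOp_zero : shiftDiffOp Φ 0 = 1 := by
  have h0 : shiftedWave Φ 0 = Φ := by
    have h1 : shiftOp 0 Φ = Φ := by ext m; exact shiftCoeff_zero _
    have h2 : cayleyTerm d 0 = 1 := by
      simp only [cayleyTerm, cayleyCoeff]
      norm_num
      rfl
    simp [shiftedWave, h1, h2]
  rw [shiftDiffOp, h0, ← mul_assoc, ← mul_assoc, h.mul_del_inv_mul_adjoint, del_inv_mul_del]

include hd

/-- Right multiplication by the monic `Φ` is injective and carries this recursion to that of the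
shifted wave operator, replacing `(L^{2k+1})_+` by `∂^{2k+1}`. -/
theorem isShift_shiftDiffOp :
    IsShift (fun k => diffHom d k + mulRightHom (flowOp d (laxOp d u v) k)) (shiftDiffOp Φ) := by
  refine IsShift.of_map (mulRightHom Φ) (fun P Q hPQ => ?_)
    (T := fun k => diffHom d k + mulRightHom (del (d 0) ((2 * k + 1 : ℕ) : ℤ))) ?_ fun k i => ?_
  · rw [mulRightHom_apply, mulRightHom_apply, ← sub_eq_zero, ← sub_mul] at hPQ
    exact sub_eq_zero.1 (eq_zero_of_mul_monic h.monic hPQ)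
  · simp only [mulRightHom_apply, shiftDiffOp_mul h]
    exact isShift_shiftedWave hd Φ
  · simp only [AddMonoidHom.add_apply, diffHom_apply, mulRightHom_apply]
    rw [diff_mul (hd k 0), add_mul, mul_assoc _ _ Φ, ← h.diff_add_mul_del k]
    noncomm_ring

/-- The recursion starts at `1` and only differentiates coefficients and multiplies by differential
operators. -/
theorem isDiff_shiftDiffOp (m : ℕ) : (shiftDiffOp Φ m).IsDiff := by
  let K : Submodule ℂ (PDO (d 0)) :=
    { carrier := {P | P.IsDiff}
      add_mem' := fun hP hQ => hP.add hQ
      zero_mem' := fun _ _ => rfl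
      smul_mem' := fun c _ hP => hP.smul c }
  refine (isShift_shiftDiffOp hd h).mem K (fun k P hP => ?_) ?_ m
  · exact IsDiff.add (IsDiff.diff hP (d k)) (IsDiff.mul hP (isDiff_pos _))
  · rw [shiftDiffOp_zero h]
    exact isDiff_one

/-- The operator `shiftDiffOp Φ m` acts on eigenfunctions as the coefficient of `z^{-m}` in the
shift. -/
theorem shiftDiffOp_apply {f : R} (hf : ∀ k, d k f = (flowOp d (laxOp d u v) k).apply f) (m : ℕ) :
    (shiftDiffOp Φ m).apply f = shiftCoeff d m f := by
  have h1 : ∀ P : PDO (d 0), ((coeffHom (d 0) 0).comp (mulRightHom (𝐦 f))) P = P.apply f :=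
    fun P => (apply_eq P f).symm
  have h2 := (isShift_shiftDiffOp hd h).map (T := flowHom d)
    ((coeffHom (d 0) 0).comp (mulRightHom (𝐦 f))) fun k i => by
      rw [AddMonoidHom.add_apply, map_add, h1, h1, h1, diffHom_apply, mulRightHom_apply,
        (isDiff_shiftDiffOp hd h i).apply_mul (B := flowOp d (laxOp d u v) k)
          (isDiff_pos _), flowHom_apply]
      rw [← hf k, apply_eq, apply_eq, apply_eq, ← coeff_add, ← diff_mulOp, ← diff_mul (hd k 0),
        coeff_diff]
  simp only [h1] at h2
  refine h2.ext (isShift_shiftCoeff hd f) ?_ m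
  rw [shiftDiffOp_zero h, shiftCoeff_zero, apply_eq, one_mul, coeff_mulOp, if_pos rfl]

/-- Pair the shifted wave operator with `Φ`. Since `Φ ∂⁻¹ Φ^* = ∂⁻¹`, the residue is the value at
`1` of the differential operators, and constants are fixed by the shift. -/
theorem symbol_mul_oppositeWave : Φ.symbol * oppositeWave Φ = 1 := by
  ext m
  have h1 := res_shiftedWave hd h.monic (B := Φ) h.coeff_of_pos m
  have h2 : shiftedWave Φ m * 𝐈 * Φ.adjoint = shiftDiffOp Φ m * 𝐈 := by
    rw [← shiftDiffOp_mul h, mul_assoc _ Φ, mul_assoc, h.mul_del_inv_mul_adjoint]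
  have h3 := shiftDiffOp_apply hd h (f := 1) (fun k => by
    rw [Derivation.map_one_eq_zero, apply_one, (isBOp_flowOp_laxOp u v k).coeff_zero]) m
  rw [apply_one, shiftCoeff_one hd] at h3
  rw [h2, coeff_mul_del, h.coeff_zero, show (-1 : ℤ) - -1 = 0 by norm_num, h3] at h1
  refine eq_of_two_mul_eq ?_
  rw [PowerSeries.coeff_one]
  linear_combination -h1

variable (hu : ∀ k, d k u = (flowOp d (laxOp d u v) k).apply u)

include hu

/-- The same pairing with `∂⁻¹ u_x Φ`: integration by parts in `∂⁻¹ u_x ∂⁻¹` produces the values of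
the differential operators at `1` and at the eigenfunction `u`. -/
theorem two_mul_symbol_mul_oppositeWave :
    2 * ((𝐈 * 𝐦 (d 0 u) * Φ).symbol * oppositeWave Φ) = PowerSeries.C u - shiftSeries d u := by
  ext m
  have hB : (𝐈 * 𝐦 (d 0 u) * Φ).OrdLE (-1) :=
    (((ordLE_del (-1)).mul (ordLE_mulOp _)).mul (b := 0) h.coeff_of_pos).mono (by norm_num)
  have h1 := res_shiftedWave hd h.monic (hB.mono (by norm_num)) m
  have h2 : shiftedWave Φ m * 𝐈 * (𝐈 * 𝐦 (d 0 u) * Φ).adjoint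
      = shiftDiffOp Φ m * 𝐈 * 𝐦 u - shiftDiffOp Φ m * 𝐦 u * 𝐈 := by
    rw [adjoint_mul, adjoint_mul, adjoint_mulOp, adjoint_del_neg_one, ← shiftDiffOp_mul h]
    calc _ = -(shiftDiffOp Φ m * (Φ * 𝐈 * Φ.adjoint * 𝐦 (d 0 u) * 𝐈)) := by noncomm_ring
      _ = _ := by
        rw [h.mul_del_inv_mul_adjoint, del_inv_mul_deriv_mul_del_inv]
        noncomm_ring
  have h3 := shiftDiffOp_apply hd h (f := 1) (fun k => by
    rw [Derivation.map_one_eq_zero, apply_one, (isBOp_flowOp_laxOp u v k).coeff_zero]) m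
  rw [apply_one, shiftCoeff_one hd] at h3
  rw [h2, coeff_sub, res_mul_mulOp, res_mul_mulOp_mul_del_inv, coeff_mul_del,
    show (-1 : ℤ) - -1 = 0 by norm_num, h3, shiftDiffOp_apply hd h hu, hB 0 (by norm_num)] at h1
  have h4 : PowerSeries.coeff m (2 * ((𝐈 * 𝐦 (d 0 u) * Φ).symbol * oppositeWave Φ))
      = 2 * PowerSeries.coeff m ((𝐈 * 𝐦 (d 0 u) * Φ).symbol * oppositeWave Φ) := by
    rw [two_mul, map_add, two_mul]
  rw [h4, map_sub, PowerSeries.coeff_C, shiftSeries, PowerSeries.coeff_mk]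
  simp only [ite_self, sub_zero, ite_mul, one_mul, zero_mul] at h1
  exact h1.symm

/-- The symbol of `T Φ` is that of `Φ` minus `2r` times that of `∂⁻¹ u_x Φ`; the two pairing
identities eliminate the latter and the opposite wave. -/
theorem symbol_stepOp_mul {r : R} (hr : u * r = 1) :
    PowerSeries.C u * (stepOp d u r * Φ).symbol = shiftSeries d u * Φ.symbol := by
  have h1 : (stepOp d u r * Φ).symbol
      = Φ.symbol - PowerSeries.C (2 * r) * (𝐈 * 𝐦 (d 0 u) * Φ).symbol := by
    ext m
    rw [map_sub, PowerSeries.coeff_C_mul, coeff_symbol, coeff_symbol, coeff_symbol, stepOp, sub_mul,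
      one_mul, coeff_sub, mul_assoc, mul_assoc, coeff_mulOp_mul, ← mul_assoc]
  have h2 := symbol_mul_oppositeWave hd h
  have h3 := two_mul_symbol_mul_oppositeWave hd h hu
  have h4 : (PowerSeries.C u : PowerSeries R) * PowerSeries.C (2 * r) = 2 := by
    rw [← map_mul, show u * (2 * r) = 2 by linear_combination 2 * hr, map_ofNat]
  rw [h1]
  linear_combination (-Φ.symbol) * h3 - (𝐈 * 𝐦 (d 0 u) * Φ).symbol * h4
    + 2 * (𝐈 * 𝐦 (d 0 u) * Φ).symbol * h2

end Dressing

theorem isTauC_iff {τ : R} : IsTauC d Φ τ ↔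
    IsUnit τ ∧ PowerSeries.C τ * Φ.symbol ^ 2 = shiftSeries d τ := by
  have h : ∀ m, PowerSeries.coeff m (PowerSeries.C τ * Φ.symbol ^ 2)
      = τ * ∑ i ∈ Finset.range (m + 1), Φ.coeff (-(i : ℤ)) * Φ.coeff (-((m : ℤ) - i)) := by
    intro m
    rw [PowerSeries.coeff_C_mul, sq, PowerSeries.coeff_mul,
      Finset.Nat.sum_antidiagonal_eq_sum_range_succ_mk]
    congr 1
    refine Finset.sum_congr rfl fun i hi => ?_
    rw [coeff_symbol, coeff_symbol, Nat.cast_sub (by have := Finset.mem_range.1 hi; omega)]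
  constructor
  · intro H
    refine ⟨H.unit, ?_⟩
    ext m
    rw [h, H.wave, shiftSeries, PowerSeries.coeff_mk]
  · rintro ⟨h1, h2⟩
    refine ⟨h1, fun m => ?_⟩
    rw [← h, h2, shiftSeries, PowerSeries.coeff_mk]

theorem isTau_iff {τ : R} : IsTau d Φ τ ↔
    IsUnit τ ∧ PowerSeries.C τ * Φ.symbol = shiftSeries d τ := by
  constructor
  · intro H
    refine ⟨H.unit, ?_⟩
    ext m
    rw [PowerSeries.coeff_C_mul, coeff_symbol, H.wave, shiftSeries, PowerSeries.coeff_mk]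
  · rintro ⟨h1, h2⟩
    refine ⟨h1, fun m => ?_⟩
    rw [← coeff_symbol, ← PowerSeries.coeff_C_mul, h2, shiftSeries, PowerSeries.coeff_mk]

theorem _root_.CMBKP.IsTauC.step (hd : ∀ i j a, d i (d j a) = d j (d i a)) {u v r τ : R}
    (h : IsDressing d (laxOp d u v) Φ)
    (hu : ∀ k, d k u = (flowOp d (laxOp d u v) k).apply u) (hr : u * r = 1)
    (hτ : IsTauC d Φ τ) : IsTauC d (stepOp d u r * Φ) (u * u * τ) := by
  rw [isTauC_iff] at hτ ⊢
  have hU : IsUnit u := .of_mul_eq_one _ hr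
  refine ⟨(hU.mul hU).mul hτ.1, ?_⟩
  have h1 := symbol_stepOp_mul hd h hu hr
  rw [shiftSeries_mul hd, shiftSeries_mul hd, ← hτ.2, map_mul, map_mul]
  linear_combination (PowerSeries.C τ * PowerSeries.C u * (stepOp d u r * Φ).symbol
    + PowerSeries.C τ * shiftSeries d u * Φ.symbol) * h1

theorem _root_.CMBKP.IsTauC.of_smul {c : ℂ} (hc : c ≠ 0) {τ σ : R} (hτ : IsTauC d Φ τ)
    (h : c • σ = τ) : IsTauC d Φ σ := by
  have h' : σ = c⁻¹ • τ := by rw [← h, inv_smul_smul₀ hc]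
  subst h'
  refine ⟨?_, fun m => ?_⟩
  · rw [Algebra.smul_def]
    exact ((IsUnit.mk0 _ (inv_ne_zero hc)).map (algebraMap ℂ R)).mul hτ.unit
  · rw [smul_mul_assoc, hτ.wave]
    simp only [shiftCoeff, map_smul, Finset.smul_sum]
    exact Finset.sum_congr rfl fun _ _ => smul_comm _ _ _

theorem _root_.CMBKP.IsTau.sq (hd : ∀ i j a, d i (d j a) = d j (d i a)) {τ : R}
    (h : IsTau d Φ τ) : IsTauC d Φ (τ ^ 2) := by
  rw [isTau_iff] at h
  rw [isTauC_iff]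
  refine ⟨h.1.pow 2, ?_⟩
  rw [pow_two τ, shiftSeries_mul hd, ← h.2, map_mul]
  ring

/-- A difference of two squares vanishes, and one of its factors has the invertible constant term
`2σ`. -/
theorem _root_.CMBKP.IsTauC.sqrt (hd : ∀ i j a, d i (d j a) = d j (d i a)) {σ : R}
    (hΦ : Φ.coeff 0 = 1) (h : IsTauC d Φ (σ ^ 2)) : IsTau d Φ σ := by
  rw [isTauC_iff] at h
  rw [isTau_iff]
  have hσ : IsUnit σ := (isUnit_pow_iff two_ne_zero).1 h.1
  refine ⟨hσ, ?_⟩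
  have h2 : IsUnit (2 : R) := by
    have := (IsUnit.mk0 (2 : ℂ) two_ne_zero).map (algebraMap ℂ R)
    rwa [map_ofNat] at this
  have hU : IsUnit (PowerSeries.C σ * Φ.symbol + shiftSeries d σ) := by
    rw [PowerSeries.isUnit_iff_constantCoeff, ← PowerSeries.coeff_zero_eq_constantCoeff_apply,
      map_add, PowerSeries.coeff_C_mul, coeff_symbol, shiftSeries, PowerSeries.coeff_mk,
      shiftCoeff_zero, Nat.cast_zero, neg_zero, hΦ, mul_one, ← two_mul]
    exact h2.mul hσ
  have h3 := h.2
  rw [pow_two σ, shiftSeries_mul hd, map_mul] at h3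
  rw [← sub_eq_zero, ← hU.mul_right_eq_zero]
  linear_combination h3

end Wave

end PDO

end CMBKP

end

/-! ### Tau functions of the iterated transformation, and the coupled systems. -/

noncomputable section

namespace CMBKP

namespace IntegrationClass

open PDO

section Tau

variable {R : Type*} [CommRing R] [Algebra ℂ R] {d : ℕ → Derivation ℂ R R}
variable {J : IntegrationClass d} {u v : R} (hd : ∀ i j a, d i (d j a) = d j (d i a))
  (hu : u ∈ J.dec) (hv : v ∈ J.reg) (h : IsConstrainedSolution d u v) {n : ℕ}

include hd hu hv h

theorem isTauC_lev (hn : ∀ k, k ≤ n → IsUnit (J.tauFactor u v k)) {Φ : PDO (d 0)}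
    (hΦ : IsDressing d (laxOp d u v) Φ) {τ : R} (hτ : IsTauC d Φ τ) :
    IsTauC d (J.gaugeOp u v n * Φ) (J.tauFactor u v n * τ) := by
  induction n with
  | zero =>
    rw [tauFactor_zero, one_mul]
    exact (one_mul Φ).symm ▸ hτ
  | succ n ih =>
    have hn' : ∀ k, k ≤ n → IsUnit (J.tauFactor u v k) := fun k hk => hn k (by omega)
    have h1 := IsTauC.step hd
      ((isGaugeTransformation_lev hd hu hv h hn').isDressing hd hΦ)
      (fun k => (isConstrainedSolution_lev hd hu hv h hn' k).1)
      (Ring.mul_inverse_cancel _ (isUnit_uNew hd hu hv h hn)) (ih hn')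
    rw [gaugeOp_succ hd hu hv h hn, mul_assoc]
    -- By `tauFactor_succ`, this constant times `GW_{n+1}` is `u_n² GW_n`; constant factors do not
    -- affect the tau property.
    refine h1.of_smul (c := (-1) ^ n * 2)
      (mul_ne_zero (pow_ne_zero _ (by norm_num)) two_ne_zero) ?_
    have h2 := tauFactor_succ hd hu hv h hn'
    have h3 : ((-1 : R) ^ n) * (-1) ^ n = 1 := by rw [← mul_pow]; simp
    rw [Algebra.smul_def, map_mul, map_pow, map_neg, map_one, map_ofNat]
    linear_combination (-1) ^ n * τ * h2
      + J.uNew u v n * J.uNew u v n * J.tauFactor u v n * τ * h3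

theorem isTau_lev (hn : ∀ k, k ≤ n → IsUnit (J.tauFactor u v k)) {Φ : PDO (d 0)}
    (hΦ : IsDressing d (laxOp d u v) Φ) {τ σ : R} (hτ : IsTau d Φ τ)
    (hσ : σ ^ 2 = J.tauFactor u v n * τ ^ 2) :
    IsTau d (J.gaugeOp u v n * Φ) σ := by
  refine IsTauC.sqrt hd
    ((isGaugeTransformation_lev hd hu hv h hn).isDressing hd hΦ).coeff_zero ?_
  rw [hσ]
  exact isTauC_lev hd hu hv h hn hΦ (hτ.sq hd)

end Tau

end IntegrationClass

/-! ## The coupled systems for `N = 2` -/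

section SecondFlow

open PDO

variable {R : Type*} [CommRing R] [Algebra ℂ R] (d : ℕ → Derivation ℂ R R)

local notation "𝐃" => PDO.del (d 0) 1
local notation "𝐈" => PDO.del (d 0) (-1)
local notation "𝐦" => PDO.mulOp (d 0)

theorem res_laxOp (u v : R) : (laxOp d u v).coeff (-1) = u * d 0 v - v * d 0 u := by
  rw [laxOp, PDO.coeff_sub, PDO.coeff_add, res_mul_mulOp, res_mul_mulOp, coeff_mulOp_mul_del,
    coeff_mulOp_mul_del, if_pos rfl, if_pos rfl, coeff_del, if_neg (by norm_num), zero_add]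

/-- `(L³)_+ = ∂³ + 3 (u v_x - v u_x) ∂`. -/
theorem flowOp_laxOp_one (u v : R) :
    flowOp d (laxOp d u v) 1 = 𝐃 * (𝐃 * 𝐃) + 𝐦 (3 * (u * d 0 v - v * d 0 u)) * 𝐃 := by
  set L := laxOp d u v with hL
  set q := u * d 0 v - v * d 0 u with hq
  obtain ⟨M, hM, hLM⟩ : ∃ M : PDO (d 0), M.OrdLE (-2) ∧ L = 𝐃 + 𝐦 q * 𝐈 + M := by
    refine ⟨L - 𝐃 - 𝐦 q * 𝐈, fun m hm => ?_, by abel⟩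
    rw [PDO.coeff_sub, PDO.coeff_sub, coeff_del, coeff_mulOp_mul_del]
    by_cases h : m = -1
    · rw [h, if_neg (by norm_num), if_pos rfl, hL, res_laxOp, sub_zero, sub_self]
    · rw [hL, coeff_laxOp u v (by omega), if_neg h, sub_self, sub_zero]
  have hqI : (𝐦 q * 𝐈).OrdLE (-1) := (ordLE_mulOp q).mul (ordLE_del (-1))
  have hN : (𝐦 q * 𝐈 + M).OrdLE (-1) := hqI.add (hM.mono (by norm_num))
  set E : PDO (d 0) := 𝐦 (d 0 q) * 𝐈 + 𝐃 * M + M * 𝐃 + (𝐦 q * 𝐈 + M) * (𝐦 q * 𝐈 + M) with hE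
  have hEo : E.OrdLE (-1) :=
    ((((ordLE_mulOp _).mul (ordLE_del (-1))).add ((ordLE_del 1).mul hM)).add
      (hM.mul (ordLE_del 1))).add ((hN.mul hN).mono (by norm_num))
  have h2 : L * L = 𝐃 * 𝐃 + 2 * 𝐦 q + E := by
    have e1 : 𝐃 * (𝐦 q * 𝐈) = 𝐦 q + 𝐦 (d 0 q) * 𝐈 := by
      rw [← mul_assoc, del_mul_mulOp, add_mul, mul_del_mul_del_inv]
    have e2 := mul_del_inv_mul_del (𝐦 q)
    calc L * L = 𝐃 * 𝐃 + 𝐃 * (𝐦 q * 𝐈) + 𝐦 q * 𝐈 * 𝐃 + 𝐃 * M + M * 𝐃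
          + (𝐦 q * 𝐈 + M) * (𝐦 q * 𝐈 + M) := by rw [hLM]; noncomm_ring
      _ = _ := by rw [e1, e2, hE]; noncomm_ring
  have h3 : (L ^ 3 - (𝐃 * (𝐃 * 𝐃) + 𝐦 (3 * q) * 𝐃)).OrdLE 0 := by
    have e1 := del_mul_mulOp (δ := d 0) q
    have e2 : 𝐦 q * 𝐈 * (𝐃 * 𝐃) = 𝐦 q * 𝐃 := by rw [← mul_assoc, mul_del_inv_mul_del]
    have e3 : 𝐦 (3 * q) = 𝐦 q + 𝐦 q + 𝐦 q := by
      rw [← mulOp_add, ← mulOp_add]; congr 1; ring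
    have e4 : L ^ 3 - (𝐃 * (𝐃 * 𝐃) + 𝐦 (3 * q) * 𝐃)
        = (𝐦 (d 0 q) + 𝐦 (d 0 q)) + 𝐃 * E + M * (𝐃 * 𝐃)
          + (𝐦 q * 𝐈 + M) * (𝐦 q + 𝐦 q + E) := by
      calc _ = (𝐃 + 𝐦 q * 𝐈 + M) * (L * L) - (𝐃 * (𝐃 * 𝐃) + 𝐦 (3 * q) * 𝐃) := by
            rw [pow_succ', pow_two, ← hLM]
        _ = 𝐃 * 𝐦 q + 𝐃 * 𝐦 q + 𝐃 * E + 𝐦 q * 𝐈 * (𝐃 * 𝐃) + M * (𝐃 * 𝐃)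
            + (𝐦 q * 𝐈 + M) * (𝐦 q + 𝐦 q + E) - 𝐦 (3 * q) * 𝐃 := by rw [h2]; noncomm_ring
        _ = _ := by rw [e1, e2, e3]; noncomm_ring
    rw [e4]
    exact (((((ordLE_mulOp _).add (ordLE_mulOp _))).add ((ordLE_del 1).mul hEo)).add
      (hM.mul ((ordLE_del 1).mul (ordLE_del 1)))).add
      ((hN.mul (((ordLE_mulOp _).add (ordLE_mulOp _)).add
        (hEo.mono (by norm_num)))).mono (by norm_num))
  ext m
  rcases lt_trichotomy m 0 with hm | rfl | hm
  · rw [(isBOp_flowOp_laxOp u v 1).isDiff m hm]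
    exact ((((isDiff_del 1).mul ((isDiff_del 1).mul (isDiff_del 1))).add
      ((isDiff_mulOp _).mul (isDiff_del 1))) m hm).symm
  -- The expansion of `L³` is controlled only in positive orders; the constant term vanishes by the
  -- B type condition.
  · rw [(isBOp_flowOp_laxOp u v 1).coeff_zero, PDO.coeff_add, coeff_mulOp_mul_del, ← mul_assoc,
      coeff_mul_del, coeff_mul_del, coeff_del]
    norm_num
  · have := h3 m hm
    rw [PDO.coeff_sub, sub_eq_zero] at this
    rw [flowOp, pow_eq, coeff_pos, if_pos hm.le]
    exact this

theorem flowOp_laxOp_one_apply (u v f : R) :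
    (flowOp d (laxOp d u v) 1).apply f
      = (d 0)^[3] f + 3 * (u * d 0 v - v * d 0 u) * d 0 f := by
  have h1 : (𝐃 * (𝐃 * 𝐃)).apply f = (d 0)^[3] f := by
    have hD : (𝐃).IsDiff := isDiff_del 1
    rw [hD.apply_mul (hD.mul hD), hD.apply_mul hD, del_apply, del_apply, del_apply]
    rfl
  rw [flowOp_laxOp_one, apply_eq, add_mul, PDO.coeff_add, ← apply_eq, h1, mul_assoc,
    coeff_mulOp_mul, ← apply_eq, del_apply]

end SecondFlow

section ZNSystem

open PDO

variable {A : Type*} [CommRing A]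

/-- The element `a + b Γ` of `A[Γ]/(Γ²)`. -/
def dual (a b : A) : ZN 2 A := scal 2 a + scal 2 b * Gam 2 A

theorem dual_eq_mk (a b : A) : dual a b = AdjoinRoot.mk ((X : A[X]) ^ 2) (C a + C b * X) := by
  rw [map_add, map_mul]
  rfl

theorem dual_inj {a b a' b' : A} : dual a b = dual a' b' ↔ a = a' ∧ b = b' := by
  rw [dual_eq_mk, dual_eq_mk, AdjoinRoot.mk_eq_mk, X_pow_dvd_iff]
  constructor
  · intro h
    have h0 := h 0 (by norm_num)
    have h1 := h 1 (by norm_num)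
    simp only [Polynomial.coeff_sub, Polynomial.coeff_add, coeff_C_mul, coeff_C, coeff_X] at h0 h1
    norm_num at h0 h1
    exact ⟨sub_eq_zero.1 h0, sub_eq_zero.1 h1⟩
  · rintro ⟨rfl, rfl⟩ m _
    rw [sub_self, coeff_zero]

theorem dual_add (a b a' b' : A) : dual a b + dual a' b' = dual (a + a') (b + b') := by
  rw [dual_eq_mk, dual_eq_mk, dual_eq_mk, ← map_add]
  congr 1
  simp only [C_add]
  ring

theorem dual_sub (a b a' b' : A) : dual a b - dual a' b' = dual (a - a') (b - b') := by
  rw [dual_eq_mk, dual_eq_mk, dual_eq_mk, ← map_sub]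
  congr 1
  simp only [C_sub]
  ring

theorem dual_mul (a b a' b' : A) : dual a b * dual a' b' = dual (a * a') (a * b' + b * a') := by
  rw [dual_eq_mk, dual_eq_mk, dual_eq_mk, ← map_mul, AdjoinRoot.mk_eq_mk]
  -- The product of the representatives exceeds the right-hand one by `b b' Γ²`.
  refine ⟨C (b * b'), ?_⟩
  simp only [C_add, C_mul]
  ring

theorem three_mul_dual (a b : A) : 3 * dual a b = dual (3 * a) (3 * b) := by
  rw [show (3 : ZN 2 A) * dual a b = dual a b + dual a b + dual a b by ring, dual_add, dual_add]
  congr 1 <;> ring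

variable [Algebra ℂ A]

theorem znDer_comm {D E : Derivation ℂ A A} (h : ∀ a, D (E a) = E (D a)) (N : ℕ) (x : ZN N A) :
    znDer N D (znDer N E x) = znDer N E (znDer N D x) := by
  obtain ⟨p, rfl⟩ := AdjoinRoot.mk_surjective x
  rw [znDer_mk, znDer_mk, znDer_mk, znDer_mk]
  congr 1
  ext i
  simp only [coeffDer_coeff, h]

theorem znDer_dual (D : Derivation ℂ A A) (a b : A) :
    znDer 2 D (dual a b) = dual (D a) (D b) := by
  rw [dual_eq_mk, dual_eq_mk, znDer_mk]
  congr 1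
  ext i
  rw [coeffDer_coeff]
  simp only [Polynomial.coeff_add, coeff_C_mul, coeff_C, coeff_X]
  split_ifs <;> simp

theorem satoFlow_one_iff (D : ℕ → Derivation ℂ A A) (q p r s : A) :
    SatoFlow (fun k => znDer 2 (D k)) 1 (dual q p) (dual r s) ↔
      D 1 q = (D 0)^[3] q + 3 * (q * D 0 r - r * D 0 q) * D 0 q ∧
      D 1 p = (D 0)^[3] p + 3 * ((q * D 0 r - r * D 0 q) * D 0 p
        + (p * D 0 r + q * D 0 s - s * D 0 q - r * D 0 p) * D 0 q) ∧
      D 1 r = (D 0)^[3] r + 3 * (q * D 0 r - r * D 0 q) * D 0 r ∧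
      D 1 s = (D 0)^[3] s + 3 * ((q * D 0 r - r * D 0 q) * D 0 s
        + (p * D 0 r + q * D 0 s - s * D 0 q - r * D 0 p) * D 0 r) := by
  have h : ∀ a b, (flowOp (fun k => znDer 2 (D k))
      (laxOp (fun k => znDer 2 (D k)) (dual q p) (dual r s)) 1).apply (dual a b)
        = dual ((D 0)^[3] a + 3 * (q * D 0 r - r * D 0 q) * D 0 a)
          ((D 0)^[3] b + 3 * ((q * D 0 r - r * D 0 q) * D 0 b
            + (p * D 0 r + q * D 0 s - s * D 0 q - r * D 0 p) * D 0 a)) := by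
    intro a b
    rw [flowOp_laxOp_one_apply]
    simp only [Function.iterate_succ, Function.iterate_zero, Function.comp_apply, id_eq, znDer_dual,
      dual_mul, dual_sub, dual_add, three_mul_dual]
    congr 1
    ring
  rw [SatoFlow, h, h]
  simp only [znDer_dual, dual_inj, and_assoc]

end ZNSystem

end CMBKP

end

theorem mainTheorem6 {A : Type*} [CommRing A] [Algebra ℂ A] (D : ℕ → Derivation ℂ A A)
    (hD : ∀ (i j : ℕ) (a : A), D i (D j a) = D j (D i a)) :
    -- the case `N = 2`: the `t₃`-flow is a coupled system
    (∀ q p r s : A,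
      CMBKP.SatoFlow (fun k => CMBKP.znDer 2 (D k)) 1
          (CMBKP.scal 2 q + CMBKP.scal 2 p * CMBKP.Gam 2 A)
          (CMBKP.scal 2 r + CMBKP.scal 2 s * CMBKP.Gam 2 A) ↔
        D 1 q = (D 0)^[3] q + 3 * (q * D 0 r - r * D 0 q) * D 0 q ∧
        D 1 p = (D 0)^[3] p + 3 * ((q * D 0 r - r * D 0 q) * D 0 p
          + (p * D 0 r + q * D 0 s - s * D 0 q - r * D 0 p) * D 0 q) ∧
        D 1 r = (D 0)^[3] r + 3 * (q * D 0 r - r * D 0 q) * D 0 r ∧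
        D 1 s = (D 0)^[3] s + 3 * ((q * D 0 r - r * D 0 q) * D 0 s
          + (p * D 0 r + q * D 0 s - s * D 0 q - r * D 0 p) * D 0 r)) ∧
    (∀ q p : A,
      CMBKP.SatoFlow (fun k => CMBKP.znDer 2 (D k)) 1
          (CMBKP.scal 2 q + CMBKP.scal 2 p * CMBKP.Gam 2 A)
          (CMBKP.scal 2 q + CMBKP.scal 2 p * CMBKP.Gam 2 A) ↔
        D 1 q = (D 0)^[3] q ∧ D 1 p = (D 0)^[3] p) ∧
    (∀ q p : A,
      CMBKP.SatoFlow (fun k => CMBKP.znDer 2 (D k)) 1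
          (CMBKP.scal 2 q + CMBKP.scal 2 p * CMBKP.Gam 2 A)
          (1 + CMBKP.Gam 2 A) ↔
        D 1 q = (D 0)^[3] q - 3 * (D 0 q) ^ 2 ∧
        D 1 p = (D 0)^[3] p - 6 * D 0 q * D 0 p - 3 * (D 0 q) ^ 2) ∧
    -- the iterated gauge transformations, for every `N`
    (∀ (N : ℕ) (J : CMBKP.IntegrationClass (fun k => CMBKP.znDer N (D k))) (u v : CMBKP.ZN N A),
      u ∈ J.dec → v ∈ J.reg → CMBKP.IsConstrainedSolution (fun k => CMBKP.znDer N (D k)) u v →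
      ∀ n : ℕ, 1 ≤ n → (∀ k, k ≤ n → IsUnit (J.tauFactor u v k)) →
        CMBKP.IsConstrainedSolution (fun k => CMBKP.znDer N (D k))
          (J.uNew u v n) (J.vNew u v n) ∧
        CMBKP.IsLaxSolution (fun k => CMBKP.znDer N (D k))
          (CMBKP.laxOp (fun k => CMBKP.znDer N (D k)) (J.uNew u v n) (J.vNew u v n)) ∧
        CMBKP.IsGaugeTransformation (fun k => CMBKP.znDer N (D k))
          (CMBKP.laxOp (fun k => CMBKP.znDer N (D k)) u v)
          (CMBKP.laxOp (fun k => CMBKP.znDer N (D k)) (J.uNew u v n) (J.vNew u v n))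
          (J.gaugeOp u v n) ∧
        ∀ Φ : CMBKP.PDO (CMBKP.znDer N (D 0)),
          CMBKP.IsDressing (fun k => CMBKP.znDer N (D k))
            (CMBKP.laxOp (fun k => CMBKP.znDer N (D k)) u v) Φ →
          CMBKP.IsDressing (fun k => CMBKP.znDer N (D k))
            (CMBKP.laxOp (fun k => CMBKP.znDer N (D k)) (J.uNew u v n) (J.vNew u v n))
            (J.gaugeOp u v n * Φ) ∧
          (∀ τc : CMBKP.ZN N A, CMBKP.IsTauC (fun k => CMBKP.znDer N (D k)) Φ τc →
            CMBKP.IsTauC (fun k => CMBKP.znDer N (D k)) (J.gaugeOp u v n * Φ)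
              (J.tauFactor u v n * τc)) ∧
          (∀ τ σ : CMBKP.ZN N A, CMBKP.IsTau (fun k => CMBKP.znDer N (D k)) Φ τ →
            σ ^ 2 = J.tauFactor u v n * τ ^ 2 →
            CMBKP.IsTau (fun k => CMBKP.znDer N (D k)) (J.gaugeOp u v n * Φ) σ)) := by
  refine ⟨CMBKP.satoFlow_one_iff D, fun q p => ?_, fun q p => ?_, ?_⟩
  · refine (CMBKP.satoFlow_one_iff D q p q p).trans ?_
    rw [show (q * D 0 q - q * D 0 q) = 0 by ring,
      show p * D 0 q + q * D 0 p - p * D 0 q - q * D 0 p = 0 by ring]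
    simp only [mul_zero, zero_mul, add_zero]
    tauto
  · have h : (1 : CMBKP.ZN 2 A) + CMBKP.Gam 2 A = CMBKP.dual 1 1 := by
      rw [CMBKP.dual, CMBKP.scal, map_one, one_mul]
    rw [h]
    refine (CMBKP.satoFlow_one_iff D q p 1 1).trans ?_
    simp only [Derivation.map_one_eq_zero, Function.iterate_succ, Function.comp_apply,
      Function.iterate_zero, id_eq, map_zero, mul_zero, add_zero, and_true]
    refine and_congr (Eq.congr_right ?_) (Eq.congr_right ?_) <;> ring
  · intro N J u v hu hv h n hn1 hn
    have hd : ∀ i j a, CMBKP.znDer N (D i) (CMBKP.znDer N (D j) a)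
        = CMBKP.znDer N (D j) (CMBKP.znDer N (D i) a) := fun i j a =>
      CMBKP.znDer_comm (hD i j) N a
    have hV := CMBKP.IntegrationClass.levelV_eq hd hu hv h hn (by omega)
    have hS := CMBKP.IntegrationClass.isConstrainedSolution_lev hd hu hv h hn
    have hG := CMBKP.IntegrationClass.isGaugeTransformation_lev hd hu hv h hn
    rw [hV] at hS hG
    exact ⟨hS, CMBKP.PDO.isLaxSolution_of_isConstrainedSolution hd hS, hG, fun Φ hΦ =>
      ⟨hG.isDressing hd hΦ,
        fun τc hτ => CMBKP.IntegrationClass.isTauC_lev hd hu hv h hn hΦ hτ,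
        fun τ σ hτ hσ => CMBKP.IntegrationClass.isTau_lev hd hu hv h hn hΦ hτ hσ⟩⟩
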